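/- Let $G$ be a countable discrete group and let $K$ be a compact metrizable space. A $W^*$-bundle over $K$ is a unital $C^*$-algebra $\mathcal M$ with a unital inclusion of $C(K)$ into its center and a faithful conditional expectation $E\colon\mathcal M\to C(K)$ with $E(ab)=E(ba)$, such that the closed unit ball of $\mathcal M$ is complete in the uniform 2-norm $\|a\|_{2,u}=\|E(a^*a)\|^{1/2}$. It is strictly separable if $\mathcal M$ has a countable $\|\cdot\|_{2,u}$-dense subset. A fiber-wise action $\gamma\colon G\to\mathrm{Aut}(\mathcal M)$ is an action with $\gamma_g\circ E=E=E\circ\gamma_g$ for all $g\in G$. For $\lambda\in K$, let $\tau_\lambda=\mathrm{ev}_\lambda\circ E$, let $\pi_\lambda$ be its GNS representation, let $\mathcal M_\lambda=\pi_\lambda(\mathcal M)$ be the fiber, and let $\gamma^\lambda$ be the action of $G$ on $\mathcal M_\lambda$ that makes $\pi_\lambda$ equivariant. Let $\mathcal R$ be the hyperfinite II$_1$-factor with trace $\tau$. The bundle $\mathcal M\overline\otimes\mathcal R$ over $K$ is the strict completion of $\mathcal M\otimes\mathcal R$ (operator-norm bounded $\|\cdot\|_{2,u}$-Cauchy sequences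 modulo $\|\cdot\|_{2,u}$-null sequences) with respect to $E\otimes\tau$; fiber-wise actions $\gamma$ on $\mathcal M$ and $\delta$ on $\mathcal R$ induce the action $\gamma\otimes\delta$ on it. The fibers and $\mathcal R$ are regarded as bundles over a point. Fiber-wise actions $\gamma$ on $\mathcal M$ and $\beta$ on $\mathcal N$ (bundles over the same space) are cocycle conjugate if there are unitaries $u_g\in\mathcal M$ with $u_{gh}=u_g\gamma_g(u_h)$ for all $g,h\in G$, and a $*$-isomorphism $\varphi\colon\mathcal M\to\mathcal N$ with $E_{\mathcal N}\circ\varphi=E_{\mathcal M}$ and $\beta_g\circ\varphi=\varphi\circ\mathrm{Ad}(u_g)\circ\gamma_g$ for all $g\in G$. An action $\delta\colon G\to\mathrm{Aut}(\mathcal R)$ is strongly McDuff if there are an equivariant isomorphism $\varphi\colon(\mathcal R,\delta)\to(\mathcal R\overline\otimes\mathcal R,\delta\otimes\delta)$ and unitaries $w_n\in\mathcal R\overline\otimes\mathcal R$ with $\|w_n\varphi(x)w_n^*-1\otimes x\|_2\to0$ and $\|(\delta_g\otimes\delta_g)(w_n)-w_n\|_2\to0$ for all $x\in\mathcal R$,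 $g\in G$. It is McDuff if it is cocycle conjugate to a strongly McDuff action on $\mathcal R$. Theorem. Let $\mathcal M$ be a strictly separable $W^*$-bundle over $K$, let $\gamma\colon G\to\mathrm{Aut}(\mathcal M)$ be a fiber-wise action, and let $\delta\colon G\to\mathrm{Aut}(\mathcal R)$ be a McDuff action. If $\gamma^\lambda\colon G\to\mathrm{Aut}(\mathcal M_\lambda)$ is cocycle conjugate to $\gamma^\lambda\otimes\delta\colon G\to\mathrm{Aut}(\mathcal M_\lambda\overline\otimes\mathcal R)$ for every $\lambda\in K$, then $\gamma\otimes\mathrm{id}_{\mathcal R}\colon G\to\mathrm{Aut}(\mathcal M\overline\otimes\mathcal R)$ is cocycle conjugate to $\gamma\otimes\mathrm{id}_{\mathcal R}\otimes\delta\colon G\to\mathrm{Aut}(\mathcal M\overline\otimes\mathcal R\overline\otimes\mathcal R)$. -/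

import Mathlib

open scoped ComplexOrder TensorProduct
open Filter Topology

universe u v w

/-! ### Tracial `*`-algebras over a compact space

The common algebraic data behind `W^*`-bundles, their fibers and their tensor products. -/

/-- A unital `*`-algebra `A` with a unital positive tracial map `E : A → C(K)` (equivalently, a
continuous field of tracial states `τ_k = ev_k ∘ E`). -/
structure TracialAlgebra (K : Type u) [TopologicalSpace K] (A : Type v) [Ring A] [StarRing A]
    [Algebra ℂ A] [StarModule ℂ A] where
  E : A →ₗ[ℂ] C(K, ℂ)
  E_one : E 1 = 1
  E_nonneg : ∀ a k, 0 ≤ E (star a * a) k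
  E_comm : ∀ a b, E (a * b) = E (b * a)

namespace TracialAlgebra

section basic

variable {K : Type u} [TopologicalSpace K] {A : Type v} [Ring A] [StarRing A]
  [Algebra ℂ A] [StarModule ℂ A] (B : TracialAlgebra K A)

/-- The seminorm `‖a‖_{2,τ_k} = τ_k(a* a)^{1/2}`. -/
noncomputable def seminorm (k : K) (a : A) : ℝ := √(B.E (star a * a) k).re

/-- `‖π(a)‖ ≤ C`, where `π` is the left regular representation of `A` on the Hilbert
`C(K)`-module of `E` (equivalently, in all the GNS representations of the `τ_k`). -/
def OpBound (C : ℝ) (a : A) : Prop :=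
  0 ≤ C ∧ ∀ b k, B.seminorm k (a * b) ≤ C * B.seminorm k b

theorem E_star (a : A) (k : K) : B.E (star a) k = starRingEnd ℂ (B.E a k) := by
  have h0 : (B.E (star a * a) k).im = 0 := ((Complex.nonneg_iff.1 (B.E_nonneg a k)).2).symm
  have h1 : (B.E (star (1 + a) * (1 + a)) k).im = 0 :=
    ((Complex.nonneg_iff.1 (B.E_nonneg (1 + a) k)).2).symm
  have h2 : (B.E (star (1 + Complex.I • a) * (1 + Complex.I • a)) k).im = 0 :=
    ((Complex.nonneg_iff.1 (B.E_nonneg (1 + Complex.I • a) k)).2).symm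
  simp only [star_add, star_one, add_mul, mul_add, one_mul, mul_one, map_add, star_smul,
    smul_mul_assoc, mul_smul_comm, map_smul, B.E_one, ContinuousMap.add_apply,
    ContinuousMap.one_apply, ContinuousMap.smul_apply, Complex.add_im, Complex.one_im, h0,
    smul_eq_mul, Complex.star_def, Complex.conj_I, Complex.mul_im, Complex.mul_re, Complex.I_re,
    Complex.I_im, Complex.neg_re, Complex.neg_im] at h1 h2
  apply Complex.ext
  · rw [Complex.conj_re]; linarith
  · rw [Complex.conj_im]; linarith

/-- The semi-inner product `⟨a, b⟩ = τ_k(a* b)`. -/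
noncomputable abbrev core (k : K) : PreInnerProductSpace.Core ℂ A where
  inner a b := B.E (star a * b) k
  conj_inner_symm a b := by
    rw [← B.E_star, star_mul, star_star]
  re_inner_nonneg a := (Complex.nonneg_iff.1 (B.E_nonneg a k)).1
  add_left a b c := by simp [star_add, add_mul]
  smul_left a b c := by simp

theorem seminorm_nonneg (k : K) (a : A) : 0 ≤ B.seminorm k a := Real.sqrt_nonneg _

theorem seminorm_sq (k : K) (a : A) : B.seminorm k a ^ 2 = (B.E (star a * a) k).re :=
  Real.sq_sqrt (Complex.nonneg_iff.1 (B.E_nonneg a k)).1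

theorem norm_E_apply_self (k : K) (a : A) : ‖B.E (star a * a) k‖ = B.seminorm k a ^ 2 := by
  rw [seminorm_sq]
  have h := Complex.nonneg_iff.1 (B.E_nonneg a k)
  rw [← Complex.abs_re_eq_norm.2 h.2.symm, abs_of_nonneg h.1]

theorem norm_E_mul_le (k : K) (a b : A) :
    ‖B.E (star a * b) k‖ ≤ B.seminorm k a * B.seminorm k b :=
  letI := B.core k
  InnerProductSpace.Core.norm_inner_le_norm (𝕜 := ℂ) a b

theorem seminorm_add_le (k : K) (a b : A) :
    B.seminorm k (a + b) ≤ B.seminorm k a + B.seminorm k b := by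
  let := B.core k
  let := InnerProductSpace.Core.toSeminormedAddCommGroup (𝕜 := ℂ) (F := A)
  exact norm_add_le a b

theorem seminorm_smul (k : K) (c : ℂ) (a : A) :
    B.seminorm k (c • a) = ‖c‖ * B.seminorm k a := by
  rw [← sq_eq_sq₀ (B.seminorm_nonneg _ _) (mul_nonneg (norm_nonneg _) (B.seminorm_nonneg _ _)),
    mul_pow, ← norm_E_apply_self, ← norm_E_apply_self, star_smul, smul_mul_assoc, mul_smul_comm]
  simp [sq, mul_assoc]

theorem seminorm_neg (k : K) (a : A) : B.seminorm k (-a) = B.seminorm k a := by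
  simp [seminorm]

theorem seminorm_zero (k : K) : B.seminorm k 0 = 0 := by simp [seminorm]

theorem seminorm_one (k : K) : B.seminorm k 1 = 1 := by simp [seminorm, B.E_one]

theorem seminorm_star (k : K) (a : A) : B.seminorm k (star a) = B.seminorm k a := by
  simp [seminorm, B.E_comm a]

variable {B} in
theorem OpBound.mono {C D : ℝ} {a : A} (h : B.OpBound C a) (hCD : C ≤ D) : B.OpBound D a :=
  ⟨h.1.trans hCD, fun b k => (h.2 b k).trans
    (mul_le_mul_of_nonneg_right hCD (B.seminorm_nonneg _ _))⟩

variable {B} in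
theorem OpBound.add {C D : ℝ} {a b : A} (ha : B.OpBound C a) (hb : B.OpBound D b) :
    B.OpBound (C + D) (a + b) :=
  ⟨add_nonneg ha.1 hb.1, fun c k => by
    rw [add_mul, add_mul]
    exact (B.seminorm_add_le _ _ _).trans (add_le_add (ha.2 c k) (hb.2 c k))⟩

variable {B} in
theorem OpBound.mul {C D : ℝ} {a b : A} (ha : B.OpBound C a) (hb : B.OpBound D b) :
    B.OpBound (C * D) (a * b) :=
  ⟨mul_nonneg ha.1 hb.1, fun c k => by
    rw [mul_assoc, mul_assoc]
    exact (ha.2 _ k).trans (mul_le_mul_of_nonneg_left (hb.2 c k) ha.1)⟩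

variable {B} in
theorem OpBound.star {C : ℝ} {a : A} (ha : B.OpBound C a) : B.OpBound C (star a) := by
  refine ⟨ha.1, fun b k => ?_⟩
  have h1 : B.seminorm k (Star.star a * b) ^ 2 ≤
      B.seminorm k (Star.star a * b) * (C * B.seminorm k b) := by
    calc _ = ‖B.E (Star.star b * (a * (Star.star a * b))) k‖ := by
            rw [← norm_E_apply_self, star_mul, star_star, mul_assoc]
      _ ≤ B.seminorm k b * B.seminorm k (a * (Star.star a * b)) := B.norm_E_mul_le _ _ _
      _ ≤ B.seminorm k b * (C * B.seminorm k (Star.star a * b)) :=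
            mul_le_mul_of_nonneg_left (ha.2 _ k) (B.seminorm_nonneg _ _)
      _ = _ := by ring
  rcases (B.seminorm_nonneg k (Star.star a * b)).eq_or_lt with h | h
  · rw [← h]; exact mul_nonneg ha.1 (B.seminorm_nonneg _ _)
  · rw [sq] at h1
    exact le_of_mul_le_mul_left h1 h

variable {B} in
theorem OpBound.mul_right {C : ℝ} {a : A} (ha : B.OpBound C a) (b : A) (k : K) :
    B.seminorm k (b * a) ≤ C * B.seminorm k b := by
  rw [← B.seminorm_star k (b * a), star_mul, ← B.seminorm_star k b]
  exact ha.star.2 _ k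

theorem opBound_smul_one (c : ℂ) : B.OpBound ‖c‖ (c • (1 : A)) :=
  ⟨norm_nonneg _, fun b k => by rw [smul_one_mul, seminorm_smul]⟩

variable {B} in
theorem seminorm_map {φ : A ≃⋆ₐ[ℂ] A} (hφ : ∀ a, B.E (φ a) = B.E a) (k : K) (a : A) :
    B.seminorm k (φ a) = B.seminorm k a := by
  rw [seminorm, seminorm, ← map_star, ← map_mul, hφ]

variable {B} in
theorem OpBound.map {φ : A ≃⋆ₐ[ℂ] A} (hφ : ∀ a, B.E (φ a) = B.E a) {C : ℝ} {a : A}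
    (h : B.OpBound C a) : B.OpBound C (φ a) := by
  refine ⟨h.1, fun b k => ?_⟩
  obtain ⟨b, rfl⟩ : ∃ c, φ c = b := φ.surjective b
  rw [← map_mul, seminorm_map hφ, seminorm_map hφ]
  exact h.2 b k

end basic

section completion

variable {K : Type u} [TopologicalSpace K] [CompactSpace K] {A : Type v} [Ring A] [StarRing A]
  [Algebra ℂ A] [StarModule ℂ A] (B : TracialAlgebra K A)

/-- The uniform 2-norm `‖a‖_{2,u} = ‖E(a* a)‖^{1/2}`. -/
noncomputable def norm2u (a : A) : ℝ := √‖B.E (star a * a)‖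

theorem norm2u_nonneg (a : A) : 0 ≤ B.norm2u a := Real.sqrt_nonneg _

theorem seminorm_le_norm2u (k : K) (a : A) : B.seminorm k a ≤ B.norm2u a := by
  apply Real.le_sqrt_of_sq_le
  rw [← norm_E_apply_self]
  exact (B.E (star a * a)).norm_coe_le_norm k

theorem norm2u_le {a : A} {c : ℝ} (hc : 0 ≤ c) (h : ∀ k, B.seminorm k a ≤ c) :
    B.norm2u a ≤ c := by
  refine Real.sqrt_le_iff.2 ⟨hc, (ContinuousMap.norm_le _ (sq_nonneg c)).2 fun k => ?_⟩
  rw [norm_E_apply_self]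
  exact pow_le_pow_left₀ (B.seminorm_nonneg _ _) (h k) 2

theorem norm2u_zero : B.norm2u 0 = 0 := by simp [norm2u]

theorem norm2u_add_le (a b : A) : B.norm2u (a + b) ≤ B.norm2u a + B.norm2u b :=
  B.norm2u_le (add_nonneg (B.norm2u_nonneg _) (B.norm2u_nonneg _)) fun k =>
    (B.seminorm_add_le k a b).trans
      (add_le_add (B.seminorm_le_norm2u _ _) (B.seminorm_le_norm2u _ _))

theorem norm2u_star (a : A) : B.norm2u (star a) = B.norm2u a := by
  simp [norm2u, B.E_comm a]

theorem norm2u_neg (a : A) : B.norm2u (-a) = B.norm2u a := by simp [norm2u]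

theorem norm2u_sub_comm (a b : A) : B.norm2u (a - b) = B.norm2u (b - a) := by
  rw [← norm2u_neg, neg_sub]

variable {B} in
theorem OpBound.norm2u_mul_le {C : ℝ} {a : A} (ha : B.OpBound C a) (b : A) :
    B.norm2u (a * b) ≤ C * B.norm2u b :=
  B.norm2u_le (mul_nonneg ha.1 (B.norm2u_nonneg _)) fun k =>
    (ha.2 b k).trans (mul_le_mul_of_nonneg_left (B.seminorm_le_norm2u _ _) ha.1)

variable {B} in
theorem OpBound.norm2u_mul_right_le {C : ℝ} {a : A} (ha : B.OpBound C a) (b : A) :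
    B.norm2u (b * a) ≤ C * B.norm2u b :=
  B.norm2u_le (mul_nonneg ha.1 (B.norm2u_nonneg _)) fun k =>
    (ha.mul_right b k).trans (mul_le_mul_of_nonneg_left (B.seminorm_le_norm2u _ _) ha.1)

theorem norm2u_mul_sub_mul_le {C D : ℝ} {a a' b b' : A} (ha : B.OpBound C a)
    (hb : B.OpBound D b') :
    B.norm2u (a * b - a' * b') ≤ C * B.norm2u (b - b') + D * B.norm2u (a - a') := by
  have h : a * b - a' * b' = a * (b - b') + (a - a') * b' := by noncomm_ring
  rw [h]
  exact (B.norm2u_add_le _ _).trans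
    (add_le_add (ha.norm2u_mul_le _) (hb.norm2u_mul_right_le _))

theorem norm_E_le (a : A) : ‖B.E a‖ ≤ B.norm2u a := by
  refine (ContinuousMap.norm_le _ (B.norm2u_nonneg a)).2 fun k => ?_
  have h := B.norm_E_mul_le k 1 a
  rw [star_one, one_mul, seminorm_one, one_mul] at h
  exact h.trans (B.seminorm_le_norm2u k a)

/-- `x` is a Cauchy sequence for the uniform 2-norm. -/
def IsCauchy (x : ℕ → A) : Prop :=
  ∀ ε > 0, ∃ N, ∀ m ≥ N, ∀ n ≥ N, B.norm2u (x m - x n) < ε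

/-- The `*`-algebra of operator-norm bounded sequences which are Cauchy in the uniform 2-norm. -/
def boundedCauchy : StarSubalgebra ℂ (ℕ → A) where
  carrier := {x | (∃ C, ∀ n, B.OpBound C (x n)) ∧ B.IsCauchy x}
  mul_mem' := by
    rintro x y ⟨⟨C, hC⟩, hx⟩ ⟨⟨D, hD⟩, hy⟩
    refine ⟨⟨C * D, fun n => (hC n).mul (hD n)⟩, fun ε hε => ?_⟩
    have hC0 := (hC 0).1
    have hD0 := (hD 0).1
    obtain ⟨N₁, h₁⟩ := hx (ε / (2 * (D + 1))) (by positivity)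
    obtain ⟨N₂, h₂⟩ := hy (ε / (2 * (C + 1))) (by positivity)
    refine ⟨max N₁ N₂, fun m hm n hn => ?_⟩
    have e₁ := h₁ m (le_of_max_le_left hm) n (le_of_max_le_left hn)
    have e₂ := h₂ m (le_of_max_le_right hm) n (le_of_max_le_right hn)
    rw [lt_div_iff₀ (by positivity)] at e₁ e₂
    have := B.norm2u_mul_sub_mul_le (a' := x n) (b := y m) (hC m) (hD n)
    have p₁ := B.norm2u_nonneg (x m - x n)
    have p₂ := B.norm2u_nonneg (y m - y n)
    simp only [Pi.mul_apply]
    nlinarith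
  add_mem' := by
    rintro x y ⟨⟨C, hC⟩, hx⟩ ⟨⟨D, hD⟩, hy⟩
    refine ⟨⟨C + D, fun n => (hC n).add (hD n)⟩, fun ε hε => ?_⟩
    obtain ⟨N₁, h₁⟩ := hx (ε / 2) (by positivity)
    obtain ⟨N₂, h₂⟩ := hy (ε / 2) (by positivity)
    refine ⟨max N₁ N₂, fun m hm n hn => ?_⟩
    have e₁ := h₁ m (le_of_max_le_left hm) n (le_of_max_le_left hn)
    have e₂ := h₂ m (le_of_max_le_right hm) n (le_of_max_le_right hn)
    have h : (x + y) m - (x + y) n = (x m - x n) + (y m - y n) := by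
      simp only [Pi.add_apply]; abel
    rw [h]
    exact (B.norm2u_add_le _ _).trans_lt (by linarith)
  algebraMap_mem' c := by
    refine ⟨⟨‖c‖, fun n => ?_⟩, fun ε hε => ⟨0, fun m _ n _ => ?_⟩⟩
    · rw [Pi.algebraMap_apply, Algebra.algebraMap_eq_smul_one]
      exact B.opBound_smul_one c
    · rw [Pi.algebraMap_apply, Pi.algebraMap_apply, sub_self, norm2u_zero]
      exact hε
  star_mem' := by
    rintro x ⟨⟨C, hC⟩, hx⟩
    refine ⟨⟨C, fun n => (hC n).star⟩, fun ε hε => ?_⟩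
    obtain ⟨N, hN⟩ := hx ε hε
    refine ⟨N, fun m hm n hn => ?_⟩
    simp only [Pi.star_apply]
    rw [← star_sub, norm2u_star]
    exact hN m hm n hn

/-- Two sequences are identified when their difference tends to `0` in the uniform 2-norm. -/
def nullCon : RingCon B.boundedCauchy where
  r x y := Tendsto (fun n => B.norm2u (x.1 n - y.1 n)) atTop (𝓝 0)
  iseqv :=
    { refl := fun x => by simp [norm2u_zero]
      symm := fun {x y} h => by simpa only [B.norm2u_sub_comm (y.1 _)] using h
      trans := fun {x y z} h₁ h₂ => by
        refine squeeze_zero (fun n => B.norm2u_nonneg _) (fun n => ?_) (by simpa using h₁.add h₂)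
        rw [← sub_add_sub_cancel (x.1 n) (y.1 n) (z.1 n)]
        exact B.norm2u_add_le _ _ }
  mul' := by
    intro x x' y y' h₁ h₂
    obtain ⟨C, hC⟩ := x.2.1
    obtain ⟨D, hD⟩ := y'.2.1
    refine squeeze_zero (fun n => B.norm2u_nonneg _)
      (fun n => B.norm2u_mul_sub_mul_le (a' := x'.1 n) (b := y.1 n) (hC n) (hD n)) ?_
    simpa using (h₂.const_mul C).add (h₁.const_mul D)
  add' := by
    intro x x' y y' h₁ h₂
    refine squeeze_zero (fun n => B.norm2u_nonneg _) (fun n => ?_) (by simpa using h₁.add h₂)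
    have h : (x + y).1 n - (x' + y').1 n = (x.1 n - x'.1 n) + (y.1 n - y'.1 n) := by
      change (x.1 n + y.1 n) - (x'.1 n + y'.1 n) = _
      abel
    rw [h]
    exact B.norm2u_add_le _ _

/-- The strict completion: operator-norm bounded `‖·‖_{2,u}`-Cauchy sequences modulo
`‖·‖_{2,u}`-null sequences. -/
abbrev Completion : Type v := B.nullCon.Quotient

namespace Completion

noncomputable instance : StarRing B.Completion where
  star := Quotient.map star (by
    intro x y (h : Tendsto (fun n => B.norm2u (x.1 n - y.1 n)) atTop (𝓝 0))
    change Tendsto (fun n => B.norm2u (star (x.1 n) - star (y.1 n))) atTop (𝓝 0)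
    simpa only [← star_sub, norm2u_star] using h)
  star_involutive := by
    rintro ⟨x⟩
    exact congrArg (Quotient.mk _) (star_star x)
  star_mul := by
    rintro ⟨x⟩ ⟨y⟩
    exact congrArg (Quotient.mk _) (star_mul x y)
  star_add := by
    rintro ⟨x⟩ ⟨y⟩
    exact congrArg (Quotient.mk _) (star_add x y)

instance : StarModule ℂ B.Completion where
  star_smul := by
    rintro c ⟨x⟩
    exact congrArg (Quotient.mk _) (star_smul c x)

end Completion

theorem exists_lim (x : B.boundedCauchy) : ∃ f, Tendsto (fun n => B.E (x.1 n)) atTop (𝓝 f) := by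
  apply cauchySeq_tendsto_of_complete
  rw [Metric.cauchySeq_iff]
  intro ε hε
  obtain ⟨N, hN⟩ := x.2.2 ε hε
  refine ⟨N, fun m hm n hn => ?_⟩
  rw [dist_eq_norm, ← map_sub]
  exact (B.norm_E_le _).trans_lt (hN m hm n hn)

/-- The limit of `E(x_n)` in `C(K)`. -/
noncomputable def limE (x : B.boundedCauchy) : C(K, ℂ) := (B.exists_lim x).choose

theorem tendsto_limE (x : B.boundedCauchy) :
    Tendsto (fun n => B.E (x.1 n)) atTop (𝓝 (B.limE x)) := (B.exists_lim x).choose_spec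

theorem tendsto_limE_apply (x : B.boundedCauchy) (k : K) :
    Tendsto (fun n => B.E (x.1 n) k) atTop (𝓝 (B.limE x k)) :=
  ((ContinuousEvalConst.continuous_eval_const k).tendsto _).comp (B.tendsto_limE x)

theorem limE_eq {x : B.boundedCauchy} {f : C(K, ℂ)}
    (h : Tendsto (fun n => B.E (x.1 n)) atTop (𝓝 f)) : B.limE x = f :=
  tendsto_nhds_unique (B.tendsto_limE x) h

theorem limE_congr {x y : B.boundedCauchy} (h : B.nullCon x y) : B.limE x = B.limE y := by
  have h' : Tendsto (fun n => B.norm2u (x.1 n - y.1 n)) atTop (𝓝 0) := h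
  have h0 : Tendsto (fun n => B.E (x.1 n - y.1 n)) atTop (𝓝 0) :=
    squeeze_zero_norm (fun n => B.norm_E_le _) h'
  apply limE_eq
  simpa using h0.add (B.tendsto_limE y)

theorem seminorm_tendsto (x : B.boundedCauchy) (k : K) :
    Tendsto (fun n => B.seminorm k (x.1 n)) atTop (𝓝 √(B.limE (star x * x) k).re) :=
  (Real.continuous_sqrt.tendsto _).comp ((Complex.continuous_re.tendsto _).comp
    (B.tendsto_limE_apply (star x * x) k))

/-- The strict completion, with the extension of `E`. -/
noncomputable def completion : TracialAlgebra K B.Completion where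
  E :=
    { toFun := Quotient.lift B.limE fun _ _ h => B.limE_congr h
      map_add' := by
        rintro ⟨x⟩ ⟨y⟩
        refine B.limE_eq (x := x + y) ?_
        refine ((B.tendsto_limE x).add (B.tendsto_limE y)).congr fun n => ?_
        exact (map_add B.E (x.1 n) (y.1 n)).symm
      map_smul' := by
        rintro c ⟨x⟩
        refine B.limE_eq (x := c • x) ?_
        refine ((B.tendsto_limE x).const_smul c).congr fun n => ?_
        exact (map_smul B.E c (x.1 n)).symm }
  E_one := by
    refine B.limE_eq (x := 1) ?_
    simp [B.E_one]
  E_nonneg := by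
    rintro ⟨x⟩ k
    exact ge_of_tendsto' (B.tendsto_limE_apply (star x * x) k) fun n => B.E_nonneg (x.1 n) k
  E_comm := by
    rintro ⟨x⟩ ⟨y⟩
    refine B.limE_eq (x := x * y) ?_
    refine (B.tendsto_limE (y * x)).congr fun n => ?_
    exact B.E_comm (y.1 n) (x.1 n)

/-- Every element of the strict completion is bounded. -/
theorem completion_bdd (z : B.Completion) : ∃ C, B.completion.OpBound C z := by
  obtain ⟨x⟩ := z
  obtain ⟨C, hC⟩ := x.2.1
  refine ⟨C, (hC 0).1, ?_⟩
  rintro ⟨y⟩ k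
  exact le_of_tendsto_of_tendsto' (B.seminorm_tendsto (x * y) k)
    ((B.seminorm_tendsto y k).const_mul C) fun n => (hC n).2 (y.1 n) k

/-- The class of the constant sequence of a bounded element. -/
def toCompletion (a : A) (ha : ∃ C, B.OpBound C a) : B.Completion :=
  ((⟨fun _ => a, ha.imp fun _ h _ => h, fun ε hε => ⟨0, fun m _ n _ => by
    rw [sub_self, norm2u_zero]; exact hε⟩⟩ : B.boundedCauchy) : B.nullCon.Quotient)

variable {B}

theorem norm2u_map {φ : A ≃⋆ₐ[ℂ] A} (hφ : ∀ a, B.E (φ a) = B.E a) (a : A) :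
    B.norm2u (φ a) = B.norm2u a := by
  rw [norm2u, norm2u, ← map_star, ← map_mul, hφ]

/-- An `E`-preserving automorphism, applied termwise to a bounded Cauchy sequence. -/
def mapSeq (φ : A ≃⋆ₐ[ℂ] A) (hφ : ∀ a, B.E (φ a) = B.E a) (x : B.boundedCauchy) :
    B.boundedCauchy :=
  ⟨fun n => φ (x.1 n), x.2.1.imp fun _ hC n => (hC n).map hφ, fun ε hε =>
    (x.2.2 ε hε).imp fun N hN m hm n hn => by
      rw [← map_sub, norm2u_map hφ]
      exact hN m hm n hn⟩

variable (B)

/-- The extension to the strict completion of an action by `E`-preserving automorphisms. -/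
noncomputable def completionAction {G : Type w} [Group G] (γ : G →* (A ≃⋆ₐ[ℂ] A))
    (hγ : ∀ g a, B.E (γ g a) = B.E a) : G →* (B.Completion ≃⋆ₐ[ℂ] B.Completion) :=
  let f : G → B.Completion → B.Completion := fun g =>
    Quotient.map (mapSeq (γ g) (hγ g)) (by
      intro x y (h : Tendsto (fun n => B.norm2u (x.1 n - y.1 n)) atTop (𝓝 0))
      change Tendsto (fun n => B.norm2u (γ g (x.1 n) - γ g (y.1 n))) atTop (𝓝 0)
      simpa only [← map_sub, norm2u_map (hγ g)] using h)
  have hf : ∀ g h x, f g (f h x) = f (g * h) x := by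
    rintro g h ⟨x⟩
    refine congrArg (Quotient.mk _) (Subtype.ext (funext fun n => ?_))
    change γ g (γ h (x.1 n)) = γ (g * h) (x.1 n)
    rw [map_mul]
    rfl
  have hf1 : ∀ x, f 1 x = x := by
    rintro ⟨x⟩
    refine congrArg (Quotient.mk _) (Subtype.ext (funext fun n => ?_))
    change γ 1 (x.1 n) = x.1 n
    rw [map_one]
    rfl
  { toFun := fun g =>
      { toFun := f g
        invFun := f g⁻¹
        left_inv := fun x => by rw [hf, inv_mul_cancel, hf1]
        right_inv := fun x => by rw [hf, mul_inv_cancel, hf1]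
        map_mul' := by
          rintro ⟨x⟩ ⟨y⟩
          exact congrArg (Quotient.mk _) (Subtype.ext (funext fun n => map_mul (γ g) _ _))
        map_add' := by
          rintro ⟨x⟩ ⟨y⟩
          exact congrArg (Quotient.mk _) (Subtype.ext (funext fun n => map_add (γ g) _ _))
        map_star' := by
          rintro ⟨x⟩
          exact congrArg (Quotient.mk _) (Subtype.ext (funext fun n => map_star (γ g) _))
        map_smul' := by
          rintro c ⟨x⟩
          exact congrArg (Quotient.mk _) (Subtype.ext (funext fun n => map_smul (γ g) c _)) }
    map_one' := StarAlgEquiv.ext hf1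
    map_mul' := fun g h => StarAlgEquiv.ext fun x => (hf g h x).symm }

theorem completion_E_action {G : Type w} [Group G] (γ : G →* (A ≃⋆ₐ[ℂ] A))
    (hγ : ∀ g a, B.E (γ g a) = B.E a) (g : G) (x : B.Completion) :
    B.completion.E (B.completionAction γ hγ g x) = B.completion.E x := by
  obtain ⟨x⟩ := x
  refine B.limE_eq (x := mapSeq (γ g) (hγ g) x) ?_
  refine (B.tendsto_limE x).congr fun n => ?_
  exact (hγ g (x.1 n)).symm

end completion

section tensor

variable {K : Type u} [TopologicalSpace K] {A : Type v} [Ring A] [StarRing A]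
  [Algebra ℂ A] [StarModule ℂ A] {D : Type w} [Ring D] [StarRing D] [Algebra ℂ D] [StarModule ℂ D]
  (B : TracialAlgebra K A) (T : TracialAlgebra Unit D)

theorem gram_posSemidef (k : K) {c : A} (hc : star c = c)
    (h : ∀ a, 0 ≤ B.E (star a * (c * a)) k) {ι : Type*} [Fintype ι] (x : ι → A) :
    (Matrix.of fun i j => B.E (star (x i) * (c * x j)) k).PosSemidef := by
  rw [Matrix.posSemidef_iff_dotProduct_mulVec]
  refine ⟨?_, fun z => ?_⟩
  · ext i j
    rw [Matrix.conjTranspose_apply, Matrix.of_apply, Matrix.of_apply, Complex.star_def,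
      ← B.E_star, star_mul, star_mul, star_star, hc, mul_assoc]
  · have := h (∑ i, z i • x i)
    convert! this using 1
    simp only [dotProduct, Matrix.mulVec, Matrix.of_apply, star_sum, Finset.sum_mul,
      Finset.mul_sum, star_smul, smul_mul_assoc, mul_smul_comm, map_sum, map_smul,
      ContinuousMap.coe_sum, Finset.sum_apply, ContinuousMap.smul_apply, smul_eq_mul, Pi.star_apply]
    rw [Finset.sum_comm]
    refine Finset.sum_congr rfl fun i _ => Finset.sum_congr rfl fun j _ => ?_
    ring

/-- The functional `E ⊗ τ` on the algebraic tensor product, `x ⊗ y ↦ τ(y) E(x)`. -/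
noncomputable def tensorE : A ⊗[ℂ] D →ₗ[ℂ] C(K, ℂ) :=
  TensorProduct.lift (LinearMap.mk₂ ℂ (fun a d => T.E d () • B.E a)
    (fun _ _ _ => ContinuousMap.ext fun _ => by simp [mul_add])
    (fun _ _ _ => ContinuousMap.ext fun _ => by simp [mul_left_comm])
    (fun _ _ _ => ContinuousMap.ext fun _ => by simp [add_mul])
    (fun _ _ _ => ContinuousMap.ext fun _ => by simp [mul_assoc]))

theorem tensorE_tmul (a : A) (d : D) : tensorE B T (a ⊗ₜ d) = T.E d () • B.E a := rfl

theorem tensorE_nonneg (k : K) {c : A} (hc : star c = c) (h : ∀ a, 0 ≤ B.E (star a * (c * a)) k)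
    {d : D} (hd : star d = d) (h' : ∀ a, 0 ≤ T.E (star a * (d * a)) ()) (t : A ⊗[ℂ] D) :
    0 ≤ tensorE B T (star t * ((c ⊗ₜ d) * t)) k := by
  obtain ⟨n, x, y, rfl⟩ : ∃ (n : ℕ) (x : Fin n → A) (y : Fin n → D),
      t = ∑ i, x i ⊗ₜ[ℂ] y i := by
    induction t with
    | zero => exact ⟨0, Fin.elim0, Fin.elim0, by simp⟩
    | tmul a b => exact ⟨1, fun _ => a, fun _ => b, by simp⟩
    | add s t hs ht =>
      obtain ⟨n, x, y, rfl⟩ := hs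
      obtain ⟨m, x', y', rfl⟩ := ht
      exact ⟨n + m, Fin.append x x', Fin.append y y', by simp [Fin.sum_univ_add]⟩
  have := ((B.gram_posSemidef k hc h x).hadamard
    (T.gram_posSemidef () hd h' y)).dotProduct_mulVec_nonneg (fun _ => 1)
  convert! this using 1
  simp only [dotProduct, Matrix.mulVec, Matrix.hadamard_apply, Matrix.of_apply, star_sum,
    Finset.sum_mul, Finset.mul_sum, map_sum, ContinuousMap.coe_sum, Finset.sum_apply,
    Pi.star_apply, star_one, one_mul, mul_one, TensorProduct.star_tmul,
    Algebra.TensorProduct.tmul_mul_tmul, tensorE_tmul, ContinuousMap.smul_apply, smul_eq_mul]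
  rw [Finset.sum_comm]
  exact Finset.sum_congr rfl fun i _ => Finset.sum_congr rfl fun j _ => mul_comm _ _

/-- The algebraic tensor product with `E ⊗ τ`. -/
noncomputable def algTensor : TracialAlgebra K (A ⊗[ℂ] D) where
  E := tensorE B T
  E_one := by
    rw [Algebra.TensorProduct.one_def, tensorE_tmul, B.E_one, T.E_one]
    simp
  E_nonneg t k := by
    have := tensorE_nonneg B T k (c := 1) (star_one _) (by simpa using B.E_nonneg · k)
      (d := 1) (star_one _) (by simpa using T.E_nonneg · ()) t
    rwa [← Algebra.TensorProduct.one_def, one_mul] at this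
  E_comm s t := by
    induction s with
    | zero => simp
    | add s s' h h' => rw [add_mul, mul_add, map_add, map_add, h, h']
    | tmul a d =>
      induction t with
      | zero => simp
      | add s s' h h' => rw [add_mul, mul_add, map_add, map_add, h, h']
      | tmul a' d' =>
        rw [Algebra.TensorProduct.tmul_mul_tmul, Algebra.TensorProduct.tmul_mul_tmul,
          tensorE_tmul, tensorE_tmul, B.E_comm, T.E_comm]

theorem opBound_form {C : ℝ} {a : A} (h : B.OpBound C a) (b : A) (k : K) :
    0 ≤ B.E (star b * (((C ^ 2 : ℝ) : ℂ) • (1 : A) - star a * a) * b) k := by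
  have h1 : B.E (star b * (((C ^ 2 : ℝ) : ℂ) • (1 : A) - star a * a) * b) k =
      ((C ^ 2 : ℝ) : ℂ) * B.E (star b * b) k - B.E (star (a * b) * (a * b)) k := by
    simp [mul_sub, sub_mul, star_mul, mul_assoc]
  have h2 := Complex.nonneg_iff.1 (B.E_nonneg b k)
  have h3 := Complex.nonneg_iff.1 (B.E_nonneg (a * b) k)
  rw [h1, Complex.nonneg_iff, Complex.sub_re, Complex.sub_im, Complex.re_ofReal_mul,
    Complex.im_ofReal_mul, ← h2.2, ← h3.2, ← seminorm_sq, ← seminorm_sq, ← mul_pow]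
  exact ⟨sub_nonneg.2 (pow_le_pow_left₀ (B.seminorm_nonneg _ _) (h.2 b k) 2), by simp⟩

theorem opBound_of_form {C : ℝ} (hC : 0 ≤ C) {a : A}
    (h : ∀ b k, 0 ≤ B.E (star b * (((C ^ 2 : ℝ) : ℂ) • (1 : A) - star a * a) * b) k) :
    B.OpBound C a := by
  refine ⟨hC, fun b k => ?_⟩
  have h1 : B.E (star b * (((C ^ 2 : ℝ) : ℂ) • (1 : A) - star a * a) * b) k =
      ((C ^ 2 : ℝ) : ℂ) * B.E (star b * b) k - B.E (star (a * b) * (a * b)) k := by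
    simp [mul_sub, sub_mul, star_mul, mul_assoc]
  have h2 := (Complex.nonneg_iff.1 (h b k)).1
  rw [h1, Complex.sub_re, Complex.re_ofReal_mul, ← seminorm_sq, ← seminorm_sq, ← mul_pow,
    sub_nonneg] at h2
  exact (sq_le_sq₀ (B.seminorm_nonneg _ _) (mul_nonneg hC (B.seminorm_nonneg _ _))).1 h2

theorem algTensor_opBound_left {C : ℝ} {a : A} (h : B.OpBound C a) :
    (algTensor B T).OpBound C (a ⊗ₜ 1) := by
  refine opBound_of_form _ h.1 fun t k => ?_
  have := tensorE_nonneg B T k (c := ((C ^ 2 : ℝ) : ℂ) • (1 : A) - star a * a)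
    (by simp) (fun b => by rw [← mul_assoc]; exact opBound_form B h b k)
    (d := 1) (star_one _) (by simpa using T.E_nonneg · ()) t
  rw [← mul_assoc, TensorProduct.sub_tmul, ← TensorProduct.smul_tmul'] at this
  simpa [algTensor, Algebra.TensorProduct.one_def] using this

theorem algTensor_opBound_right {C : ℝ} {d : D} (h : T.OpBound C d) :
    (algTensor B T).OpBound C (1 ⊗ₜ d) := by
  refine opBound_of_form _ h.1 fun t k => ?_
  have := tensorE_nonneg B T k (c := 1) (star_one _) (by simpa using B.E_nonneg · k)
    (d := ((C ^ 2 : ℝ) : ℂ) • (1 : D) - star d * d) (by simp)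
    (fun b => by rw [← mul_assoc]; exact opBound_form T h b ()) t
  rw [← mul_assoc, TensorProduct.tmul_sub, TensorProduct.tmul_smul] at this
  simpa [algTensor, Algebra.TensorProduct.one_def] using this

/-- The tensor product `φ ⊗ ψ` of two automorphisms. -/
noncomputable def autTensor (φ : A ≃⋆ₐ[ℂ] A) (ψ : D ≃⋆ₐ[ℂ] D) :
    (A ⊗[ℂ] D) ≃⋆ₐ[ℂ] (A ⊗[ℂ] D) :=
  StarAlgEquiv.ofAlgEquiv (Algebra.TensorProduct.congr φ.toAlgEquiv ψ.toAlgEquiv) (by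
    intro t
    induction t with
    | zero => simp
    | tmul a d => simp [TensorProduct.star_tmul, map_star φ a, map_star ψ d]
    | add s t hs ht => simp only [star_add, map_add, hs, ht])

/-- The tensor product action `γ ⊗ δ` on the algebraic tensor product. -/
noncomputable def actTensor {G : Type*} [Group G] (γ : G →* (A ≃⋆ₐ[ℂ] A))
    (δ : G →* (D ≃⋆ₐ[ℂ] D)) : G →* ((A ⊗[ℂ] D) ≃⋆ₐ[ℂ] (A ⊗[ℂ] D)) where
  toFun g := autTensor (γ g) (δ g)
  map_one' := by
    ext t
    induction t with
    | zero => simp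
    | tmul a d => simp [autTensor]
    | add s t hs ht => simp only [map_add, hs, ht]
  map_mul' g h := by
    ext t
    induction t with
    | zero => simp
    | tmul a d => simp [autTensor]
    | add s t hs ht => simp only [map_add, hs, ht]

variable {B T} in
theorem algTensor_E_act {G : Type*} [Group G] {γ : G →* (A ≃⋆ₐ[ℂ] A)} {δ : G →* (D ≃⋆ₐ[ℂ] D)}
    (hγ : ∀ g a, B.E (γ g a) = B.E a) (hδ : ∀ g d, T.E (δ g d) = T.E d) (g : G)
    (t : A ⊗[ℂ] D) : (algTensor B T).E (actTensor γ δ g t) = (algTensor B T).E t := by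
  induction t with
  | zero => simp
  | tmul a d =>
    change T.E (δ g d) () • B.E (γ g a) = T.E d () • B.E a
    rw [hγ, hδ]
  | add s t hs ht => rw [map_add, map_add, map_add, hs, ht]

end tensor

end TracialAlgebra

/-! ### Tracial systems and cocycle conjugacy -/

/-- A tracial `*`-algebra over `K` all of whose elements are bounded, with a fiber-wise action of
the discrete group `G`, that is, an action by `E`-preserving `*`-automorphisms. -/
structure TracialSystem (G : Type*) [Group G] (K : Type u) [TopologicalSpace K] where
  carrier : Type v
  [ring : Ring carrier]
  [starRing : StarRing carrier]
  [algebra : Algebra ℂ carrier]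
  [starModule : StarModule ℂ carrier]
  alg : TracialAlgebra K carrier
  bdd : ∀ a, ∃ C, alg.OpBound C a
  act : G →* (carrier ≃⋆ₐ[ℂ] carrier)
  E_act : ∀ g a, alg.E (act g a) = alg.E a

namespace TracialSystem

attribute [instance] ring starRing algebra starModule

variable {G : Type*} [Group G] {K : Type u} [TopologicalSpace K]

/-- `u` is a cocycle for the action: `u_{gh} = u_g γ_g(u_h)`. -/
def IsCocycle (S : TracialSystem G K) (u : G → unitary S.carrier) : Prop :=
  ∀ g h, (u (g * h) : S.carrier) = u g * S.act g (u h)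

/-- Cocycle conjugacy as equivariant bundles: for some cocycle `u` for the action `γ` of `S`, the
perturbed action `Ad(u_g) ∘ γ_g` is conjugate to the action of `T` through an `E`-preserving
`*`-isomorphism. -/
def CocycleConjugate (S : TracialSystem G K) (T : TracialSystem G K) : Prop :=
  ∃ u : G → unitary S.carrier, S.IsCocycle u ∧
    ∃ φ : S.carrier ≃⋆ₐ[ℂ] T.carrier, (∀ a, T.alg.E (φ a) = S.alg.E a) ∧
      ∀ g a, T.act g (φ a) = φ ((u g : S.carrier) * S.act g a * star (u g : S.carrier))

variable [CompactSpace K]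

/-- The tensor product `S ⊗̄ T` of a system over `K` with a system over the one-point space: the
strict completion of the algebraic tensor product with respect to `E ⊗ τ`, with the
extension of the tensor product action. -/
noncomputable def tensor (S : TracialSystem G K) (T : TracialSystem G Unit) :
    TracialSystem G K where
  carrier := (S.alg.algTensor T.alg).Completion
  alg := (S.alg.algTensor T.alg).completion
  bdd := (S.alg.algTensor T.alg).completion_bdd
  act := (S.alg.algTensor T.alg).completionAction (TracialAlgebra.actTensor S.act T.act)
    (TracialAlgebra.algTensor_E_act S.E_act T.E_act)
  E_act := TracialAlgebra.completion_E_action _ _ _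

/-- The second tensor factor embedding `T → S ⊗̄ T`, `x ↦ 1 ⊗ x`. -/
noncomputable def inr (S : TracialSystem G K) (T : TracialSystem G Unit) (x : T.carrier) :
    (S.tensor T).carrier :=
  (S.alg.algTensor T.alg).toCompletion (1 ⊗ₜ[ℂ] x)
    ((T.bdd x).imp fun _ h => S.alg.algTensor_opBound_right T.alg h)

/-- A strongly McDuff system: there is an equivariant isomorphism `φ : S → S ⊗̄ S` which is
`G`-equivariantly approximately unitarily equivalent to the second factor embedding. -/
def IsStronglyMcDuff (S : TracialSystem G Unit) : Prop :=
  ∃ φ : S.carrier ≃⋆ₐ[ℂ] (S.tensor S).carrier,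
    (∀ a, (S.tensor S).alg.E (φ a) = S.alg.E a) ∧
    (∀ g a, (S.tensor S).act g (φ a) = φ (S.act g a)) ∧
    ∃ w : ℕ → unitary (S.tensor S).carrier,
      (∀ x, Tendsto (fun n => (S.tensor S).alg.norm2u
        ((w n : (S.tensor S).carrier) * φ x * star (w n : (S.tensor S).carrier) - S.inr S x))
        atTop (𝓝 0)) ∧
      ∀ g, Tendsto (fun n => (S.tensor S).alg.norm2u
        ((S.tensor S).act g (w n : (S.tensor S).carrier) - (w n : (S.tensor S).carrier)))
        atTop (𝓝 0)

end TracialSystem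

/-! ### `W^*`-bundles -/

/-- A `W^*`-bundle over `K` on the unital C*-algebra `M`. Over the one-point space these
are the von Neumann algebras with a faithful normal tracial state. -/
structure WStarBundle (K : Type u) [TopologicalSpace K] [CompactSpace K] (M : Type v)
    [CStarAlgebra M] where
  /-- the unital inclusion of `C(K)` into the center of `M` -/
  incl : C(K, ℂ) →⋆ₐ[ℂ] M
  incl_injective : Function.Injective incl
  incl_central : ∀ f a, incl f * a = a * incl f
  /-- the faithful tracial conditional expectation -/
  E : M →ₗ[ℂ] C(K, ℂ)
  E_incl : ∀ f, E (incl f) = f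
  E_incl_mul : ∀ f a, E (incl f * a) = f * E a
  E_nonneg : ∀ a k, 0 ≤ E (star a * a) k
  E_faithful : ∀ a, E (star a * a) = 0 → a = 0
  E_comm : ∀ a b, E (a * b) = E (b * a)
  /-- the norm-closed unit ball is complete in `‖a‖_{2,u} = ‖E(a* a)‖^{1/2}` -/
  complete : ∀ x : ℕ → M, (∀ n, ‖x n‖ ≤ 1) →
    (∀ ε > 0, ∃ N, ∀ m ≥ N, ∀ n ≥ N, √‖E (star (x m - x n) * (x m - x n))‖ < ε) →
    ∃ a, ‖a‖ ≤ 1 ∧ Tendsto (fun n => √‖E (star (x n - a) * (x n - a))‖) atTop (𝓝 0)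

namespace WStarBundle

variable {K : Type u} [TopologicalSpace K] [CompactSpace K] {M : Type v} [CStarAlgebra M]
  (B : WStarBundle K M)

/-- The underlying tracial `*`-algebra. -/
def alg : TracialAlgebra K M where
  E := B.E
  E_one := by rw [← map_one B.incl, B.E_incl]
  E_nonneg := B.E_nonneg
  E_comm := B.E_comm

theorem alg_opBound (a : M) : B.alg.OpBound ‖a‖ a := by
  let := CStarAlgebra.spectralOrder M
  have := CStarAlgebra.spectralOrderedRing M
  refine TracialAlgebra.opBound_of_form _ (norm_nonneg a) fun b k => ?_
  have h : star b * (star a * a) * b ≤ ‖star a * a‖ • (star b * b) :=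
    CStarAlgebra.star_left_conjugate_le_norm_smul
  rw [CStarRing.norm_star_mul_self, ← sq, ← sub_nonneg,
    CStarAlgebra.nonneg_iff_eq_star_mul_self] at h
  obtain ⟨c, hc⟩ := h
  have h' : star b * (((‖a‖ ^ 2 : ℝ) : ℂ) • (1 : M) - star a * a) * b = star c * c := by
    rw [← hc, mul_sub, sub_mul, mul_smul_comm, smul_mul_assoc, mul_one, Complex.coe_smul]
  rw [h']
  exact B.E_nonneg c k

/-- `M` contains a countable subset which is dense in the uniform 2-norm. -/
def StrictlySeparable : Prop :=
  ∃ s : Set M, s.Countable ∧ ∀ a, ∀ ε > 0, ∃ b ∈ s, B.alg.norm2u (a - b) < ε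

/-- A fiber-wise action: `γ_g ∘ E = E = E ∘ γ_g`. -/
structure IsFiberwise {G : Type*} [Group G] (γ : G →* (M ≃⋆ₐ[ℂ] M)) : Prop where
  act_E : ∀ g a, γ g (B.incl (B.E a)) = B.incl (B.E a)
  E_act : ∀ g a, B.E (γ g a) = B.E a

/-- The equivariant `W^*`-bundle `(M, γ)`. -/
def system {G : Type*} [Group G] (γ : G →* (M ≃⋆ₐ[ℂ] M)) (hγ : B.IsFiberwise γ) :
    TracialSystem G K where
  carrier := M
  alg := B.alg
  bdd a := ⟨‖a‖, B.alg_opBound a⟩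
  act := γ
  E_act := hγ.E_act

theorem isFiberwise_one {G : Type*} [Group G] : B.IsFiberwise (1 : G →* (M ≃⋆ₐ[ℂ] M)) :=
  ⟨fun _ _ => rfl, fun _ _ => rfl⟩

section fiber

variable [PartialOrder M] [StarOrderedRing M] (k : K)

/-- The tracial state `τ_k = ev_k ∘ E`. -/
noncomputable def trace : M →ₚ[ℂ] ℂ :=
  PositiveLinearMap.mk₀ ((ContinuousMap.evalCLM ℂ k).toLinearMap ∘ₗ B.E) (by
    intro a ha
    obtain ⟨b, rfl⟩ := CStarAlgebra.nonneg_iff_eq_star_mul_self.1 ha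
    exact B.E_nonneg b k)

theorem trace_apply (a : M) : B.trace k a = B.E a k := rfl

/-- The fiber `M_k`: the image of the GNS representation of `τ_k`. -/
noncomputable abbrev fiber : StarSubalgebra ℂ ((B.trace k).GNS →L[ℂ] (B.trace k).GNS) :=
  (B.trace k).gnsStarAlgHom.range

/-- The quotient map `π_k : M → M_k`. -/
noncomputable def toFiber : M →⋆ₐ[ℂ] B.fiber k := (B.trace k).gnsStarAlgHom.rangeRestrict

/-- The cyclic vector of the GNS representation of `τ_k`. -/
noncomputable def cyclicVector : (B.trace k).GNS := ((B.trace k).toPreGNS 1 : (B.trace k).PreGNS)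

theorem gns_cyclicVector (a : M) :
    (B.trace k).gnsStarAlgHom a (B.cyclicVector k) =
      (((B.trace k).toPreGNS a : (B.trace k).PreGNS) : (B.trace k).GNS) := by
  simp [cyclicVector]

theorem inner_cyclicVector (a b : M) :
    inner ℂ ((B.trace k).gnsStarAlgHom a (B.cyclicVector k))
      ((B.trace k).gnsStarAlgHom b (B.cyclicVector k)) = B.E (star a * b) k := by
  rw [gns_cyclicVector, gns_cyclicVector, UniformSpace.Completion.inner_coe,
    PositiveLinearMap.preGNS_inner_def]
  rfl

theorem toFiber_surjective : Function.Surjective (B.toFiber k) := by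
  rintro ⟨_, a, rfl⟩
  exact ⟨a, rfl⟩

theorem toFiber_eq_zero_iff (a : M) : B.toFiber k a = 0 ↔ B.alg.seminorm k a = 0 := by
  constructor
  · intro h
    have h1 : (B.trace k).gnsStarAlgHom a = 0 := congrArg Subtype.val h
    have h2 := B.inner_cyclicVector k a a
    rw [h1] at h2
    rw [zero_apply, inner_zero_left] at h2
    have h3 : B.alg.E (star a * a) k = 0 := h2.symm
    simp [TracialAlgebra.seminorm, h3]
  · intro h
    apply Subtype.ext
    change (B.trace k).gnsStarAlgHom a = 0
    ext x
    induction x using UniformSpace.Completion.induction_on with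
    | hp => exact isClosed_eq (by fun_prop) (by fun_prop)
    | ih x =>
      have h1 : B.alg.seminorm k (a * (B.trace k).ofPreGNS x) ≤ 0 := by
        have := (B.alg_opBound ((B.trace k).ofPreGNS x)).mul_right a k
        rwa [h, mul_zero] at this
      have h2 : ‖(B.trace k).leftMulMapPreGNS a x‖ ≤ 0 := by
        rw [PositiveLinearMap.preGNS_norm_def]
        exact h1
      change (B.trace k).gnsNonUnitalStarAlgHom a x = 0
      rw [PositiveLinearMap.gnsNonUnitalStarAlgHom_apply_coe, ← norm_le_zero_iff,
        UniformSpace.Completion.norm_coe]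
      exact h2

/-- The vector state `x ↦ ⟨ξ, x ξ⟩` of the cyclic vector on the fiber. -/
noncomputable def fiberE : B.fiber k →ₗ[ℂ] C(Unit, ℂ) where
  toFun x := ContinuousMap.const Unit (inner ℂ (B.cyclicVector k) (x.1 (B.cyclicVector k)))
  map_add' x y := ContinuousMap.ext fun _ => by simp [inner_add_right]
  map_smul' c x := ContinuousMap.ext fun _ => by simp [inner_smul_right]

theorem fiberE_toFiber (a : M) (u : Unit) : B.fiberE k (B.toFiber k a) u = B.E a k := by
  have h := B.inner_cyclicVector k 1 a
  rw [map_one, star_one, one_mul] at h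
  exact h

/-- The fiber `M_k` with its vector state, that is, `π_k(a) ↦ τ_k(a)`. -/
noncomputable def fiberAlg : TracialAlgebra Unit (B.fiber k) where
  E := B.fiberE k
  E_one := ContinuousMap.ext fun u => by
    rw [← map_one (B.toFiber k), fiberE_toFiber, ← map_one B.incl, B.E_incl]
    rfl
  E_nonneg x u := by
    obtain ⟨a, rfl⟩ := B.toFiber_surjective k x
    rw [← map_star (B.toFiber k) a, ← map_mul (B.toFiber k) (star a) a, fiberE_toFiber]
    exact B.E_nonneg a k
  E_comm x y := ContinuousMap.ext fun u => by
    obtain ⟨a, rfl⟩ := B.toFiber_surjective k x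
    obtain ⟨b, rfl⟩ := B.toFiber_surjective k y
    rw [← map_mul (B.toFiber k) a b, ← map_mul (B.toFiber k) b a, fiberE_toFiber, fiberE_toFiber,
      B.E_comm]

theorem fiberAlg_seminorm (c : M) (u : Unit) :
    (B.fiberAlg k).seminorm u (B.toFiber k c) = B.alg.seminorm k c := by
  rw [TracialAlgebra.seminorm, TracialAlgebra.seminorm, ← map_star (B.toFiber k) c,
    ← map_mul (B.toFiber k) (star c) c]
  exact congrArg (fun z : ℂ => √z.re) (B.fiberE_toFiber k (star c * c) u)

theorem fiberAlg_bdd (x : B.fiber k) : ∃ C, (B.fiberAlg k).OpBound C x := by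
  obtain ⟨a, rfl⟩ := B.toFiber_surjective k x
  refine ⟨‖a‖, norm_nonneg a, fun y u => ?_⟩
  obtain ⟨b, rfl⟩ := B.toFiber_surjective k y
  rw [← map_mul (B.toFiber k) a b, fiberAlg_seminorm, fiberAlg_seminorm]
  exact (B.alg_opBound a).2 b k

variable {G : Type*} [Group G] (γ : G →* (M ≃⋆ₐ[ℂ] M))

/-- The map induced by `γ_g` on the fiber. -/
noncomputable def fiberMap (g : G) (x : B.fiber k) : B.fiber k :=
  B.toFiber k (γ g (Function.surjInv (B.toFiber_surjective k) x))

theorem fiberMap_toFiber (hγ : B.IsFiberwise γ) (g : G) (a : M) :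
    B.fiberMap k γ g (B.toFiber k a) = B.toFiber k (γ g a) := by
  rw [fiberMap, ← sub_eq_zero, ← map_sub, ← map_sub, toFiber_eq_zero_iff,
    TracialAlgebra.seminorm_map (hγ.E_act g), ← toFiber_eq_zero_iff, map_sub, sub_eq_zero]
  exact Function.surjInv_eq _ _

/-- The induced action `γ^k` on the fiber, which makes `π_k` equivariant. -/
noncomputable def fiberAct (hγ : B.IsFiberwise γ) : G →* (B.fiber k ≃⋆ₐ[ℂ] B.fiber k) :=
  have hf : ∀ g h x, B.fiberMap k γ g (B.fiberMap k γ h x) = B.fiberMap k γ (g * h) x := by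
    intro g h x
    obtain ⟨a, rfl⟩ := B.toFiber_surjective k x
    rw [B.fiberMap_toFiber k γ hγ, B.fiberMap_toFiber k γ hγ, B.fiberMap_toFiber k γ hγ, map_mul]
    rfl
  have hf1 : ∀ x, B.fiberMap k γ 1 x = x := by
    intro x
    obtain ⟨a, rfl⟩ := B.toFiber_surjective k x
    rw [B.fiberMap_toFiber k γ hγ, map_one]
    rfl
  { toFun := fun g =>
      { toFun := B.fiberMap k γ g
        invFun := B.fiberMap k γ g⁻¹
        left_inv := fun x => by rw [hf, inv_mul_cancel, hf1]
        right_inv := fun x => by rw [hf, mul_inv_cancel, hf1]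
        map_mul' := fun x y => by
          obtain ⟨a, rfl⟩ := B.toFiber_surjective k x
          obtain ⟨b, rfl⟩ := B.toFiber_surjective k y
          simp only [← map_mul, B.fiberMap_toFiber k γ hγ]
        map_add' := fun x y => by
          obtain ⟨a, rfl⟩ := B.toFiber_surjective k x
          obtain ⟨b, rfl⟩ := B.toFiber_surjective k y
          simp only [← map_add, B.fiberMap_toFiber k γ hγ]
        map_star' := fun x => by
          obtain ⟨a, rfl⟩ := B.toFiber_surjective k x
          simp only [← map_star, B.fiberMap_toFiber k γ hγ]
        map_smul' := fun c x => by
          obtain ⟨a, rfl⟩ := B.toFiber_surjective k x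
          simp only [← map_smul, B.fiberMap_toFiber k γ hγ] }
    map_one' := StarAlgEquiv.ext hf1
    map_mul' := fun g h => StarAlgEquiv.ext fun x => (hf g h x).symm }

theorem fiberAct_toFiber (hγ : B.IsFiberwise γ) (g : G) (a : M) :
    B.fiberAct k γ hγ g (B.toFiber k a) = B.toFiber k (γ g a) :=
  B.fiberMap_toFiber k γ hγ g a

theorem fiberE_fiberAct (hγ : B.IsFiberwise γ) (g : G) (x : B.fiber k) :
    (B.fiberAlg k).E (B.fiberAct k γ hγ g x) = (B.fiberAlg k).E x := by
  obtain ⟨a, rfl⟩ := B.toFiber_surjective k x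
  rw [fiberAct_toFiber]
  refine ContinuousMap.ext fun u => ?_
  exact (B.fiberE_toFiber k _ u).trans ((congrArg (fun f : C(K, ℂ) => f k) (hγ.E_act g a)).trans
    (B.fiberE_toFiber k a u).symm)

/-- The fiber `(M_k, γ^k)`, as a system over the one-point space. -/
noncomputable def fiberSystem (hγ : B.IsFiberwise γ) : TracialSystem G Unit where
  carrier := B.fiber k
  alg := B.fiberAlg k
  bdd := B.fiberAlg_bdd k
  act := B.fiberAct k γ hγ
  E_act := B.fiberE_fiberAct k γ hγ

end fiber

end WStarBundle

/-! ### The hyperfinite II₁ factor and McDuff actions -/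

/-- The tracial von Neumann algebra `R` is a hyperfinite II₁ factor: it has trivial center, is
infinite dimensional, and contains an increasing sequence of finite-dimensional
`*`-subalgebras with `‖·‖₂`-dense union. -/
structure IsHyperfiniteII1Factor {R : Type*} [CStarAlgebra R] (T : WStarBundle Unit R) : Prop where
  factor : ∀ z : R, (∀ x, z * x = x * z) → ∃ c : ℂ, z = algebraMap ℂ R c
  infinite_dimensional : ¬ FiniteDimensional ℂ R
  hyperfinite : ∃ F : ℕ → StarSubalgebra ℂ R, Monotone F ∧
    (∀ n, FiniteDimensional ℂ (F n)) ∧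
    ∀ x, ∀ ε > 0, ∃ n, ∃ b ∈ F n, T.alg.norm2u (x - b) < ε

/-- A McDuff action on `R`: one which is cocycle conjugate to a strongly McDuff action on `R`. -/
def IsMcDuff {R : Type*} [CStarAlgebra R] (T : WStarBundle Unit R) {G : Type*} [Group G]
    (δ : G →* (R ≃⋆ₐ[ℂ] R)) (hδ : T.IsFiberwise δ) : Prop :=
  ∃ (σ : G →* (R ≃⋆ₐ[ℂ] R)) (hσ : T.IsFiberwise σ), (T.system σ hσ).IsStronglyMcDuff ∧
    (T.system δ hδ).CocycleConjugate (T.system σ hσ)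

/-!
The action `δ` may be replaced by a strongly McDuff action `σ`, since cocycle conjugacy is
compatible with tensor products. Whether `X` absorbs `σ` is decided inside `X ⊗̄ R`: it suffices that
the embedding `X → X ⊗̄ R` is absorbing (`IsAbsorbing`), that is, there are almost fixed unitaries of
`X ⊗̄ R` which almost commute with finitely many elements of `X` and conjugate finitely many elements
of `R` almost into `X`. A one-sided approximate intertwining then yields the cocycle conjugacy
(`IsAbsorbing.exists_cocycle_conjugacy`); separability makes a countable induction possible, and the
conditional expectation onto the first factor supplies surjectivity.

Over a point, such unitaries exist as soon as the fiber absorbs `σ`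
(`CocycleConjugate.exists_unitary`). Strong McDuffness gives an almost fixed unitary in `R ⊗̄ R` that
conjugates the second factor almost into the first, and it gives almost central and almost
equivariant embeddings of `R` into the fiber along which this unitary is transported.

To pass from the fibers to the bundle, a unitary of the tensor product of a fiber with `R` is
approximated in the 2-norm by `exp(i h)` with `h` a self-adjoint algebraic tensor
(`exists_expI_of_near`, obtained by cutting the circle at a point of small spectral mass). Such an
`h` lifts to the bundle, and by continuity its exponential solves the problem near the given point
(`exists_lift_unitary`). Finitely many of these neighbourhoods cover the base, but a partition of
unity mixes the local solutions where it takes values strictly between `0` and `1`. For this reason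
it is cut into `N` layers (`exists_step_functions`) such that at each point all but a bounded number
of the layers are concentrated on a single local solution. Interpolating the exponents gives `N`
global unitaries, of which at each point at most `n` fail, with `n` independent of `N`
(`exists_layers`).

These unitaries are glued to one along an almost central partition of the unit by `N` projections of
small trace (`exists_central_partition`). The projections lie in the additional copy of `R` with the
trivial action, so they are fixed by the action; this is why that copy appears. In the 2-norm the
glued element is a weighted quadratic mean of its pieces, so that the few failing layers do not
matter (`exists_glued_unitary`, `isAbsorbing_of_local`).

Along the way the strict completion of a tracial `*`-algebra is shown to be a C*-algebra with a
strictly complete unit ball. This rests on Kaplansky's density theorem (`kaplansky`), proved by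
polynomial functional calculus in the GNS representations.
-/


set_option linter.unusedSectionVars false
set_option linter.overlappingInstances false

universe u' v' w'

namespace TracialAlgebra

/-! ### Operator bounds in tracial algebras -/

section opbound

variable {K : Type u} [TopologicalSpace K] {A : Type v} [Ring A] [StarRing A]
  [Algebra ℂ A] [StarModule ℂ A] {B : TracialAlgebra K A}

theorem seminorm_sub_comm (k : K) (a b : A) : B.seminorm k (a - b) = B.seminorm k (b - a) := by
  rw [← seminorm_neg, neg_sub]

theorem seminorm_sub_le (k : K) (a b c : A) :
    B.seminorm k (a - c) ≤ B.seminorm k (a - b) + B.seminorm k (b - c) := by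
  rw [← sub_add_sub_cancel a b c]
  exact B.seminorm_add_le k _ _

theorem seminorm_le_add (k : K) (a b : A) :
    B.seminorm k a ≤ B.seminorm k (a - b) + B.seminorm k b := by
  simpa using B.seminorm_add_le k (a - b) b

theorem seminorm_congr {k : K} {a b : A} (h : B.seminorm k (a - b) = 0) :
    B.seminorm k a = B.seminorm k b := by
  have h1 := B.seminorm_le_add k a b
  have h2 := B.seminorm_le_add k b a
  rw [B.seminorm_sub_comm, h] at h2
  rw [h] at h1
  linarith

theorem seminorm_sum_le {ι : Type*} (s : Finset ι) (k : K) (f : ι → A) :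
    B.seminorm k (∑ i ∈ s, f i) ≤ ∑ i ∈ s, B.seminorm k (f i) := by
  classical
  induction s using Finset.induction_on with
  | empty => simp [B.seminorm_zero]
  | insert a s ha ih =>
    rw [Finset.sum_insert ha, Finset.sum_insert ha]
    exact (B.seminorm_add_le _ _ _).trans (by gcongr)

theorem opBound_zero : B.OpBound 0 (0 : A) :=
  ⟨le_rfl, fun b k => by rw [zero_mul, seminorm_zero, zero_mul]⟩

theorem OpBound.smul {C : ℝ} {a : A} (h : B.OpBound C a) (c : ℂ) : B.OpBound (‖c‖ * C) (c • a) := by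
  have := (B.opBound_smul_one c).mul h
  rwa [smul_one_mul] at this

theorem opBound_one : B.OpBound 1 (1 : A) := by
  simpa using B.opBound_smul_one 1

theorem OpBound.neg {C : ℝ} {a : A} (h : B.OpBound C a) : B.OpBound C (-a) := by
  simpa using h.smul (-1)

theorem OpBound.pow {C : ℝ} {a : A} (h : B.OpBound C a) (n : ℕ) : B.OpBound (C ^ n) (a ^ n) := by
  induction n with
  | zero => simpa using B.opBound_one
  | succ n ih => rw [pow_succ, pow_succ]; exact ih.mul h

theorem OpBound.seminorm_le {C : ℝ} {a : A} (h : B.OpBound C a) (k : K) : B.seminorm k a ≤ C := by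
  simpa [B.seminorm_one] using h.2 1 k

theorem opBound_of_star_mul_self {C : ℝ} (hC : 0 ≤ C) {a : A}
    (h : B.OpBound (C ^ 2) (star a * a)) : B.OpBound C a := by
  refine ⟨hC, fun b k => ?_⟩
  refine (sq_le_sq₀ (B.seminorm_nonneg _ _) (mul_nonneg hC (B.seminorm_nonneg _ _))).1 ?_
  calc B.seminorm k (a * b) ^ 2 = ‖B.E (star b * (star a * a * b)) k‖ := by
        rw [← norm_E_apply_self, star_mul, mul_assoc, mul_assoc]
    _ ≤ B.seminorm k b * B.seminorm k (star a * a * b) := B.norm_E_mul_le _ _ _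
    _ ≤ B.seminorm k b * (C ^ 2 * B.seminorm k b) :=
        mul_le_mul_of_nonneg_left (h.2 _ _) (B.seminorm_nonneg _ _)
    _ = _ := by ring

theorem opBound_unitary {a : A} (h : star a * a = 1) : B.OpBound 1 a :=
  opBound_of_star_mul_self zero_le_one (by rw [h, one_pow]; exact opBound_one)

theorem continuous_seminorm (B : TracialAlgebra K A) (a : A) :
    Continuous fun k => B.seminorm k a := by
  unfold seminorm
  fun_prop

end opbound

/-! ### Polynomial functional calculus in the GNS representations -/

section gns

variable {K : Type u} [TopologicalSpace K] {A : Type v} [Ring A] [StarRing A]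
  [Algebra ℂ A] [StarModule ℂ A]

/-- The algebra `A` with the semi-inner product `⟨a, b⟩ = τ_k(a* b)`. -/
def PreGNS (_B : TracialAlgebra K A) (_k : K) : Type v := A

variable (B : TracialAlgebra K A) (k : K)

instance : AddCommGroup (B.PreGNS k) := inferInstanceAs (AddCommGroup A)
instance : Module ℂ (B.PreGNS k) := inferInstanceAs (Module ℂ A)

/-- The identity map from `A` to the pre-Hilbert space of `τ_k`. -/
def toPreGNS : A ≃ₗ[ℂ] B.PreGNS k := LinearEquiv.refl ℂ _

/-- The semi-inner product of `τ_k`, on the type synonym. -/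
noncomputable abbrev preGNSCore : PreInnerProductSpace.Core ℂ (B.PreGNS k) := B.core k

noncomputable instance : SeminormedAddCommGroup (B.PreGNS k) :=
  InnerProductSpace.Core.toSeminormedAddCommGroup (c := B.preGNSCore k)
noncomputable instance : InnerProductSpace ℂ (B.PreGNS k) :=
  InnerProductSpace.ofCore (B.preGNSCore k)

theorem inner_toPreGNS (a b : A) :
    inner ℂ (B.toPreGNS k a) (B.toPreGNS k b) = B.E (star a * b) k := rfl

/-- Left multiplication by an element on the pre-Hilbert space of `τ_k`. -/
noncomputable def leftMul (hb : ∀ a, ∃ C, B.OpBound C a) (a : A) : B.PreGNS k →L[ℂ] B.PreGNS k :=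
  ((B.toPreGNS k).toLinearMap ∘ₗ LinearMap.mulLeft ℂ a ∘ₗ
    (B.toPreGNS k).symm.toLinearMap).mkContinuous (hb a).choose fun x =>
      (hb a).choose_spec.2 ((B.toPreGNS k).symm x) k

theorem leftMul_apply (hb : ∀ a, ∃ C, B.OpBound C a) (a b : A) :
    B.leftMul k hb a (B.toPreGNS k b) = B.toPreGNS k (a * b) := rfl

/-- Left multiplication by an element on the GNS Hilbert space of `τ_k`. -/
noncomputable def gnsMul (hb : ∀ a, ∃ C, B.OpBound C a) (a : A) :
    UniformSpace.Completion (B.PreGNS k) →L[ℂ] UniformSpace.Completion (B.PreGNS k) :=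
  (B.leftMul k hb a).completion

theorem gnsMul_apply (hb : ∀ a, ∃ C, B.OpBound C a) (a b : A) :
    B.gnsMul k hb a (B.toPreGNS k b : UniformSpace.Completion (B.PreGNS k)) =
      (B.toPreGNS k (a * b) : UniformSpace.Completion (B.PreGNS k)) := by
  rw [gnsMul, ContinuousLinearMap.completion_apply_coe, leftMul_apply]

theorem gns_ext {x y : UniformSpace.Completion (B.PreGNS k) →L[ℂ]
    UniformSpace.Completion (B.PreGNS k)} (h : ∀ a : A, x (B.toPreGNS k a) = y (B.toPreGNS k a)) :
    x = y := by
  refine ContinuousLinearMap.ext fun z => ?_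
  induction z using UniformSpace.Completion.induction_on with
  | hp => exact isClosed_eq x.continuous y.continuous
  | ih z => exact h z

/-- The GNS representation of `τ_k`. -/
noncomputable def gns (hb : ∀ a, ∃ C, B.OpBound C a) :
    A →ₐ[ℂ] (UniformSpace.Completion (B.PreGNS k) →L[ℂ] UniformSpace.Completion (B.PreGNS k)) :=
  AlgHom.ofLinearMap
    { toFun := B.gnsMul k hb
      map_add' := fun a b => B.gns_ext k fun x => by
        rw [add_apply, gnsMul_apply, gnsMul_apply, gnsMul_apply, add_mul,
          map_add, UniformSpace.Completion.coe_add]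
      map_smul' := fun c a => B.gns_ext k fun x => by
        rw [smul_apply, gnsMul_apply, gnsMul_apply, smul_mul_assoc, map_smul,
          UniformSpace.Completion.coe_smul, RingHom.id_apply] }
    (B.gns_ext k fun x => (B.gnsMul_apply k hb _ _).trans (by rw [one_mul]; rfl))
    (fun a b => B.gns_ext k fun x => (B.gnsMul_apply k hb _ _).trans (by
      rw [mul_apply_eq_comp]
      refine Eq.trans ?_ (congrArg _ (B.gnsMul_apply k hb _ _)).symm
      refine Eq.trans ?_ (B.gnsMul_apply k hb _ _).symm
      rw [mul_assoc]))

theorem gns_apply (hb : ∀ a, ∃ C, B.OpBound C a) (a b : A) :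
    B.gns k hb a (B.toPreGNS k b : UniformSpace.Completion (B.PreGNS k)) =
      (B.toPreGNS k (a * b) : UniformSpace.Completion (B.PreGNS k)) :=
  B.gnsMul_apply k hb a b

theorem gns_star (hb : ∀ a, ∃ C, B.OpBound C a) (a : A) :
    B.gns k hb (star a) = star (B.gns k hb a) := by
  rw [ContinuousLinearMap.star_eq_adjoint]
  refine (ContinuousLinearMap.eq_adjoint_iff _ _).2 fun x y => ?_
  induction x, y using UniformSpace.Completion.induction_on₂ with
  | hp => apply isClosed_eq <;> fun_prop
  | ih x y =>
    obtain ⟨x, rfl⟩ := (B.toPreGNS k).surjective x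
    obtain ⟨y, rfl⟩ := (B.toPreGNS k).surjective y
    rw [gns_apply, gns_apply, UniformSpace.Completion.inner_coe, UniformSpace.Completion.inner_coe,
      inner_toPreGNS, inner_toPreGNS, star_mul, star_star, mul_assoc]

theorem norm_gns_le (hb : ∀ a, ∃ C, B.OpBound C a) {a : A} {C : ℝ} (h : B.OpBound C a) :
    ‖B.gns k hb a‖ ≤ C := by
  refine ContinuousLinearMap.opNorm_le_bound _ h.1 fun x => ?_
  induction x using UniformSpace.Completion.induction_on with
  | hp => apply isClosed_le <;> fun_prop
  | ih x =>
    obtain ⟨x, rfl⟩ := (B.toPreGNS k).surjective x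
    rw [gns_apply, UniformSpace.Completion.norm_coe, UniformSpace.Completion.norm_coe]
    exact h.2 x k

theorem opBound_of_norm_gns_le (hb : ∀ a, ∃ C, B.OpBound C a) {a : A} {C : ℝ} (hC : 0 ≤ C)
    (h : ∀ k, ‖B.gns k hb a‖ ≤ C) : B.OpBound C a := by
  refine ⟨hC, fun b k => ?_⟩
  have := (B.gns k hb a).le_of_opNorm_le (h k) (B.toPreGNS k b)
  rwa [gns_apply, UniformSpace.Completion.norm_coe, UniformSpace.Completion.norm_coe] at this

/-- The spectral bound for real polynomials in a self-adjoint element. -/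
theorem OpBound.aeval {B : TracialAlgebra K A} (hb : ∀ a, ∃ C, B.OpBound C a) {s : A}
    (hs : Star.star s = s) {c L : ℝ} (hc : B.OpBound c s) (q : Polynomial ℝ) (hL : 0 ≤ L)
    (hq : ∀ t, |t| ≤ c → |q.eval t| ≤ L) :
    B.OpBound L (Polynomial.aeval s (q.map (algebraMap ℝ ℂ))) := by
  refine B.opBound_of_norm_gns_le hb hL fun k => ?_
  have hsa : IsSelfAdjoint (B.gns k hb s) := by
    rw [IsSelfAdjoint, ← gns_star, hs]
  have hn : IsStarNormal (B.gns k hb s) := hsa.isStarNormal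
  rw [← Polynomial.aeval_algHom_apply, ← cfc_polynomial _ _ hn]
  refine norm_cfc_le hL fun z hz => ?_
  have hz1 : z = z.re := by
    have := hsa.mem_spectrum_eq_re hz
    exact this
  rw [hz1, ← Complex.coe_algebraMap, Polynomial.eval_map, Polynomial.eval₂_at_apply]
  rw [Complex.coe_algebraMap, Complex.norm_real]
  apply hq
  rcases subsingleton_or_nontrivial
    (UniformSpace.Completion (B.PreGNS k) →L[ℂ] UniformSpace.Completion (B.PreGNS k)) with h | h
  · simp at hz
  · refine (Complex.abs_re_le_norm z).trans ?_
    exact (spectrum.norm_le_norm_of_mem hz).trans (B.norm_gns_le k hb hc)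

end gns

end TracialAlgebra

namespace TracialAlgebra

/-! ### Kaplansky density and completeness of the strict completion -/

section kaplansky

variable {K : Type u} [TopologicalSpace K] [CompactSpace K] {A : Type v} [Ring A] [StarRing A]
  [Algebra ℂ A] [StarModule ℂ A] {B : TracialAlgebra K A}

theorem norm2u_sub_le (B : TracialAlgebra K A) (a b c : A) :
    B.norm2u (a - c) ≤ B.norm2u (a - b) + B.norm2u (b - c) := by
  rw [← sub_add_sub_cancel a b c]
  exact B.norm2u_add_le _ _

theorem OpBound.norm2u_le {C : ℝ} {a : A} (h : B.OpBound C a) : B.norm2u a ≤ C :=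
  B.norm2u_le h.1 fun k => h.seminorm_le k

theorem norm2u_smul_le (B : TracialAlgebra K A) (c : ℂ) (a : A) :
    B.norm2u (c • a) ≤ ‖c‖ * B.norm2u a := by
  refine B.norm2u_le (mul_nonneg (norm_nonneg _) (B.norm2u_nonneg _)) fun k => ?_
  rw [seminorm_smul]
  exact mul_le_mul_of_nonneg_left (B.seminorm_le_norm2u _ _) (norm_nonneg _)

variable (B) in
/-- The class of a bounded Cauchy sequence in the strict completion. -/
def cls : B.boundedCauchy →⋆ₐ[ℂ] B.Completion where
  toFun x := (x : B.nullCon.Quotient)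
  map_one' := rfl
  map_mul' _ _ := rfl
  map_zero' := rfl
  map_add' _ _ := rfl
  commutes' _ := rfl
  map_star' _ := rfl

variable (B) in
theorem cls_surjective : Function.Surjective B.cls := by
  rintro ⟨x⟩
  exact ⟨x, rfl⟩

theorem cls_eq_cls {x y : B.boundedCauchy} :
    B.cls x = B.cls y ↔ Tendsto (fun n => B.norm2u (x.1 n - y.1 n)) atTop (𝓝 0) :=
  RingCon.eq B.nullCon

theorem completion_E_cls (x : B.boundedCauchy) : B.completion.E (B.cls x) = B.limE x := rfl

theorem tendsto_norm2u_cls (x : B.boundedCauchy) :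
    Tendsto (fun n => B.norm2u (x.1 n)) atTop (𝓝 (B.completion.norm2u (B.cls x))) :=
  (Real.continuous_sqrt.tendsto _).comp (B.tendsto_limE (star x * x)).norm

/-- The constant sequence of a bounded element. -/
def constSeq (hb : ∀ a, ∃ C, B.OpBound C a) (a : A) : B.boundedCauchy :=
  ⟨fun _ => a, (hb a).imp fun _ h _ => h, fun ε hε => ⟨0, fun m _ n _ => by
    rw [sub_self, norm2u_zero]; exact hε⟩⟩

/-- The canonical map of a tracial `*`-algebra of bounded elements into its strict completion. -/
noncomputable def of (hb : ∀ a, ∃ C, B.OpBound C a) : A →⋆ₐ[ℂ] B.Completion where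
  toFun a := B.cls (constSeq hb a)
  map_one' := rfl
  map_mul' _ _ := rfl
  map_zero' := rfl
  map_add' _ _ := rfl
  commutes' _ := rfl
  map_star' _ := rfl

variable (hb : ∀ a, ∃ C, B.OpBound C a)

theorem of_apply (a : A) : of hb a = B.cls (constSeq hb a) := rfl

theorem E_of (a : A) : B.completion.E (of hb a) = B.E a :=
  B.limE_eq (x := constSeq hb a) tendsto_const_nhds

theorem seminorm_of (k : K) (a : A) : B.completion.seminorm k (of hb a) = B.seminorm k a := by
  rw [seminorm, ← map_star, ← map_mul, E_of, seminorm]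

theorem norm2u_of (a : A) : B.completion.norm2u (of hb a) = B.norm2u a := by
  rw [norm2u, ← map_star, ← map_mul, E_of, norm2u]

theorem tendsto_of_cls (x : B.boundedCauchy) :
    Tendsto (fun n => B.completion.norm2u (B.cls x - of hb (x.1 n))) atTop (𝓝 0) := by
  rw [Metric.tendsto_atTop]
  intro ε hε
  obtain ⟨N, hN⟩ := x.2.2 (ε / 2) (half_pos hε)
  refine ⟨N, fun n hn => ?_⟩
  have h : B.completion.norm2u (B.cls x - of hb (x.1 n)) ≤ ε / 2 := by
    rw [of_apply, ← map_sub]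
    refine le_of_tendsto (tendsto_norm2u_cls _) ?_
    filter_upwards [eventually_ge_atTop N] with m hm
    exact (hN m hm n hn).le
  rw [Real.dist_eq, sub_zero, abs_of_nonneg (B.completion.norm2u_nonneg _)]
  linarith

theorem OpBound.cls {C : ℝ} {x : B.boundedCauchy} (h : ∀ n, B.OpBound C (x.1 n)) :
    B.completion.OpBound C (B.cls x) := by
  refine ⟨(h 0).1, ?_⟩
  rintro ⟨y⟩ k
  exact le_of_tendsto_of_tendsto' (B.seminorm_tendsto (x * y) k)
    ((B.seminorm_tendsto y k).const_mul C) fun n => (h n).2 (y.1 n) k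

theorem OpBound.of {C : ℝ} {a : A} (h : B.OpBound C a) :
    B.completion.OpBound C (TracialAlgebra.of hb a) :=
  OpBound.cls fun _ => h

theorem completion_faithful {x : B.Completion} (h : B.completion.norm2u x = 0) : x = 0 := by
  obtain ⟨x, rfl⟩ := B.cls_surjective x
  rw [← map_zero B.cls, cls_eq_cls]
  have := tendsto_norm2u_cls x
  rw [h] at this
  simpa using this

/-- The truncation `t ↦ C / max(C, √|t|)`, up to a uniform error, by a polynomial. -/
theorem exists_truncation {C : ℝ} (hC : 0 < C) (r : ℝ) {δ : ℝ} (hδ : 0 < δ) :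
    ∃ p : Polynomial ℝ, (∀ t, |t| ≤ r → √|t| * |p.eval t| ≤ C + √r * δ) ∧
      ∀ t, |t| ≤ r → |t| ≤ C ^ 2 → |1 - p.eval t| ≤ δ := by
  obtain ⟨p, hp⟩ := exists_polynomial_near_of_continuousOn (-r) r (fun t => C / max C √|t|)
    (by
      refine Continuous.continuousOn (continuous_const.div (by fun_prop) fun t => ?_)
      exact (lt_of_lt_of_le hC (le_max_left _ _)).ne') δ hδ
  refine ⟨p, fun t ht => ?_, fun t ht htC => ?_⟩
  · have h1 := (hp t (Set.mem_Icc.2 (abs_le.1 ht))).le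
    have h2 : |p.eval t| ≤ C / max C √|t| + δ := by
      have h0 : 0 ≤ C / max C √|t| := by positivity
      calc |p.eval t| = abs ((p.eval t - C / max C √|t|) + C / max C √|t|) := by ring_nf
        _ ≤ δ + C / max C √|t| := (abs_add_le _ _).trans (by rw [abs_of_nonneg h0]; gcongr)
        _ = _ := add_comm _ _
    calc √|t| * |p.eval t| ≤ √|t| * (C / max C √|t| + δ) := by gcongr
      _ = √|t| * (C / max C √|t|) + √|t| * δ := by ring
      _ ≤ C + √r * δ := by
        gcongr
        rw [mul_div_assoc', div_le_iff₀ (lt_of_lt_of_le hC (le_max_left _ _)), mul_comm]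
        gcongr
        exact le_max_right _ _
  · have h1 := (hp t (Set.mem_Icc.2 (abs_le.1 ht))).le
    have h2 : √|t| ≤ C := Real.sqrt_le_iff.2 ⟨hC.le, htC⟩
    rwa [max_eq_left h2, div_self hC.ne', abs_sub_comm] at h1

include hb in
/-- Kaplansky density: elements of operator norm at most `C` of the strict completion are
approximated by elements of operator norm at most `C` of the algebra itself. -/
theorem kaplansky {C : ℝ} {x : B.Completion} (hx : B.completion.OpBound C x) {ε : ℝ} (hε : 0 < ε) :
    ∃ a, B.OpBound C a ∧ B.completion.norm2u (x - of hb a) < ε := by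
  rcases hx.1.eq_or_lt with hC | hC
  · subst hC
    refine ⟨0, B.opBound_zero, ?_⟩
    rw [map_zero, sub_zero]
    exact hx.norm2u_le.trans_lt hε
  obtain ⟨y, rfl⟩ := B.cls_surjective x
  obtain ⟨D, hD⟩ := y.2.1
  have hD0 : 0 ≤ D := (hD 0).1
  set r : ℝ := max (D ^ 2) (C ^ 2)
  have hr : 0 ≤ r := (sq_nonneg C).trans (le_max_right _ _)
  set δ : ℝ := ε / (4 * (C + √r))
  have hsr : 0 ≤ √r := Real.sqrt_nonneg r
  have hδ : 0 < δ := by positivity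
  obtain ⟨p, hp1, hp2⟩ := exists_truncation hC r hδ
  set L : ℝ := C + √r * δ
  have hL : 0 < L := by positivity
  let P : Polynomial ℂ := p.map (algebraMap ℝ ℂ)
  -- the truncated sequence `y_n p(y_n* y_n)`
  let z : B.boundedCauchy := y * Polynomial.aeval (star y * y) P
  have hs : ∀ {R : Type _} [Ring R] [StarRing R] [Algebra ℂ R] [StarModule ℂ R] (s : R)
      (q : Polynomial ℝ), star s = s → star (Polynomial.aeval s (q.map (algebraMap ℝ ℂ))) =
        Polynomial.aeval s (q.map (algebraMap ℝ ℂ)) := by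
    intro R _ _ _ _ s q hs
    rw [Polynomial.aeval_eq_sum_range, star_sum]
    refine Finset.sum_congr rfl fun i _ => ?_
    rw [star_smul, star_pow, hs, Polynomial.coeff_map, Complex.coe_algebraMap, Complex.star_def,
      Complex.conj_ofReal]
  have hz : ∀ n, z.1 n = y.1 n * Polynomial.aeval (star (y.1 n) * y.1 n) P := by
    intro n
    have := Polynomial.aeval_algHom_apply
      ((Pi.evalAlgHom ℂ (fun _ : ℕ => A) n).comp B.boundedCauchy.subtype.toAlgHom) (star y * y) P
    change y.1 n * _ = y.1 n * _
    exact congrArg _ this.symm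
  have hmz : B.cls z = B.cls y * Polynomial.aeval (star (B.cls y) * B.cls y) P := by
    have := Polynomial.aeval_algHom_apply B.cls.toAlgHom (star y * y) P
    change B.cls (y * _) = _
    rw [map_mul]
    exact congrArg _ this.symm
  have hzb : ∀ n, B.OpBound L (z.1 n) := by
    intro n
    refine opBound_of_star_mul_self hL.le ?_
    have hsn : B.OpBound r (star (y.1 n) * y.1 n) := by
      refine ((hD n).star.mul (hD n)).mono ?_
      rw [← sq]; exact le_max_left _ _
    have := OpBound.aeval hb (s := star (y.1 n) * y.1 n) (by simp) hsn (p * Polynomial.X * p)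
      (sq_nonneg L) (fun t ht => by
        have h := pow_le_pow_left₀ (by positivity) (hp1 t ht) 2
        rw [mul_pow, Real.sq_sqrt (abs_nonneg _)] at h
        simp only [Polynomial.eval_mul, Polynomial.eval_X, abs_mul]
        calc _ = |t| * |p.eval t| ^ 2 := by ring
          _ ≤ _ := h)
    rw [Polynomial.map_mul, Polynomial.map_mul, Polynomial.map_X, map_mul, map_mul,
      Polynomial.aeval_X] at this
    rw [hz, star_mul, hs _ _ (by simp)]
    simpa only [mul_assoc] using this
  have h1 : B.completion.norm2u (B.cls y - B.cls z) ≤ C * δ := by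
    refine OpBound.norm2u_le (opBound_of_star_mul_self (by positivity) ?_)
    have hsn : B.completion.OpBound (C ^ 2) (star (B.cls y) * B.cls y) := by
      rw [sq]; exact hx.star.mul hx
    have := OpBound.aeval B.completion_bdd (s := star (B.cls y) * B.cls y) (by simp) hsn
      ((1 - p) * Polynomial.X * (1 - p)) (sq_nonneg (C * δ)) (fun t ht => by
        have h := hp2 t (ht.trans (le_max_right _ _)) ht
        simp only [Polynomial.eval_mul, Polynomial.eval_X, Polynomial.eval_sub,
          Polynomial.eval_one, abs_mul]
        calc _ = |t| * |1 - p.eval t| ^ 2 := by ring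
          _ ≤ C ^ 2 * δ ^ 2 := by gcongr
          _ = _ := by ring)
    rw [Polynomial.map_mul, Polynomial.map_mul, Polynomial.map_X, map_mul, map_mul,
      Polynomial.aeval_X] at this
    have he : B.cls y - B.cls z = B.cls y * Polynomial.aeval (star (B.cls y) * B.cls y)
        ((1 - p).map (algebraMap ℝ ℂ)) := by
      rw [hmz, Polynomial.map_sub, Polynomial.map_one, map_sub, map_one, mul_sub, mul_one]
    rw [he, star_mul, hs _ _ (by simp)]
    simpa only [mul_assoc] using this
  obtain ⟨n, hn⟩ :=
    ((tendsto_of_cls hb z).eventually_lt_const (show 0 < ε / 4 by positivity)).exists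
  refine ⟨((C / L : ℝ) : ℂ) • z.1 n, ?_, ?_⟩
  · have := (hzb n).smul ((C / L : ℝ) : ℂ)
    rwa [Complex.norm_real, Real.norm_of_nonneg (by positivity), div_mul_cancel₀ _ hL.ne'] at this
  · have h2 : B.completion.norm2u (of hb (z.1 n) - of hb (((C / L : ℝ) : ℂ) • z.1 n)) ≤ √r * δ := by
      rw [← map_sub, norm2u_of]
      have he : z.1 n - ((C / L : ℝ) : ℂ) • z.1 n = ((1 - C / L : ℝ) : ℂ) • z.1 n := by
        rw [Complex.ofReal_sub, sub_smul, Complex.ofReal_one, one_smul]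
      rw [he]
      refine (B.norm2u_smul_le _ _).trans ?_
      have h3 : 0 ≤ 1 - C / L := by
        rw [sub_nonneg, div_le_one hL]
        exact le_add_of_nonneg_right (by positivity)
      rw [Complex.norm_real, Real.norm_of_nonneg h3]
      calc _ ≤ (1 - C / L) * L := by gcongr; exact (hzb n).norm2u_le
        _ = √r * δ := by rw [sub_mul, div_mul_cancel₀ _ hL.ne', one_mul]; simp [L]
    have h4 : (C + √r) * δ = ε / 4 := by
      simp only [δ]; field_simp
    calc _ ≤ B.completion.norm2u (B.cls y - B.cls z) +
          (B.completion.norm2u (B.cls z - of hb (z.1 n)) +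
          B.completion.norm2u (of hb (z.1 n) - of hb (((C / L : ℝ) : ℂ) • z.1 n))) :=
          (norm2u_sub_le _ _ (B.cls z) _).trans (by gcongr; exact norm2u_sub_le _ _ _ _)
      _ < ε := by nlinarith

/-- Bounded sequences of the strict completion which are Cauchy in the uniform 2-norm converge,
without increase of the operator norm. -/
theorem completion_complete (hb : ∀ a, ∃ C, B.OpBound C a) {C : ℝ} {x : ℕ → B.Completion}
    (hx : ∀ n, B.completion.OpBound C (x n)) (hc : B.completion.IsCauchy x) :
    ∃ y, B.completion.OpBound C y ∧
      Tendsto (fun n => B.completion.norm2u (x n - y)) atTop (𝓝 0) := by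
  choose a ha ha' using fun n : ℕ => kaplansky hb (hx n) (Nat.one_div_pos_of_nat (α := ℝ) (n := n))
  have h0 : Tendsto (fun n => B.completion.norm2u (x n - of hb (a n))) atTop (𝓝 0) :=
    squeeze_zero (fun _ => B.completion.norm2u_nonneg _) (fun n => (ha' n).le)
      tendsto_one_div_add_atTop_nhds_zero_nat
  have hac : B.IsCauchy a := by
    intro ε hε
    obtain ⟨N₁, h₁⟩ := hc (ε / 3) (by positivity)
    obtain ⟨N₂, h₂⟩ := eventually_atTop.1 (h0.eventually_lt_const (show 0 < ε / 3 by positivity))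
    refine ⟨max N₁ N₂, fun m hm n hn => ?_⟩
    have e₁ := h₁ m (le_of_max_le_left hm) n (le_of_max_le_left hn)
    have e₂ := h₂ m (le_of_max_le_right hm)
    have e₃ := h₂ n (le_of_max_le_right hn)
    rw [← norm2u_of hb, map_sub]
    rw [norm2u_sub_comm] at e₂
    calc _ ≤ B.completion.norm2u (of hb (a m) - x m) + (B.completion.norm2u (x m - x n) +
          B.completion.norm2u (x n - of hb (a n))) :=
          (norm2u_sub_le _ _ (x m) _).trans (by gcongr; exact norm2u_sub_le _ _ _ _)
      _ < ε := by linarith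
  let y : B.boundedCauchy := ⟨a, ⟨C, ha⟩, hac⟩
  refine ⟨B.cls y, OpBound.cls ha, ?_⟩
  refine squeeze_zero (fun n => B.completion.norm2u_nonneg _)
    (fun n => norm2u_sub_le _ _ (of hb (a n)) _) ?_
  have := h0.add (tendsto_of_cls hb y)
  simpa only [add_zero, B.completion.norm2u_sub_comm (B.cls y)] using this

end kaplansky

end TracialAlgebra

namespace TracialAlgebra

/-! ### The strict completion as a C*-algebra -/

section cstar

variable {K : Type u} [TopologicalSpace K] {A : Type v} [Ring A] [StarRing A]
  [Algebra ℂ A] [StarModule ℂ A] (B : TracialAlgebra K A)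

/-- The operator norm `inf {C | ‖a b‖_{2,k} ≤ C ‖b‖_{2,k} for all b, k}`. -/
noncomputable def opNorm (a : A) : ℝ := sInf {C | B.OpBound C a}

theorem opNorm_nonneg (a : A) : 0 ≤ B.opNorm a := Real.sInf_nonneg fun _ h => h.1

variable {B} in
theorem OpBound.opNorm_le {C : ℝ} {a : A} (h : B.OpBound C a) : B.opNorm a ≤ C :=
  csInf_le ⟨0, fun _ h => h.1⟩ h

variable {B}

theorem opBound_opNorm {a : A} (h : ∃ C, B.OpBound C a) : B.OpBound (B.opNorm a) a := by
  refine ⟨B.opNorm_nonneg a, fun b k => ?_⟩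
  refine le_of_forall_pos_le_add fun ε hε => ?_
  obtain ⟨C, hC, hlt⟩ := Real.lt_sInf_add_pos h
    (show 0 < ε / (B.seminorm k b + 1) from div_pos hε
      (add_pos_of_nonneg_of_pos (B.seminorm_nonneg k b) one_pos))
  have h0 := B.seminorm_nonneg k b
  calc B.seminorm k (a * b) ≤ C * B.seminorm k b := hC.2 b k
    _ ≤ (B.opNorm a + ε / (B.seminorm k b + 1)) * B.seminorm k b := by gcongr; exact hlt.le
    _ = B.opNorm a * B.seminorm k b + ε * (B.seminorm k b / (B.seminorm k b + 1)) := by ring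
    _ ≤ B.opNorm a * B.seminorm k b + ε * 1 := by
      gcongr
      rw [div_le_one (by positivity)]
      linarith
    _ = _ := by ring

variable [CompactSpace K]

noncomputable instance : NormedRing B.Completion where
  norm := B.completion.opNorm
  dist a b := B.completion.opNorm (-a + b)
  dist_self a := by
    rw [neg_add_cancel]
    exact le_antisymm B.completion.opBound_zero.opNorm_le (B.completion.opNorm_nonneg _)
  dist_comm a b := by
    have h : ∀ x, B.completion.opNorm (-x) ≤ B.completion.opNorm x := fun x =>
      (opBound_opNorm (B.completion_bdd x)).neg.opNorm_le
    refine le_antisymm ?_ ?_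
    · simpa using h (-b + a)
    · simpa using h (-a + b)
  dist_triangle a b c := by
    have := ((opBound_opNorm (B.completion_bdd (-a + b))).add
      (opBound_opNorm (B.completion_bdd (-b + c)))).opNorm_le
    rwa [neg_add_eq_sub, neg_add_eq_sub, sub_add_sub_comm, add_comm b, add_sub_add_right_eq_sub,
      ← neg_add_eq_sub, ← neg_add_eq_sub, ← neg_add_eq_sub] at this
  eq_of_dist_eq_zero {a b} h := by
    have h1 := opBound_opNorm (B.completion_bdd (-a + b))
    have h2 : B.completion.norm2u (-a + b) = 0 :=
      le_antisymm (h1.norm2u_le.trans h.le) (B.completion.norm2u_nonneg _)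
    have := completion_faithful h2
    rw [neg_add_eq_sub, sub_eq_zero] at this
    exact this.symm
  dist_eq a b := rfl
  norm_mul_le a b := ((opBound_opNorm (B.completion_bdd a)).mul
    (opBound_opNorm (B.completion_bdd b))).opNorm_le

theorem opBound_norm (x : B.Completion) : B.completion.OpBound ‖x‖ x :=
  opBound_opNorm (B.completion_bdd x)

theorem OpBound.norm_le {C : ℝ} {x : B.Completion} (h : B.completion.OpBound C x) : ‖x‖ ≤ C :=
  h.opNorm_le

theorem norm2u_le_norm (x : B.Completion) : B.completion.norm2u x ≤ ‖x‖ :=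
  (opBound_norm x).norm2u_le

noncomputable instance : NormedAlgebra ℂ B.Completion where
  norm_smul_le c x := ((opBound_norm x).smul c).norm_le

instance : CStarRing B.Completion where
  norm_mul_self_le x := by
    have h : B.completion.OpBound √‖star x * x‖ x :=
      opBound_of_star_mul_self (Real.sqrt_nonneg _)
        (by rw [Real.sq_sqrt (norm_nonneg _)]; exact opBound_norm _)
    have h2 := pow_le_pow_left₀ (norm_nonneg x) h.norm_le 2
    rwa [Real.sq_sqrt (norm_nonneg _), sq] at h2

/-- A tracial `*`-algebra all of whose elements are bounded. The strict completion is complete in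
the operator norm only because of Kaplansky's density theorem, which needs this. -/
class IsBounded (B : TracialAlgebra K A) : Prop where
  bdd : ∀ a, ∃ C, B.OpBound C a

instance [hB : IsBounded B] : CompleteSpace B.Completion := by
  refine Metric.complete_of_cauchySeq_tendsto fun x hx => ?_
  obtain ⟨C, hC⟩ := hx.isBounded_range.exists_norm_le
  have hb : ∀ n, B.completion.OpBound C (x n) := fun n =>
    (opBound_norm (x n)).mono (hC _ ⟨n, rfl⟩)
  obtain ⟨y, -, hy⟩ := completion_complete hB.bdd hb (by
    intro ε hε
    obtain ⟨N, hN⟩ := Metric.cauchySeq_iff.1 hx ε hε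
    refine ⟨N, fun m hm n hn => ?_⟩
    refine (norm2u_le_norm _).trans_lt ?_
    rw [← dist_eq_norm]
    exact hN m hm n hn)
  refine ⟨y, Metric.tendsto_atTop.2 fun ε hε => ?_⟩
  obtain ⟨N, hN⟩ := Metric.cauchySeq_iff.1 hx (ε / 2) (half_pos hε)
  refine ⟨N, fun n hn => lt_of_le_of_lt ?_ (half_lt_self hε)⟩
  rw [dist_eq_norm]
  refine OpBound.norm_le ⟨(half_pos hε).le, fun b k => ?_⟩
  -- the operator bound of `x n - x m` passes to the limit in the 2-norm
  have h1 : Tendsto (fun m => B.completion.seminorm k ((x m - y) * b)) atTop (𝓝 0) := by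
    obtain ⟨D, hD⟩ := B.completion_bdd b
    refine squeeze_zero (fun _ => B.completion.seminorm_nonneg _ _)
      (fun m => (hD.mul_right _ k).trans (mul_le_mul_of_nonneg_left
        (B.completion.seminorm_le_norm2u k _) hD.1)) (by simpa using hy.const_mul D)
  refine le_of_tendsto' (x := atTop)
    (f := fun m => B.completion.seminorm k ((x n - y) * b) -
      B.completion.seminorm k ((x (max m N) - y) * b)) ?_ fun m => ?_
  · have := (h1.comp (tendsto_atTop_mono (fun m => le_max_left m N) tendsto_id)).const_sub
      (B.completion.seminorm k ((x n - y) * b))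
    simpa using this
  · rw [sub_le_iff_le_add]
    have e : (x n - y) * b = (x n - x (max m N)) * b + (x (max m N) - y) * b := by
      rw [← add_mul, sub_add_sub_cancel]
    rw [e]
    refine (B.completion.seminorm_add_le _ _ _).trans ?_
    gcongr
    have h2 := (hN n hn (max m N) (le_max_right _ _)).le
    rw [dist_eq_norm] at h2
    exact ((opBound_norm (x n - x (max m N))).mono h2).2 b k

noncomputable instance [IsBounded B] : CStarAlgebra B.Completion where

instance : IsBounded B.completion := ⟨B.completion_bdd⟩

end cstar

end TracialAlgebra

namespace TracialAlgebra

/-! ### Exponentials and logarithms of unitaries in the 2-norm -/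

section exponential

variable {K : Type u} [TopologicalSpace K] {A : Type v} [Ring A] [StarRing A]
  [Algebra ℂ A] [StarModule ℂ A] {B : TracialAlgebra K A}

/-- The difference of two one-parameter groups has derivative `a - b` at the origin. -/
theorem tendsto_smul_exp_sub_exp {X : Type*} [NormedRing X] [NormedAlgebra ℂ X] [CompleteSpace X]
    (a b : X) : Tendsto (fun n : ℕ => (n : ℂ) •
      (NormedSpace.exp ((n : ℂ)⁻¹ • a) - NormedSpace.exp ((n : ℂ)⁻¹ • b))) atTop (𝓝 (a - b)) := by
  have hf : HasDerivAt (fun t : ℂ => NormedSpace.exp (t • a) - NormedSpace.exp (t • b))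
      (a - b) 0 := by
    refine ((hasDerivAt_exp_smul_const (𝕂 := ℂ) a (0 : ℂ)).fun_sub
      (hasDerivAt_exp_smul_const (𝕂 := ℂ) b (0 : ℂ))).congr_deriv ?_
    simp
  have ht : Tendsto (fun n : ℕ => ((n : ℂ)⁻¹)) atTop (𝓝[≠] 0) := by
    refine tendsto_nhdsWithin_iff.2 ⟨?_, ?_⟩
    · rw [tendsto_zero_iff_norm_tendsto_zero]
      simpa using tendsto_inv_atTop_nhds_zero_nat (𝕜 := ℝ)
    · filter_upwards [eventually_gt_atTop 0] with n hn
      simpa using hn.ne'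
  simpa [Function.comp_def] using hf.tendsto_slope_zero.comp ht

theorem seminorm_pow_sub_pow_le {x y : A} (hx : B.OpBound 1 x) (hy : B.OpBound 1 y) (k : K)
    (n : ℕ) :
    B.seminorm k (x ^ n - y ^ n) ≤ n * B.seminorm k (x - y) := by
  induction n with
  | zero => simp [B.seminorm_zero]
  | succ n ih =>
    have e : x ^ (n + 1) - y ^ (n + 1) = x ^ n * (x - y) + (x ^ n - y ^ n) * y := by
      rw [pow_succ, pow_succ]; noncomm_ring
    rw [e]
    have h1 := (hx.pow n).2 (x - y) k
    have h2 := hy.mul_right (x ^ n - y ^ n) k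
    rw [one_pow, one_mul] at h1
    rw [one_mul] at h2
    push_cast
    linarith [B.seminorm_add_le k (x ^ n * (x - y)) ((x ^ n - y ^ n) * y)]

theorem opBound_of_mem_unitary {x : A} (hx : x ∈ unitary A) : B.OpBound 1 x :=
  opBound_unitary (Unitary.star_mul_self_of_mem hx)

variable [CompactSpace K]

theorem continuous_completion_seminorm (B : TracialAlgebra K A) (k : K) :
    Continuous fun x : B.Completion => B.completion.seminorm k x := by
  refine (LipschitzWith.of_le_add fun x y => ?_ : LipschitzWith 1 _).continuous
  rw [dist_eq_norm, add_comm]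
  exact (B.completion.seminorm_le_add k x y).trans (by
    gcongr
    exact (B.completion.seminorm_le_norm2u _ _).trans (norm2u_le_norm _))

variable [B.IsBounded]

/-- The unitary `exp(i h)` of a self-adjoint element of the strict completion. -/
noncomputable def expI (h : B.Completion) : B.Completion := NormedSpace.exp (Complex.I • h)

theorem expI_mem_unitary {h : B.Completion} (hh : IsSelfAdjoint h) :
    expI h ∈ unitary B.Completion :=
  (selfAdjoint.expUnitary (⟨h, hh⟩ : selfAdjoint B.Completion)).2

/-- The exponential `h ↦ exp(i h)` is contractive in every 2-norm. -/
theorem seminorm_expI_sub_le {x y : B.Completion} (hx : IsSelfAdjoint x) (hy : IsSelfAdjoint y)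
    (k : K) : B.completion.seminorm k (expI x - expI y) ≤ B.completion.seminorm k (x - y) := by
  let +nondep : NormedAlgebra ℚ B.Completion := .restrictScalars ℚ ℂ B.Completion
  have h2 := ((continuous_completion_seminorm B k).tendsto _).comp
    (tendsto_smul_exp_sub_exp (Complex.I • x) (Complex.I • y))
  rw [← smul_sub] at h2
  have e : B.completion.seminorm k (Complex.I • (x - y)) = B.completion.seminorm k (x - y) := by
    rw [seminorm_smul]; simp
  rw [e] at h2
  refine ge_of_tendsto h2 ?_
  filter_upwards [eventually_gt_atTop 0] with n hn
  have hsa : ∀ z : B.Completion, IsSelfAdjoint z →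
      NormedSpace.exp ((n : ℂ)⁻¹ • (Complex.I • z)) ∈ unitary B.Completion := by
    intro z hz
    rw [smul_comm]
    refine expI_mem_unitary ?_
    refine IsSelfAdjoint.smul ?_ hz
    simp [IsSelfAdjoint]
  have hpow : ∀ z : B.Completion,
      expI z = NormedSpace.exp ((n : ℂ)⁻¹ • (Complex.I • z)) ^ n := by
    intro z
    rw [← NormedSpace.exp_nsmul, ← Nat.cast_smul_eq_nsmul ℂ, smul_smul,
      mul_inv_cancel₀ (by exact_mod_cast hn.ne'), one_smul, expI]
  have h3 := seminorm_pow_sub_pow_le (B := B.completion) (opBound_of_mem_unitary (hsa x hx))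
    (opBound_of_mem_unitary (hsa y hy)) k n
  rw [← hpow, ← hpow] at h3
  refine h3.trans (le_of_eq ?_)
  rw [Function.comp, seminorm_smul]
  simp

/-- A continuous real-valued cut-off of the argument on the unit circle. -/
theorem continuousOn_arg_mul_min (m : ℝ) :
    ContinuousOn (fun z : ℂ => z.arg * min 1 (m * ‖z + 1‖)) (Metric.sphere 0 1) := by
  intro z hz
  by_cases h : z ∈ Complex.slitPlane
  · exact ((Complex.continuousAt_arg h).mul (by fun_prop)).continuousWithinAt
  · have hz1 : z = -1 := by
      by_contra hne
      exact h ((Complex.subset_slitPlane_iff_of_subset_sphere (s := {z})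
        (r := 1) (by simpa using hz)).2 (by simpa using fun h => hne h.symm) rfl)
    subst hz1
    have h0 : (-1 : ℂ).arg * min 1 (m * ‖(-1 : ℂ) + 1‖) = 0 := by simp
    refine ContinuousAt.continuousWithinAt ?_
    rw [ContinuousAt, h0]
    refine bdd_le_mul_tendsto_zero (b := -Real.pi) (B := Real.pi)
      (Eventually.of_forall fun z => (Complex.neg_pi_lt_arg z).le)
      (Eventually.of_forall fun z => Complex.arg_le_pi z) ?_
    have : Continuous fun z : ℂ => min 1 (m * ‖z + 1‖) := by fun_prop
    simpa using this.tendsto (-1)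

/-- The branch of the argument with a continuous cut-off around the point `-exp(-i t)`. -/
noncomputable def cutArg (m t : ℝ) (z : ℂ) : ℝ :=
  let w := Complex.exp (t * Complex.I) * z
  w.arg * min 1 (m * ‖w + 1‖) - t

theorem continuousOn_cutArg (m t : ℝ) : ContinuousOn (cutArg m t) (Metric.sphere 0 1) := by
  unfold cutArg
  refine ContinuousOn.sub ((continuousOn_arg_mul_min m).comp (by fun_prop) ?_) continuousOn_const
  intro z hz
  simpa [Complex.norm_exp_ofReal_mul_I] using hz

/-- Away from the cut, `cutArg` is a logarithm. -/
theorem exp_cutArg {m t : ℝ} {z : ℂ} (hz : ‖z‖ = 1)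
    (h : 1 ≤ m * ‖Complex.exp (t * Complex.I) * z + 1‖) :
    Complex.exp (Complex.I * cutArg m t z) = z := by
  have hw : ‖Complex.exp (t * Complex.I) * z‖ = 1 := by simp [Complex.norm_exp_ofReal_mul_I, hz]
  have h1 := Complex.norm_mul_exp_arg_mul_I (Complex.exp (t * Complex.I) * z)
  rw [hw, Complex.ofReal_one, one_mul] at h1
  rw [cutArg, min_eq_left h, mul_one]
  push_cast
  rw [mul_sub, Complex.exp_sub, mul_comm, h1, mul_comm Complex.I]
  field_simp

section cstar

variable {X : Type w} [CStarAlgebra X] {Q : TracialAlgebra K X}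

/-- Monotonicity of the trace on the functional calculus of a normal element: `c - f(v)` is a
square. -/
theorem re_E_cfc_le {v : X} (hv : IsStarNormal v) (k : K) {f : ℂ → ℝ}
    (hf : ContinuousOn f (spectrum ℂ v)) {c : ℝ} (hc : ∀ z ∈ spectrum ℂ v, f z ≤ c) :
    (Q.E (cfc (fun z => (f z : ℂ)) v) k).re ≤ c := by
  have hfc : ContinuousOn (fun z => (f z : ℂ)) (spectrum ℂ v) :=
    Complex.continuous_ofReal.comp_continuousOn hf
  have hg : ContinuousOn (fun z => (√(c - f z) : ℂ)) (spectrum ℂ v) :=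
    Complex.continuous_ofReal.comp_continuousOn
      (Real.continuous_sqrt.comp_continuousOn (continuousOn_const.sub hf))
  have e : star (cfc (fun z => (√(c - f z) : ℂ)) v) * cfc (fun z => (√(c - f z) : ℂ)) v =
      algebraMap ℂ _ (c : ℂ) - cfc (fun z => (f z : ℂ)) v := by
    rw [← cfc_star, ← cfc_const (c : ℂ) v, ← cfc_sub _ _ v, ← cfc_mul _ _ v
      (by simpa using hg) hg]
    refine cfc_congr fun z hz => ?_
    simp only [Complex.star_def, Complex.conj_ofReal]
    rw [← Complex.ofReal_mul, Real.mul_self_sqrt (sub_nonneg.2 (hc z hz)), Complex.ofReal_sub]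
  have h := (Complex.nonneg_iff.1 (Q.E_nonneg (cfc (fun z => (√(c - f z) : ℂ)) v) k)).1
  rw [e, map_sub, Algebra.algebraMap_eq_smul_one, map_smul, Q.E_one] at h
  simpa using h

/-- Every unitary is approximated in the 2-norm by exponentials: cut the circle at one of `n` many
points, in a neighbourhood of which the spectral measure is small. -/
theorem exists_exp_near {v : X} (hv : v ∈ unitary X) (k : K) {ε : ℝ}
    (hε : 0 < ε) : ∃ h, IsSelfAdjoint h ∧
      Q.seminorm k (v - NormedSpace.exp (Complex.I • h)) < ε := by
  have hn : IsStarNormal v := ⟨by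
    rw [commute_iff_eq, Unitary.star_mul_self_of_mem hv, Unitary.mul_star_self_of_mem hv]⟩
  have hsp : spectrum ℂ v ⊆ Metric.sphere 0 1 := spectrum.subset_circle_of_unitary hv
  obtain ⟨n, hn4⟩ := exists_nat_gt (4 / ε ^ 2)
  have hn0 : (0 : ℝ) < n := lt_of_le_of_lt (by positivity) hn4
  let t : ℕ → ℝ := fun j => j / n
  let p : ℕ → ℂ := fun j => Complex.exp (t j * Complex.I)
  have hp : ∀ i < n, ∀ j < n, i ≠ j → p i ≠ p j := by
    intro i hi j hj hij h
    have h1 : ∀ l < n, 0 ≤ t l ∧ t l < 1 := fun l hl =>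
      ⟨by positivity, (div_lt_one hn0).2 (by exact_mod_cast hl)⟩
    have h2 := congrArg Complex.arg h
    simp only [p] at h2
    have h3 := Real.pi_gt_three
    rw [Complex.arg_exp_mul_I, Complex.arg_exp_mul_I, (toIocMod_eq_self _).2,
      (toIocMod_eq_self _).2]
      at h2
    · simp only [t] at h2
      rw [div_left_inj' hn0.ne'] at h2
      exact hij (by exact_mod_cast h2)
    · constructor <;> linarith [h1 j hj]
    · constructor <;> linarith [h1 i hi]
  let m : ℝ := ∑ i ∈ Finset.range n, ∑ j ∈ Finset.range n, 2 / ‖p i - p j‖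
  have hm : ∀ i < n, ∀ j < n, i ≠ j → 2 ≤ m * ‖p i - p j‖ := by
    intro i hi j hj hij
    have h1 : 2 / ‖p i - p j‖ ≤ m := by
      refine (Finset.single_le_sum (f := fun j => 2 / ‖p i - p j‖) (fun _ _ => by positivity)
        (Finset.mem_range.2 hj)).trans ?_
      exact Finset.single_le_sum (f := fun i => ∑ j ∈ Finset.range n, 2 / ‖p i - p j‖)
        (fun _ _ => by positivity) (Finset.mem_range.2 hi)
    rwa [div_le_iff₀ (norm_pos_iff.2 (sub_ne_zero.2 (hp i hi j hj hij)))] at h1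
  let D : ℕ → ℂ → ℂ := fun j z => Complex.exp (Complex.I * cutArg m (t j) z) - z
  have hD : ∀ j, ContinuousOn (D j) (spectrum ℂ v) := fun j =>
    ((Complex.continuous_exp.comp
      (continuous_const.mul Complex.continuous_ofReal)).comp_continuousOn
      ((continuousOn_cutArg m (t j)).mono hsp)).sub continuousOn_id
  have hsum : ∀ z ∈ spectrum ℂ v, ∑ j ∈ Finset.range n, ‖D j z‖ ^ 2 ≤ 4 := by
    intro z hz
    have hz1 : ‖z‖ = 1 := by simpa using hsp hz
    have h4 : ∀ j, ‖D j z‖ ^ 2 ≤ 4 := by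
      intro j
      have : ‖D j z‖ ≤ 2 := by
        refine (norm_sub_le _ _).trans ?_
        rw [hz1, mul_comm, Complex.norm_exp_ofReal_mul_I]; norm_num
      nlinarith [norm_nonneg (D j z)]
    by_cases h : ∀ j ∈ Finset.range n, D j z = 0
    · rw [Finset.sum_eq_zero fun j hj => by rw [h j hj]; simp]; norm_num
    push Not at h
    obtain ⟨j, hj, hj0⟩ := h
    rw [Finset.sum_eq_single_of_mem j hj]
    · exact h4 j
    intro i hi hij
    by_contra hne
    have hi0 : D i z ≠ 0 := fun h => hne (by rw [h]; simp)
    have key : ∀ l, D l z ≠ 0 → m * ‖p l * z + 1‖ < 1 := by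
      intro l hl
      by_contra hcon
      exact hl (sub_eq_zero.2 (exp_cutArg hz1 (not_lt.1 hcon)))
    have hm0 : 0 ≤ m := Finset.sum_nonneg fun _ _ => Finset.sum_nonneg fun _ _ => by positivity
    have h5 : ‖p i - p j‖ ≤ ‖p i * z + 1‖ + ‖p j * z + 1‖ := by
      have : ‖p i - p j‖ = ‖(p i * z + 1) - (p j * z + 1)‖ := by
        rw [add_sub_add_right_eq_sub, ← sub_mul, norm_mul, hz1, mul_one]
      rw [this]; exact norm_sub_le _ _
    have h6 := hm i (Finset.mem_range.1 hi) j (Finset.mem_range.1 hj) hij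
    have h7 := mul_le_mul_of_nonneg_left h5 hm0
    linarith [key i hi0, key j hj0]
  have hS : ∑ j ∈ Finset.range n, Q.seminorm k (cfc (D j) v) ^ 2 ≤ 4 := by
    have h1 : ∀ j, Q.seminorm k (cfc (D j) v) ^ 2 =
        (Q.E (cfc (fun z => ((‖D j z‖ ^ 2 : ℝ) : ℂ)) v) k).re := by
      intro j
      rw [seminorm_sq, ← cfc_star, ← cfc_mul (fun z => star (D j z)) (D j) v
        (continuous_star.comp_continuousOn (hD j)) (hD j)]
      congr 3
      refine cfc_congr fun z _ => ?_
      simp only [Complex.star_def]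
      rw [← Complex.normSq_eq_conj_mul_self, Complex.normSq_eq_norm_sq]
    have h2 := re_E_cfc_le (Q := Q) hn k (f := fun z => ∑ j ∈ Finset.range n, ‖D j z‖ ^ 2)
      (continuousOn_finsetSum _ fun j _ => (hD j).norm.pow 2) hsum
    refine le_trans (le_of_eq ?_) h2
    rw [Finset.sum_congr rfl fun j _ => h1 j]
    have e : (fun z => ((∑ j ∈ Finset.range n, ‖D j z‖ ^ 2 : ℝ) : ℂ)) =
        ∑ j ∈ Finset.range n, fun z => ((‖D j z‖ ^ 2 : ℝ) : ℂ) := by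
      ext z; simp
    rw [e, cfc_sum (fun j z => ((‖D j z‖ ^ 2 : ℝ) : ℂ)) v _ fun j _ =>
      Complex.continuous_ofReal.comp_continuousOn ((hD j).norm.pow 2)]
    simp
  obtain ⟨j, hj, hj4⟩ : ∃ j ∈ Finset.range n, Q.seminorm k (cfc (D j) v) ^ 2 < ε ^ 2 := by
    by_contra hcon
    push Not at hcon
    have h1 := Finset.card_nsmul_le_sum _ _ _ hcon
    rw [Finset.card_range, nsmul_eq_mul] at h1
    rw [div_lt_iff₀ (by positivity)] at hn4
    linarith
  have hcont : ContinuousOn (fun z => (cutArg m (t j) z : ℂ)) (spectrum ℂ v) :=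
    Complex.continuous_ofReal.comp_continuousOn ((continuousOn_cutArg m (t j)).mono hsp)
  refine ⟨cfc (fun z => (cutArg m (t j) z : ℂ)) v, ?_, ?_⟩
  · rw [isSelfAdjoint_iff, ← cfc_star]
    simp
  · have e : cfc (D j) v =
        NormedSpace.exp (Complex.I • cfc (fun z => (cutArg m (t j) z : ℂ)) v) - v := by
      rw [← CFC.exp_eq_normedSpace_exp (𝕜 := ℂ), ← cfc_comp_smul .., ← cfc_comp' ..]
      conv_rhs => rw [← cfc_id' ℂ v]
      rw [cfc_sub _ _ v]
      simp [← Complex.exp_eq_exp_ℂ, cfc_id' ℂ v]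
    rw [e] at hj4
    rw [seminorm_sub_comm]
    exact lt_of_pow_lt_pow_left₀ 2 hε.le hj4

end cstar

theorem exists_expI_near {v : B.Completion} (hv : v ∈ unitary B.Completion) (k : K) {ε : ℝ}
    (hε : 0 < ε) : ∃ h, IsSelfAdjoint h ∧ B.completion.seminorm k (v - expI h) < ε :=
  exists_exp_near (Q := B.completion) hv k hε

/-- Every unitary is approximated in the 2-norm by exponentials of self-adjoint elements of the
underlying algebra. -/
theorem exists_expI_of_near {v : B.Completion} (hv : v ∈ unitary B.Completion) (k : K) {ε : ℝ}
    (hε : 0 < ε) : ∃ h : A, IsSelfAdjoint h ∧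
      B.completion.seminorm k (v - expI (of IsBounded.bdd h)) < ε := by
  obtain ⟨h, hh, hh'⟩ := exists_expI_near hv k (half_pos hε)
  obtain ⟨C, hC⟩ := B.completion_bdd h
  obtain ⟨a, -, ha⟩ := kaplansky IsBounded.bdd hC (half_pos hε)
  set b : A := (2⁻¹ : ℂ) • (a + star a)
  have hb : IsSelfAdjoint b := by
    rw [isSelfAdjoint_iff, star_smul, star_add, star_star, add_comm]
    simp [b]
  have hbo : IsSelfAdjoint (of (B := B) IsBounded.bdd b) := hb.map _
  refine ⟨b, hb, ?_⟩
  have e : h - of IsBounded.bdd b = (2⁻¹ : ℂ) • ((h - of IsBounded.bdd a) +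
      star (h - of IsBounded.bdd a)) := by
    rw [star_sub, hh.star_eq, map_smul, map_add, map_star, sub_add_sub_comm, smul_sub,
      ← two_smul ℂ h,
      smul_smul]
    norm_num
  have h1 : B.completion.seminorm k (h - of IsBounded.bdd b) < ε / 2 := by
    refine lt_of_le_of_lt ?_ ha
    rw [e, seminorm_smul]
    have h2 := B.completion.seminorm_add_le k (h - of IsBounded.bdd a)
      (star (h - of IsBounded.bdd a))
    rw [seminorm_star] at h2
    have h3 := B.completion.seminorm_le_norm2u k (h - of IsBounded.bdd a)
    rw [show ‖(2⁻¹ : ℂ)‖ = 2⁻¹ by norm_num]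
    linarith
  calc _ ≤ B.completion.seminorm k (v - expI h) +
        B.completion.seminorm k (expI h - expI (of IsBounded.bdd b)) :=
        B.completion.seminorm_sub_le k _ _ _
    _ < ε := by linarith [seminorm_expI_sub_le hh hbo k]

end exponential

end TracialAlgebra

namespace TracialAlgebra

/-! ### Functoriality of the strict completion -/

section functoriality

variable {K : Type u} [TopologicalSpace K] {A : Type v} [Ring A] [StarRing A]
  [Algebra ℂ A] [StarModule ℂ A] {B : TracialAlgebra K A}
  {K' : Type u'} [TopologicalSpace K'] {A' : Type v'} [Ring A'] [StarRing A']
  [Algebra ℂ A'] [StarModule ℂ A'] {B' : TracialAlgebra K' A'}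
  {K'' : Type w'} [TopologicalSpace K''] {A'' : Type w} [Ring A''] [StarRing A'']
  [Algebra ℂ A''] [StarModule ℂ A''] {B'' : TracialAlgebra K'' A''}

/-- In an algebra of bounded elements the operator norm of `x` is determined by the growth of the
2-norms of the powers of `x* x`. -/
theorem opBound_of_seminorm_pow_le [hB : B.IsBounded] {x : A} {C : ℝ} (hC : 0 ≤ C)
    (h : ∀ k n, B.seminorm k ((star x * x) ^ n) ≤ (C ^ 2) ^ n) : B.OpBound C x := by
  refine ⟨hC, fun b k => ?_⟩
  set s := star x * x with hs
  have hsn : ∀ n, star (s ^ n) = s ^ n := fun n => by rw [star_pow, hs, star_mul, star_star]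
  set r := B.seminorm k (x * b)
  set c := B.seminorm k b
  have hc : 0 ≤ c := B.seminorm_nonneg k b
  have hr : 0 ≤ r := B.seminorm_nonneg k _
  obtain ⟨D, hD⟩ := hB.bdd b
  have h1 : ∀ n, r ^ (2 ^ (n + 1)) ≤ c ^ (2 ^ (n + 1) - 1) * B.seminorm k (s ^ 2 ^ n * b) := by
    intro n
    induction n with
    | zero =>
      calc r ^ (2 ^ (0 + 1)) = ‖B.E (star b * (s * b)) k‖ := by
            rw [zero_add, pow_one, ← norm_E_apply_self, star_mul, hs]; simp only [mul_assoc]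
        _ ≤ c * B.seminorm k (s * b) := B.norm_E_mul_le _ _ _
        _ = _ := by simp
    | succ n ih =>
      have h2 : B.seminorm k (s ^ 2 ^ n * b) ^ 2 ≤ c * B.seminorm k (s ^ 2 ^ (n + 1) * b) := by
        calc _ = ‖B.E (star b * (s ^ 2 ^ (n + 1) * b)) k‖ := by
              rw [← norm_E_apply_self, star_mul, hsn, pow_succ 2 n, pow_mul, sq]
              simp only [mul_assoc]
          _ ≤ _ := B.norm_E_mul_le _ _ _
      have h3 := pow_le_pow_left₀ (by positivity) ih 2
      have e : (2 ^ (n + 1) - 1) * 2 + 1 = 2 ^ (n + 1 + 1) - 1 := by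
        have := Nat.one_le_two_pow (n := n + 1)
        rw [pow_succ 2 (n + 1)]; omega
      calc r ^ 2 ^ (n + 1 + 1) = (r ^ 2 ^ (n + 1)) ^ 2 := by rw [← pow_mul, ← pow_succ]
        _ ≤ (c ^ (2 ^ (n + 1) - 1) * B.seminorm k (s ^ 2 ^ n * b)) ^ 2 := h3
        _ = c ^ ((2 ^ (n + 1) - 1) * 2) * B.seminorm k (s ^ 2 ^ n * b) ^ 2 := by
          rw [mul_pow, ← pow_mul]
        _ ≤ c ^ ((2 ^ (n + 1) - 1) * 2) * (c * B.seminorm k (s ^ 2 ^ (n + 1) * b)) := by gcongr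
        _ = _ := by rw [← mul_assoc, ← pow_succ, e]
  have h2 : ∀ n, r ^ (2 ^ (n + 1)) ≤ c ^ (2 ^ (n + 1) - 1) * (D * C ^ (2 ^ (n + 1))) := by
    intro n
    refine (h1 n).trans ?_
    gcongr
    refine (hD.mul_right _ k).trans ?_
    refine mul_le_mul_of_nonneg_left ((h k _).trans (le_of_eq ?_)) hD.1
    rw [← pow_mul, ← pow_succ']
  by_contra! hlt
  rcases hc.eq_or_lt with hc0 | hc0
  · have := h2 0
    rw [← hc0] at this hlt
    simp only [zero_add, pow_one, mul_zero] at this hlt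
    norm_num at this
    nlinarith [pow_pos hlt 2]
  · have hr0 : 0 < r := lt_of_le_of_lt (by positivity) hlt
    have h3 : ∀ n, c * r ^ (2 ^ (n + 1)) ≤ D * (C * c) ^ 2 ^ (n + 1) := by
      intro n
      have e : c ^ 2 ^ (n + 1) = c * c ^ (2 ^ (n + 1) - 1) := by
        rw [← pow_succ', Nat.sub_add_cancel Nat.one_le_two_pow]
      calc c * r ^ (2 ^ (n + 1)) ≤ c * (c ^ (2 ^ (n + 1) - 1) * (D * C ^ (2 ^ (n + 1)))) := by
            gcongr; exact h2 n
        _ = D * C ^ (2 ^ (n + 1)) * (c * c ^ (2 ^ (n + 1) - 1)) := by ring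
        _ = _ := by rw [← e, mul_pow]; ring
    rcases (mul_nonneg hC hc).eq_or_lt with h0 | h0
    · have := h3 0
      rw [← h0] at this
      norm_num at this
      nlinarith [pow_pos hr0 2]
    · obtain ⟨n, hn⟩ := pow_unbounded_of_one_lt (D / c) ((one_lt_div h0).2 hlt)
      have h4 : D / c < (r / (C * c)) ^ 2 ^ (n + 1) := by
        refine hn.trans_le (pow_le_pow_right₀ ((one_lt_div h0).2 hlt).le ?_)
        exact (Nat.lt_two_pow_self.trans (Nat.pow_lt_pow_right one_lt_two n.lt_succ_self)).le
      rw [div_pow, div_lt_div_iff₀ hc0 (by positivity)] at h4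
      linarith [h3 n]

variable (B B') in
/-- The `*`-homomorphism `f : A → A'` intertwines the expectations along the map `κ : K' → K` of
base spaces: `τ_{k'} ∘ f = τ_{κ(k')}`. -/
def IntertwinesE (κ : K' → K) (f : A →⋆ₐ[ℂ] A') : Prop := ∀ a k, B'.E (f a) k = B.E a (κ k)

namespace IntertwinesE

variable {κ : K' → K} {f : A →⋆ₐ[ℂ] A'}

theorem seminorm_map (hf : B.IntertwinesE B' κ f) (k : K') (a : A) :
    B'.seminorm k (f a) = B.seminorm (κ k) a := by
  rw [seminorm, ← map_star, ← map_mul, hf, seminorm]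

/-- A `*`-homomorphism which intertwines the expectations is contractive in operator norm. No
C*-structure is assumed: the operator bound is read off from the traces of powers. -/
theorem opBound_map [B'.IsBounded] (hf : B.IntertwinesE B' κ f) {C : ℝ} {a : A}
    (h : B.OpBound C a) : B'.OpBound C (f a) := by
  refine opBound_of_seminorm_pow_le h.1 fun k n => ?_
  rw [← map_star, ← map_mul, ← map_pow, hf.seminorm_map]
  have := (h.star.mul h).pow n
  rw [← sq] at this
  exact this.seminorm_le _

theorem norm2u_map_le [CompactSpace K] [CompactSpace K'] (hf : B.IntertwinesE B' κ f) (a : A) :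
    B'.norm2u (f a) ≤ B.norm2u a :=
  B'.norm2u_le (B.norm2u_nonneg a) fun k => by
    rw [hf.seminorm_map]; exact B.seminorm_le_norm2u _ _

theorem comp {κ' : K'' → K'} {f' : A' →⋆ₐ[ℂ] A''} (hf' : B'.IntertwinesE B'' κ' f')
    (hf : B.IntertwinesE B' κ f) : B.IntertwinesE B'' (κ ∘ κ') (f'.comp f) :=
  fun _ _ => (hf' _ _).trans (hf _ _)

variable [CompactSpace K] [CompactSpace K'] [B'.IsBounded]

/-- Termwise application of a `*`-homomorphism to a bounded Cauchy sequence. -/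
def mapBoundedCauchy (hf : B.IntertwinesE B' κ f) (x : B.boundedCauchy) : B'.boundedCauchy :=
  ⟨fun n => f (x.1 n), x.2.1.imp fun _ h n => hf.opBound_map (h n), fun ε hε =>
    (x.2.2 ε hε).imp fun N hN m hm n hn => by
      rw [← map_sub]
      exact (hf.norm2u_map_le _).trans_lt (hN m hm n hn)⟩

/-- The extension of a `*`-homomorphism to the strict completions. -/
noncomputable def completionMap (hf : B.IntertwinesE B' κ f) :
    B.Completion →⋆ₐ[ℂ] B'.Completion where
  toFun := Quotient.map hf.mapBoundedCauchy (by
    intro x y (h : Tendsto (fun n => B.norm2u (x.1 n - y.1 n)) atTop (𝓝 0))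
    change Tendsto (fun n => B'.norm2u (f (x.1 n) - f (y.1 n))) atTop (𝓝 0)
    refine squeeze_zero (fun _ => B'.norm2u_nonneg _) (fun n => ?_) h
    rw [← map_sub]
    exact hf.norm2u_map_le _)
  map_one' := congrArg (Quotient.mk _) (Subtype.ext (funext fun _ => map_one f))
  map_zero' := congrArg (Quotient.mk _) (Subtype.ext (funext fun _ => map_zero f))
  map_mul' := by
    rintro ⟨x⟩ ⟨y⟩
    exact congrArg (Quotient.mk _) (Subtype.ext (funext fun _ => map_mul f _ _))
  map_add' := by
    rintro ⟨x⟩ ⟨y⟩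
    exact congrArg (Quotient.mk _) (Subtype.ext (funext fun _ => map_add f _ _))
  commutes' c := congrArg (Quotient.mk _) (Subtype.ext (funext fun _ => AlgHomClass.commutes f c))
  map_star' := by
    rintro ⟨x⟩
    exact congrArg (Quotient.mk _) (Subtype.ext (funext fun _ => map_star f _))

theorem completionMap_cls (hf : B.IntertwinesE B' κ f) (x : B.boundedCauchy) :
    hf.completionMap (B.cls x) = B'.cls (hf.mapBoundedCauchy x) := rfl

theorem completion (hf : B.IntertwinesE B' κ f) :
    B.completion.IntertwinesE B'.completion κ hf.completionMap := by
  intro x k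
  obtain ⟨x, rfl⟩ := B.cls_surjective x
  rw [completionMap_cls, completion_E_cls, completion_E_cls]
  refine tendsto_nhds_unique (B'.tendsto_limE_apply _ k) ?_
  refine (B.tendsto_limE_apply x (κ k)).congr fun n => ?_
  exact (hf _ _).symm

end IntertwinesE

/-- Mutually inverse `*`-homomorphisms extend to an isomorphism of strict completions. -/
noncomputable def completionEquiv [CompactSpace K] [CompactSpace K'] [B.IsBounded] [B'.IsBounded]
    {κ : K' → K} {κ' : K → K'} {f : A →⋆ₐ[ℂ] A'} {f' : A' →⋆ₐ[ℂ] A} (hf : B.IntertwinesE B' κ f)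
    (hf' : B'.IntertwinesE B κ' f') (h : ∀ a, f' (f a) = a) (h' : ∀ a, f (f' a) = a) :
    B.Completion ≃⋆ₐ[ℂ] B'.Completion :=
  StarAlgEquiv.ofBijective hf.completionMap (Function.bijective_iff_has_inverse.2
    ⟨hf'.completionMap, by
      rintro ⟨x⟩
      exact congrArg (Quotient.mk _) (Subtype.ext (funext fun _ => h _)), by
      rintro ⟨x⟩
      exact congrArg (Quotient.mk _) (Subtype.ext (funext fun _ => h' _))⟩)

end functoriality

/-! ### Tensor products -/

section tensor

variable {K : Type u} [TopologicalSpace K] {A : Type v} [Ring A] [StarRing A]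
  [Algebra ℂ A] [StarModule ℂ A] {B : TracialAlgebra K A}
  {K' : Type u'} [TopologicalSpace K'] {A' : Type v'} [Ring A'] [StarRing A']
  [Algebra ℂ A'] [StarModule ℂ A'] {B' : TracialAlgebra K' A'}
  {D : Type w} [Ring D] [StarRing D] [Algebra ℂ D] [StarModule ℂ D] {T : TracialAlgebra Unit D}
  {D' : Type w'} [Ring D'] [StarRing D'] [Algebra ℂ D'] [StarModule ℂ D']
  {T' : TracialAlgebra Unit D'}

/-- The tensor product of two `*`-homomorphisms. -/
noncomputable def starTensorMap (f : A →⋆ₐ[ℂ] A') (g : D →⋆ₐ[ℂ] D') :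
    A ⊗[ℂ] D →⋆ₐ[ℂ] A' ⊗[ℂ] D' :=
  { Algebra.TensorProduct.map f.toAlgHom g.toAlgHom with
    map_star' := fun t => by
      induction t with
      | zero => simp
      | tmul a d =>
        change f (star a) ⊗ₜ[ℂ] g (star d) = star (f a ⊗ₜ[ℂ] g d)
        rw [map_star, map_star, TensorProduct.star_tmul]
      | add s t hs ht =>
        rw [star_add]
        exact (map_add (Algebra.TensorProduct.map f.toAlgHom g.toAlgHom) _ _).trans
          ((congrArg₂ (· + ·) hs ht).trans ((star_add _ _).symm.trans (congrArg star
            (map_add (Algebra.TensorProduct.map f.toAlgHom g.toAlgHom) _ _).symm))) }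

theorem starTensorMap_tmul (f : A →⋆ₐ[ℂ] A') (g : D →⋆ₐ[ℂ] D') (a : A) (d : D) :
    starTensorMap f g (a ⊗ₜ d) = f a ⊗ₜ g d := rfl

theorem IntertwinesE.tensor {κ : K' → K} {f : A →⋆ₐ[ℂ] A'} (hf : B.IntertwinesE B' κ f)
    {κ' : Unit → Unit} {g : D →⋆ₐ[ℂ] D'} (hg : T.IntertwinesE T' κ' g) :
    (B.algTensor T).IntertwinesE (B'.algTensor T') κ (starTensorMap f g) := by
  intro t k
  induction t with
  | zero => simp
  | add s t hs ht => rw [map_add, map_add, map_add, ContinuousMap.add_apply, hs, ht]; rfl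
  | tmul a d =>
    change (T'.E (g d) () • B'.E (f a)) k = (T.E d () • B.E a) (κ k)
    rw [ContinuousMap.smul_apply, ContinuousMap.smul_apply, hf, hg]

theorem seminorm_tmul (k : K) (a : A) (d : D) :
    (B.algTensor T).seminorm k (a ⊗ₜ d) = B.seminorm k a * T.seminorm () d := by
  refine (sq_eq_sq₀ (seminorm_nonneg _ _ _)
    (mul_nonneg (seminorm_nonneg _ _ _) (seminorm_nonneg _ _ _))).1 ?_
  rw [mul_pow, ← norm_E_apply_self, ← norm_E_apply_self, ← norm_E_apply_self,
    TensorProduct.star_tmul, Algebra.TensorProduct.tmul_mul_tmul, mul_comm]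
  change ‖(T.E (star d * d) () • B.E (star a * a)) k‖ = _
  rw [ContinuousMap.smul_apply, norm_smul]

instance [hB : B.IsBounded] [hT : T.IsBounded] : (B.algTensor T).IsBounded where
  bdd t := by
    induction t with
    | zero => exact ⟨0, opBound_zero⟩
    | add s t hs ht =>
      obtain ⟨C, hC⟩ := hs
      obtain ⟨D, hD⟩ := ht
      exact ⟨_, hC.add hD⟩
    | tmul a d =>
      obtain ⟨C, hC⟩ := hB.bdd a
      obtain ⟨D, hD⟩ := hT.bdd d
      have := (B.algTensor_opBound_left T hC).mul (B.algTensor_opBound_right T hD)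
      rw [Algebra.TensorProduct.tmul_mul_tmul, one_mul, mul_one] at this
      exact ⟨_, this⟩

variable [CompactSpace K] [CompactSpace K'] [hB : B.IsBounded] [hT : T.IsBounded]
  [hB' : B'.IsBounded] [hT' : T'.IsBounded]

variable (B T) in
/-- The embedding of the first tensor factor into the strict tensor product. -/
noncomputable def inlHom : A →⋆ₐ[ℂ] (B.algTensor T).Completion where
  toFun a := of IsBounded.bdd (a ⊗ₜ 1)
  map_one' := rfl
  map_mul' a b := by
    rw [← map_mul, Algebra.TensorProduct.tmul_mul_tmul, one_mul]
  map_zero' := by rw [TensorProduct.zero_tmul, map_zero]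
  map_add' a b := by rw [TensorProduct.add_tmul, map_add]
  commutes' _ := rfl
  map_star' a := by rw [← map_star, TensorProduct.star_tmul, star_one]

variable (B T) in
/-- The embedding of the second tensor factor into the strict tensor product. -/
noncomputable def inrHom : D →⋆ₐ[ℂ] (B.algTensor T).Completion where
  toFun d := of IsBounded.bdd (1 ⊗ₜ d)
  map_one' := rfl
  map_mul' a b := by
    rw [← map_mul, Algebra.TensorProduct.tmul_mul_tmul, one_mul]
  map_zero' := by rw [TensorProduct.tmul_zero, map_zero]
  map_add' a b := by rw [TensorProduct.tmul_add, map_add]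
  commutes' c := by
    rw [Algebra.algebraMap_eq_smul_one, TensorProduct.tmul_smul, map_smul,
      Algebra.algebraMap_eq_smul_one]
    rfl
  map_star' a := by rw [← map_star, TensorProduct.star_tmul, star_one]

theorem of_tmul (a : A) (d : D) :
    of (B := B.algTensor T) IsBounded.bdd (a ⊗ₜ d) = B.inlHom T a * B.inrHom T d := by
  change _ = of IsBounded.bdd (a ⊗ₜ 1) * of IsBounded.bdd (1 ⊗ₜ d)
  rw [← map_mul, Algebra.TensorProduct.tmul_mul_tmul, one_mul, mul_one]

theorem inl_mul_inr_comm (a : A) (d : D) :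
    B.inlHom T a * B.inrHom T d = B.inrHom T d * B.inlHom T a := by
  change of IsBounded.bdd (a ⊗ₜ 1) * of IsBounded.bdd (1 ⊗ₜ d) =
    of IsBounded.bdd (1 ⊗ₜ d) * of IsBounded.bdd (a ⊗ₜ 1)
  rw [← map_mul, ← map_mul, Algebra.TensorProduct.tmul_mul_tmul,
    Algebra.TensorProduct.tmul_mul_tmul, one_mul, mul_one, one_mul, mul_one]

theorem E_inl_mul_inr (a : A) (d : D) :
    (B.algTensor T).completion.E (B.inlHom T a * B.inrHom T d) = T.E d () • B.E a := by
  rw [← of_tmul, E_of]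
  rfl

theorem inl_intertwinesE : B.IntertwinesE (B.algTensor T).completion id (B.inlHom T) := by
  intro a k
  have := E_inl_mul_inr (B := B) (T := T) a 1
  rw [map_one, mul_one, T.E_one] at this
  rw [this]
  simp

theorem seminorm_inl (k : K) (a : A) :
    (B.algTensor T).completion.seminorm k (B.inlHom T a) = B.seminorm k a :=
  inl_intertwinesE.seminorm_map k a

theorem norm2u_inl (a : A) : (B.algTensor T).completion.norm2u (B.inlHom T a) = B.norm2u a := by
  refine le_antisymm (inl_intertwinesE.norm2u_map_le a) ?_
  refine norm2u_le _ (norm2u_nonneg _ _) fun k => ?_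
  rw [← seminorm_inl (T := T)]
  exact seminorm_le_norm2u _ _ _

theorem seminorm_inr (k : K) (d : D) :
    (B.algTensor T).completion.seminorm k (B.inrHom T d) = T.seminorm () d := by
  change (B.algTensor T).completion.seminorm k (of IsBounded.bdd (1 ⊗ₜ d)) = _
  rw [seminorm_of, seminorm_tmul, B.seminorm_one, one_mul]

theorem norm2u_inr_le (d : D) :
    (B.algTensor T).completion.norm2u (B.inrHom T d) ≤ T.norm2u d :=
  norm2u_le _ (norm2u_nonneg _ _) fun k => by
    rw [seminorm_inr]; exact T.seminorm_le_norm2u _ _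

theorem OpBound.inl {C : ℝ} {a : A} (h : B.OpBound C a) :
    (B.algTensor T).completion.OpBound C (B.inlHom T a) :=
  (B.algTensor_opBound_left T h).of _

theorem OpBound.inr {C : ℝ} {d : D} (h : T.OpBound C d) :
    (B.algTensor T).completion.OpBound C (B.inrHom T d) :=
  (B.algTensor_opBound_right T h).of _

theorem exists_of_near (x : B.Completion) {ε : ℝ} (hε : 0 < ε) :
    ∃ a, B.completion.norm2u (x - of hB.bdd a) < ε := by
  obtain ⟨C, hC⟩ := B.completion_bdd x
  obtain ⟨a, -, ha⟩ := kaplansky hB.bdd hC hε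
  exact ⟨a, ha⟩

/-- A function on the strict completion which is Lipschitz in the 2-norm and nonpositive on the
algebra itself is nonpositive. -/
theorem nonpos_of_lipschitz {φ : B.Completion → ℝ} {C : ℝ}
    (h : ∀ x y, φ x ≤ φ y + C * B.completion.norm2u (x - y)) (h0 : ∀ a, φ (of hB.bdd a) ≤ 0)
    (x : B.Completion) : φ x ≤ 0 := by
  refine le_of_forall_pos_le_add fun ε hε => ?_
  obtain ⟨a, ha⟩ := exists_of_near x (show 0 < ε / (|C| + 1) by positivity)
  have h1 := h x (of hB.bdd a)
  have h2 := h0 a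
  rw [lt_div_iff₀ (by positivity)] at ha
  have h3 : C * B.completion.norm2u (x - of hB.bdd a) ≤
      |C| * B.completion.norm2u (x - of hB.bdd a) :=
    mul_le_mul_of_nonneg_right (le_abs_self C) (norm2u_nonneg _ _)
  nlinarith [B.completion.norm2u_nonneg (x - of hB.bdd a)]

/-- An element commuting with both tensor factors is central. -/
theorem commute_of_commute_inl_inr {z : (B.algTensor T).Completion}
    (h₁ : ∀ a, z * B.inlHom T a = B.inlHom T a * z) (h₂ : ∀ d, z * B.inrHom T d = B.inrHom T d * z)
    (x : (B.algTensor T).Completion) : z * x = x * z := by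
  obtain ⟨C, hC⟩ := (B.algTensor T).completion_bdd z
  rw [← sub_eq_zero]
  refine completion_faithful (le_antisymm ?_ (norm2u_nonneg _ _))
  refine nonpos_of_lipschitz (φ := fun x => (B.algTensor T).completion.norm2u (z * x - x * z))
    (C := 2 * C) (fun x y => ?_) (fun t => ?_) x
  · have e : z * x - x * z = (z * y - y * z) + (z * (x - y) - (x - y) * z) := by noncomm_ring
    have h3 := hC.norm2u_mul_le (x - y)
    have h4 := hC.norm2u_mul_right_le (x - y)
    have h5 := (B.algTensor T).completion.norm2u_sub_le (z * (x - y)) 0 ((x - y) * z)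
    rw [sub_zero, zero_sub, norm2u_neg] at h5
    beta_reduce
    rw [e]
    have h6 := (B.algTensor T).completion.norm2u_add_le (z * y - y * z)
      (z * (x - y) - (x - y) * z)
    linarith
  · refine le_of_eq ?_
    have : z * of IsBounded.bdd t = of IsBounded.bdd t * z := by
      induction t with
      | zero => simp
      | add s t hs ht => rw [map_add, mul_add, add_mul, hs, ht]
      | tmul a d => rw [of_tmul, ← mul_assoc, h₁, mul_assoc, h₂, mul_assoc]
    rw [this, sub_self, norm2u_zero]

/-- The tensor product of two expectation-preserving `*`-homomorphisms. -/
noncomputable def tensorMap {κ : K' → K} {f : A →⋆ₐ[ℂ] A'} (hf : B.IntertwinesE B' κ f)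
    {g : D →⋆ₐ[ℂ] D'} (hg : T.IntertwinesE T' id g) :
    (B.algTensor T).Completion →⋆ₐ[ℂ] (B'.algTensor T').Completion :=
  (hf.tensor hg).completionMap

section tensorMap

variable {κ : K' → K} {f : A →⋆ₐ[ℂ] A'} (hf : B.IntertwinesE B' κ f)
  {g : D →⋆ₐ[ℂ] D'} (hg : T.IntertwinesE T' id g)

theorem tensorMap_intertwinesE :
    (B.algTensor T).completion.IntertwinesE (B'.algTensor T').completion κ (tensorMap hf hg) :=
  (hf.tensor hg).completion

theorem tensorMap_of (t : A ⊗[ℂ] D) : tensorMap hf hg (of IsBounded.bdd t) =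
    of IsBounded.bdd (starTensorMap f g t) := rfl

theorem tensorMap_inl (a : A) : tensorMap hf hg (B.inlHom T a) = B'.inlHom T' (f a) := by
  change of IsBounded.bdd (starTensorMap f g (a ⊗ₜ 1)) = of IsBounded.bdd (f a ⊗ₜ 1)
  rw [starTensorMap_tmul, map_one]

theorem tensorMap_inr (d : D) : tensorMap hf hg (B.inrHom T d) = B'.inrHom T' (g d) := by
  change of IsBounded.bdd (starTensorMap f g (1 ⊗ₜ d)) = of IsBounded.bdd (1 ⊗ₜ g d)
  rw [starTensorMap_tmul, map_one]

end tensorMap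

section action

variable {G : Type*} [Group G] {γ : G →* (A ≃⋆ₐ[ℂ] A)} {δ : G →* (D ≃⋆ₐ[ℂ] D)}
  (hγ : ∀ g a, B.E (γ g a) = B.E a) (hδ : ∀ g d, T.E (δ g d) = T.E d)

variable (γ δ) in
/-- The tensor product action on the strict tensor product. -/
noncomputable abbrev tensorAct (hγ : ∀ g a, B.E (γ g a) = B.E a)
    (hδ : ∀ g d, T.E (δ g d) = T.E d) :
    G →* ((B.algTensor T).Completion ≃⋆ₐ[ℂ] (B.algTensor T).Completion) :=
  (B.algTensor T).completionAction (actTensor γ δ) (algTensor_E_act hγ hδ)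

theorem tensorAct_inl (g : G) (a : A) :
    tensorAct γ δ hγ hδ g (B.inlHom T a) = B.inlHom T (γ g a) := by
  change of IsBounded.bdd (γ g a ⊗ₜ δ g 1) = of IsBounded.bdd (γ g a ⊗ₜ 1)
  rw [map_one]

theorem tensorAct_inr (g : G) (d : D) :
    tensorAct γ δ hγ hδ g (B.inrHom T d) = B.inrHom T (δ g d) := by
  change of IsBounded.bdd (γ g 1 ⊗ₜ δ g d) = of IsBounded.bdd (1 ⊗ₜ δ g d)
  rw [map_one]

theorem E_tensorAct (g : G) (x : (B.algTensor T).Completion) :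
    (B.algTensor T).completion.E (tensorAct γ δ hγ hδ g x) = (B.algTensor T).completion.E x :=
  completion_E_action _ _ _ _ _

/-- Equivariance of the tensor product of two equivariant `*`-homomorphisms. -/
theorem tensorMap_tensorAct {γ' : G →* (A' ≃⋆ₐ[ℂ] A')} {δ' : G →* (D' ≃⋆ₐ[ℂ] D')}
    (hγ' : ∀ g a, B'.E (γ' g a) = B'.E a) (hδ' : ∀ g d, T'.E (δ' g d) = T'.E d)
    {κ : K' → K} {f : A →⋆ₐ[ℂ] A'} (hf : B.IntertwinesE B' κ f) {g : D →⋆ₐ[ℂ] D'}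
    (hg : T.IntertwinesE T' id g) (h₁ : ∀ s a, f (γ s a) = γ' s (f a))
    (h₂ : ∀ s d, g (δ s d) = δ' s (g d)) (s : G) (x : (B.algTensor T).Completion) :
    tensorMap hf hg (tensorAct γ δ hγ hδ s x) = tensorAct γ' δ' hγ' hδ' s (tensorMap hf hg x) := by
  obtain ⟨x⟩ := x
  refine congrArg (Quotient.mk _) (Subtype.ext (funext fun n => ?_))
  change starTensorMap f g (actTensor γ δ s (x.1 n)) = actTensor γ' δ' s (starTensorMap f g (x.1 n))
  generalize x.1 n = t
  induction t with
  | zero => simp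
  | add a b ha hb => simp only [map_add, ha, hb]
  | tmul a d =>
    change f (γ s a) ⊗ₜ[ℂ] g (δ s d) = γ' s (f a) ⊗ₜ[ℂ] δ' s (g d)
    rw [h₁, h₂]

end action

end tensor

end TracialAlgebra

namespace TracialAlgebra

/-! ### Strictly complete algebras and limits in the uniform 2-norm -/

section complete

variable {K : Type u} [TopologicalSpace K] [CompactSpace K] {A : Type v} [Ring A] [StarRing A]
  [Algebra ℂ A] [StarModule ℂ A]

/-- The uniform 2-norm is a norm, and operator-norm bounded sequences which are Cauchy in the
uniform 2-norm converge without increase of the operator norm. -/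
class IsStrictlyComplete (B : TracialAlgebra K A) : Prop extends B.IsBounded where
  faithful : ∀ a, B.norm2u a = 0 → a = 0
  complete : ∀ (C : ℝ) (x : ℕ → A), (∀ n, B.OpBound C (x n)) → B.IsCauchy x →
    ∃ y, B.OpBound C y ∧ Tendsto (fun n => B.norm2u (x n - y)) atTop (𝓝 0)

instance isStrictlyComplete_completion (B : TracialAlgebra K A) [B.IsBounded] :
    B.completion.IsStrictlyComplete where
  faithful _ h := completion_faithful h
  complete _ _ hx hc := completion_complete IsBounded.bdd hx hc

variable {B : TracialAlgebra K A}

variable (B) in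
/-- Convergence of a sequence in the uniform 2-norm. -/
def Converges (x : ℕ → A) (a : A) : Prop := Tendsto (fun n => B.norm2u (x n - a)) atTop (𝓝 0)

theorem isCauchy_of_geometric {x : ℕ → A} {C : ℝ} {N : ℕ}
    (h : ∀ n ≥ N, B.norm2u (x (n + 1) - x n) ≤ C * (1 / 2) ^ n) :
    ∀ n ≥ N, ∀ m ≥ n, B.norm2u (x m - x n) ≤ 2 * C * (1 / 2) ^ n - 2 * C * (1 / 2) ^ m := by
  intro n hn m hm
  induction m, hm using Nat.le_induction with
  | base => rw [sub_self, norm2u_zero, sub_self]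
  | succ m hm ih =>
    have h1 := h m (hn.trans hm)
    have h2 := B.norm2u_sub_le (x (m + 1)) (x m) (x n)
    have e : 2 * C * (1 / 2 : ℝ) ^ (m + 1) = C * (1 / 2) ^ m := by ring
    have e' : 2 * C * (1 / 2 : ℝ) ^ m = C * (1 / 2) ^ m + C * (1 / 2) ^ m := by ring
    linarith

namespace Converges

theorem const (a : A) : B.Converges (fun _ => a) a := by
  simp [Converges, norm2u_zero]

theorem add {x y : ℕ → A} {a b : A} (hx : B.Converges x a) (hy : B.Converges y b) :
    B.Converges (fun n => x n + y n) (a + b) := by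
  refine squeeze_zero (fun _ => B.norm2u_nonneg _) (fun n => ?_)
    (by simpa using Tendsto.add hx hy)
  rw [add_sub_add_comm]
  exact B.norm2u_add_le _ _

theorem star {x : ℕ → A} {a : A} (hx : B.Converges x a) :
    B.Converges (fun n => star (x n)) (Star.star a) := by
  simpa only [Converges, ← star_sub, norm2u_star] using hx

theorem mul {x y : ℕ → A} {a b : A} {C : ℝ} (hC : ∀ n, B.OpBound C (x n)) (hb : ∃ D, B.OpBound D b)
    (hx : B.Converges x a) (hy : B.Converges y b) :
    B.Converges (fun n => x n * y n) (a * b) := by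
  obtain ⟨D, hD⟩ := hb
  refine squeeze_zero (fun _ => B.norm2u_nonneg _)
    (fun n => B.norm2u_mul_sub_mul_le (a' := a) (b := y n) (hC n) hD) ?_
  simpa using (Tendsto.const_mul C hy).add (Tendsto.const_mul D hx)

theorem eventually_near {x : ℕ → A} {a : A} (hx : B.Converges x a) {ε : ℝ} (hε : 0 < ε) :
    ∀ᶠ n in atTop, B.norm2u (x n - a) < ε := Tendsto.eventually_lt_const hε hx

theorem E_eq {x : ℕ → A} {a : A} (hx : B.Converges x a) {f : C(K, ℂ)} (h : ∀ n, B.E (x n) = f) :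
    B.E a = f := by
  have h1 : Tendsto (fun n => B.E (x n - a)) atTop (𝓝 0) :=
    squeeze_zero_norm (fun n => B.norm_E_le _) hx
  simp only [map_sub, h] at h1
  exact (sub_eq_zero.1 (tendsto_nhds_unique tendsto_const_nhds h1)).symm

theorem norm2u_le {x : ℕ → A} {a : A} (hx : B.Converges x a) {c : ℝ}
    (h : ∀ᶠ n in atTop, B.norm2u (x n) ≤ c) : B.norm2u a ≤ c := by
  have h1 : Tendsto (fun n => c + B.norm2u (x n - a)) atTop (𝓝 (c + 0)) := Tendsto.const_add c hx
  rw [add_zero] at h1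
  refine ge_of_tendsto h1 ?_
  filter_upwards [h] with n hn
  have := B.norm2u_sub_le a (x n) 0
  rw [sub_zero, sub_zero, norm2u_sub_comm] at this
  linarith

variable [B.IsStrictlyComplete]

theorem unique {x : ℕ → A} {a b : A} (ha : B.Converges x a) (hb : B.Converges x b) : a = b := by
  rw [← sub_eq_zero]
  refine IsStrictlyComplete.faithful (B := B) _ ?_
  have h : Tendsto (fun n => B.norm2u (x n - a) + B.norm2u (x n - b)) atTop (𝓝 0) := by
    simpa using Tendsto.add ha hb
  refine le_antisymm (ge_of_tendsto' h fun n => ?_) (B.norm2u_nonneg _)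
  rw [B.norm2u_sub_comm (x n) a]
  exact B.norm2u_sub_le _ _ _

end Converges

theorem norm2u_unitary_mul {u : A} (hu : u ∈ unitary A) (x : A) :
    B.norm2u (u * x) = B.norm2u x := by
  have h : ∀ v ∈ unitary A, ∀ y, B.norm2u (v * y) ≤ B.norm2u y := fun v hv y => by
    simpa using (opBound_of_mem_unitary (B := B) hv).norm2u_mul_le y
  refine le_antisymm (h u hu x) ?_
  have := h _ (Unitary.star_mem hu) (u * x)
  rwa [← mul_assoc, Unitary.star_mul_self_of_mem hu, one_mul] at this

theorem norm2u_mul_unitary {u : A} (hu : u ∈ unitary A) (x : A) :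
    B.norm2u (x * u) = B.norm2u x := by
  rw [← norm2u_star, star_mul, norm2u_unitary_mul (Unitary.star_mem hu), norm2u_star]

theorem norm2u_conj {u : A} (hu : u ∈ unitary A) (x : A) :
    B.norm2u (u * x * star u) = B.norm2u x := by
  rw [norm2u_mul_unitary (Unitary.star_mem hu), norm2u_unitary_mul hu]

end complete

/-! ### The one-sided intertwining argument -/

section intertwining

variable {K : Type u} [TopologicalSpace K] [CompactSpace K] {A : Type v} [Ring A] [StarRing A]
  [Algebra ℂ A] [StarModule ℂ A] {B : TracialAlgebra K A} {X : Type w} [Ring X] [StarRing X]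
  [Algebra ℂ X] [StarModule ℂ X] {Y : TracialAlgebra K X} {G : Type*} [Group G]

/-- The inclusion `ι : A → X` can be approximately surrounded by unitaries: some unitary `v` of `X`
almost commutes with a given finite subset of `A`, conjugates a given finite subset of `X` almost
into `A`, and is almost fixed by a given finite set of group elements. -/
def IsAbsorbing (Y : TracialAlgebra K X) (ι : A →⋆ₐ[ℂ] X) (β : G →* (X ≃⋆ₐ[ℂ] X)) : Prop :=
  ∀ (F : Finset A) (D : Finset X) (L : Finset G) (ε : ℝ), 0 < ε → ∃ v ∈ unitary X,
    (∀ a ∈ F, Y.norm2u (v * ι a - ι a * v) < ε) ∧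
    (∀ d ∈ D, ∃ c, Y.norm2u (star v * d * v - ι c) < ε) ∧
    ∀ g ∈ L, Y.norm2u (β g v - v) < ε

/-- The inductive construction behind the intertwining argument. The unitaries `V_{n+1} = V_n v_n` are
chosen such that the maps `a ↦ V_n ι(a) V_n*` and the elements `β_g(V_n) V_n*` vary by at most `2⁻ⁿ`
on increasing finite sets, while `V_{n+1}* b_j V_{n+1}` is `2⁻ⁿ`-close to the range of `ι`. The sets
`F n` exhaust `A` and absorb the slices of these conjugates. -/
theorem IsAbsorbing.exists_sequence {ι : A →⋆ₐ[ℂ] X} {β : G →* (X ≃⋆ₐ[ℂ] X)}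
    (H : IsAbsorbing Y ι β) (a : ℕ → A) (b : ℕ → X) (g : ℕ → G)
    (s : X → A) :
    ∃ (V : ℕ → X) (F : ℕ → Finset A), (∀ n, V n ∈ unitary X) ∧ Monotone F ∧
      (∀ n, a n ∈ F (n + 1)) ∧ (∀ n, ∀ j ≤ n, s (star (V n) * b j * V n) ∈ F (n + 1)) ∧
      (∀ n, ∀ x ∈ F (n + 1), Y.norm2u (V (n + 1) * ι x * star (V (n + 1)) -
        V n * ι x * star (V n)) ≤ (1 / 2) ^ n) ∧
      (∀ n, ∀ j ≤ n, ∃ c, Y.norm2u (star (V (n + 1)) * b j * V (n + 1) - ι c) ≤ (1 / 2) ^ n) ∧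
      ∀ n, ∀ j ≤ n, Y.norm2u (β (g j) (V (n + 1)) * star (V (n + 1)) -
        β (g j) (V n) * star (V n)) ≤ (1 / 2) ^ n := by
  classical
  choose v hv h₁ h₂ h₃ using H
  let F' : ℕ → unitary X × Finset A → Finset A := fun n p =>
    insert (a n) (p.2 ∪ (Finset.range (n + 1)).image fun j => s (star (p.1 : X) * b j * p.1))
  let D' : ℕ → unitary X × Finset A → Finset X := fun n p =>
    (Finset.range (n + 1)).image fun j => star (p.1 : X) * b j * p.1
  let L' : ℕ → Finset G := fun n => (Finset.range (n + 1)).image g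
  have hε : ∀ n : ℕ, (0 : ℝ) < (1 / 2) ^ n := fun n => by positivity
  let step : ℕ → unitary X × Finset A → X := fun n p =>
    v (F' n p) (D' n p) (L' n) _ (hε n)
  have hstep : ∀ n p, step n p ∈ unitary X := fun n p => hv _ _ _ _ _
  let st : ℕ → unitary X × Finset A := fun n => Nat.rec (1, ∅)
    (fun n p => (p.1 * ⟨step n p, hstep n p⟩, F' n p)) n
  have hst : ∀ n, st (n + 1) = ((st n).1 * ⟨step n (st n), hstep n (st n)⟩, F' n (st n)) :=
    fun n => rfl
  have hV : ∀ n, ((st (n + 1)).1 : X) = (st n).1 * step n (st n) := fun n => by rw [hst]; rfl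
  refine ⟨fun n => (st n).1, fun n => (st n).2, fun n => (st n).1.2, ?_, ?_, ?_, ?_, ?_, ?_⟩
  · refine monotone_nat_of_le_succ fun n => ?_
    rw [hst]
    exact Finset.subset_union_left.trans (Finset.subset_insert _ _)
  · intro n
    simp only [hst]
    exact Finset.mem_insert_self _ _
  · intro n j hj
    simp only [hst]
    exact Finset.mem_insert_of_mem (Finset.mem_union_right _
      (Finset.mem_image.2 ⟨j, Finset.mem_range.2 (Nat.lt_succ_of_le hj), rfl⟩))
  · intro n x hx
    have h := (h₁ (F' n (st n)) (D' n (st n)) (L' n) _ (hε n) x (by simpa only [hst] using hx)).le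
    have hu := hstep n (st n)
    have e : ((st (n + 1)).1 : X) * ι x * star ((st (n + 1)).1 : X) -
        (st n).1 * ι x * star ((st n).1 : X) = (st n).1 *
        ((step n (st n) * ι x - ι x * step n (st n)) * star (step n (st n))) *
          star ((st n).1 : X) := by
      rw [hV, star_mul, sub_mul, mul_assoc (ι x), Unitary.mul_star_self_of_mem hu]
      noncomm_ring
    rw [e, norm2u_conj (st n).1.2, norm2u_mul_unitary (Unitary.star_mem hu)]
    exact h
  · intro n j hj
    obtain ⟨c, hc⟩ := h₂ (F' n (st n)) (D' n (st n)) (L' n) _ (hε n)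
      (star ((st n).1 : X) * b j * (st n).1)
      (Finset.mem_image.2 ⟨j, Finset.mem_range.2 (Nat.lt_succ_of_le hj), rfl⟩)
    refine ⟨c, le_of_eq_of_le ?_ hc.le⟩
    simp only [hV, star_mul, mul_assoc, step]
  · intro n j hj
    have h := (h₃ (F' n (st n)) (D' n (st n)) (L' n) _ (hε n) (g j)
      (Finset.mem_image.2 ⟨j, Finset.mem_range.2 (Nat.lt_succ_of_le hj), rfl⟩)).le
    have hu := hstep n (st n)
    have hw : β (g j) ((st n).1 : X) ∈ unitary X := Unitary.map_mem (β (g j)) (st n).1.2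
    have e : β (g j) ((st (n + 1)).1 : X) * star ((st (n + 1)).1 : X) -
        β (g j) ((st n).1 : X) * star ((st n).1 : X) = β (g j) ((st n).1 : X) *
        ((β (g j) (step n (st n)) - step n (st n)) * star (step n (st n))) *
          star ((st n).1 : X) := by
      rw [hV, star_mul, map_mul, sub_mul, Unitary.mul_star_self_of_mem hu]
      noncomm_ring
    rw [e, norm2u_mul_unitary (Unitary.star_mem (st n).1.2), norm2u_unitary_mul hw,
      norm2u_mul_unitary (Unitary.star_mem hu)]
    exact h

/-- A one-sided inverse `s` of `ι` which is contractive in operator norm and in 2-norm. -/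
structure IsSlice (B : TracialAlgebra K A) (Y : TracialAlgebra K X) (ι : A →⋆ₐ[ℂ] X)
    (s : X → A) : Prop where
  opBound : ∀ {C x}, Y.OpBound C x → B.OpBound C (s x)
  norm2u_sub_le : ∀ x y, B.norm2u (s x - s y) ≤ Y.norm2u (x - y)
  apply_ι : ∀ a, s (ι a) = a

/-- An element close to the range of `ι` is close to the image of its slice. -/
theorem IsSlice.norm2u_sub_ι_le {ι : A →⋆ₐ[ℂ] X} {s : X → A} (hs : IsSlice B Y ι s)
    (hι : ∀ a, Y.norm2u (ι a) = B.norm2u a) (x : X) (c : A) :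
    Y.norm2u (x - ι (s x)) ≤ 2 * Y.norm2u (x - ι c) := by
  have h1 := Y.norm2u_sub_le x (ι c) (ι (s x))
  rw [← map_sub, hι] at h1
  have h2 := hs.norm2u_sub_le (ι c) x
  rw [hs.apply_ι, Y.norm2u_sub_comm] at h2
  linarith

theorem sub_tendsto_pow_half (C : ℝ) : Tendsto (fun n : ℕ => C * (1 / 2 : ℝ) ^ n) atTop (𝓝 0) := by
  simpa using (tendsto_pow_atTop_nhds_zero_of_lt_one (r := (1 / 2 : ℝ)) (by norm_num)
    (by norm_num)).const_mul C

/-- The one-sided intertwining: if `ι : A → X` is absorbing, then the limit `Ψ` of the maps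
`a ↦ V_n ι(a) V_n*` is an isomorphism, and it conjugates the action of `X` to the perturbation of
that of `A` by the cocycle `Ψ⁻¹(lim β_g(V_n) V_n*)`. -/
theorem IsAbsorbing.exists_cocycle_conjugacy [Countable G] [B.IsStrictlyComplete]
    [Y.IsStrictlyComplete] {ι : A →⋆ₐ[ℂ] X} (hι : B.IntertwinesE Y id ι) {α : G →* (A ≃⋆ₐ[ℂ] A)}
    {β : G →* (X ≃⋆ₐ[ℂ] X)} (hβ : ∀ g x, Y.E (β g x) = Y.E x)
    (heq : ∀ g a, β g (ι a) = ι (α g a)) {s : X → A} (hs : IsSlice B Y ι s)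
    (hA : ∃ a : ℕ → A, ∀ x, ∀ ε > 0, ∃ n, B.norm2u (x - a n) < ε)
    (hX : ∃ b : ℕ → X, ∀ x, ∀ ε > 0, ∃ n, Y.norm2u (x - b n) < ε)
    (H : IsAbsorbing Y ι β) :
    ∃ u : G → unitary A, (∀ g h, (u (g * h) : A) = u g * α g (u h)) ∧
      ∃ φ : A ≃⋆ₐ[ℂ] X, (∀ a, Y.E (φ a) = B.E a) ∧
        ∀ g a, β g (φ a) = φ ((u g : A) * α g a * star (u g : A)) := by
  obtain ⟨a, ha⟩ := hA
  obtain ⟨b, hb⟩ := hX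
  obtain ⟨g, hg⟩ := exists_surjective_nat G
  obtain ⟨V, F, hV, hF, haF, hsF, h₁, h₂, h₃⟩ := H.exists_sequence a b g s
  have hιn : ∀ x, Y.norm2u (ι x) = B.norm2u x := fun x =>
    le_antisymm (hι.norm2u_map_le x) (B.norm2u_le (Y.norm2u_nonneg _) fun k => by
      have := hι.seminorm_map k x
      rw [id] at this
      rw [← this]; exact Y.seminorm_le_norm2u _ _)
  let Ψn : ℕ → A → X := fun n x => V n * ι x * star (V n)
  have hΨnorm : ∀ n x, Y.norm2u (Ψn n x) = B.norm2u x := fun n x => by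
    rw [norm2u_conj (hV n), hιn]
  have hΨsub : ∀ n x y, Ψn n (x - y) = Ψn n x - Ψn n y := fun n x y => by
    simp only [Ψn, map_sub, mul_sub, sub_mul]
  have hgeo : ∀ N, ∀ x ∈ F (N + 1), ∀ n ≥ N, ∀ m ≥ n,
      Y.norm2u (Ψn m x - Ψn n x) ≤ 2 * (1 / 2) ^ n := by
    intro N x hx n hn m hm
    have := isCauchy_of_geometric (B := Y) (x := fun n => Ψn n x) (C := 1) (N := N)
      (fun n hn => by
        rw [one_mul]
        exact h₁ n x (hF (Nat.succ_le_succ hn) hx)) n hn m hm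
    have h0 : (0 : ℝ) ≤ (1 / 2) ^ m := by positivity
    linarith
  have hΨb : ∀ {C : ℝ} {x : A}, B.OpBound C x → ∀ n, Y.OpBound C (Ψn n x) := by
    intro C x hx n
    have := ((opBound_of_mem_unitary (B := Y) (hV n)).mul (hι.opBound_map hx)).mul
      (opBound_of_mem_unitary (B := Y) (Unitary.star_mem (hV n)))
    rwa [one_mul, mul_one] at this
  have hΨc : ∀ x, Y.IsCauchy fun n => Ψn n x := by
    intro x ε hε
    obtain ⟨N, hN⟩ := ha x (ε / 8) (by positivity)
    obtain ⟨N', hN'⟩ := eventually_atTop.1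
      ((sub_tendsto_pow_half 2).eventually_lt_const (show 0 < ε / 8 by positivity))
    have key : ∀ n ≥ max N N', Y.norm2u (Ψn n x - Ψn (max N N') x) < ε / 2 := by
      intro n hn
      have h4 := hgeo N (a N) (haF N) (max N N') (le_max_left _ _) n hn
      have h5 := hN' _ (le_max_right N N')
      have h6 : Ψn n x - Ψn (max N N') x = (Ψn n (x - a N) - Ψn (max N N') (x - a N)) +
          (Ψn n (a N) - Ψn (max N N') (a N)) := by
        rw [hΨsub, hΨsub]; abel
      have h7 := Y.norm2u_sub_le (Ψn n (x - a N)) 0 (Ψn (max N N') (x - a N))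
      rw [sub_zero, zero_sub, norm2u_neg, hΨnorm, hΨnorm] at h7
      rw [h6]
      have h8 := Y.norm2u_add_le (Ψn n (x - a N) - Ψn (max N N') (x - a N))
        (Ψn n (a N) - Ψn (max N N') (a N))
      linarith
    refine ⟨max N N', fun m hm n hn => ?_⟩
    have h4 := key n hn
    rw [Y.norm2u_sub_comm] at h4
    linarith [key m hm, Y.norm2u_sub_le (Ψn m x) (Ψn (max N N') x) (Ψn n x)]
  have hlim : ∀ x, ∃ y, Y.Converges (fun n => Ψn n x) y := by
    intro x
    obtain ⟨C, hC⟩ := IsBounded.bdd (B := B) x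
    obtain ⟨y, -, hy⟩ := IsStrictlyComplete.complete (B := Y) C _ (hΨb hC) (hΨc x)
    exact ⟨y, hy⟩
  choose Ψ hΨ using hlim
  have hΨmul : ∀ n x y, Ψn n x * Ψn n y = Ψn n (x * y) := fun n x y => by
    simp only [Ψn, map_mul]
    calc _ = V n * ι x * (star (V n) * V n) * ι y * star (V n) := by noncomm_ring
      _ = _ := by rw [Unitary.star_mul_self_of_mem (hV n)]; noncomm_ring
  let Φ : A →⋆ₐ[ℂ] X :=
    { toFun := Ψ
      map_one' := (hΨ 1).unique (by
        have : (fun n => Ψn n 1) = fun _ => 1 := by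
          ext n; simp only [Ψn, map_one, mul_one]; exact Unitary.mul_star_self_of_mem (hV n)
        rw [this]; exact .const 1)
      map_mul' := fun x y => (hΨ (x * y)).unique (by
        obtain ⟨C, hC⟩ := IsBounded.bdd (B := B) x
        simpa only [hΨmul] using (hΨ x).mul (hΨb hC) (IsBounded.bdd _) (hΨ y))
      map_zero' := (hΨ 0).unique (by
        simp only [Ψn, map_zero, mul_zero, zero_mul]; exact .const 0)
      map_add' := fun x y => (hΨ (x + y)).unique (by
        have := (hΨ x).add (hΨ y)
        simpa only [Ψn, map_add, mul_add, add_mul] using this)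
      commutes' := fun c => (hΨ _).unique (by
        have : (fun n => Ψn n (algebraMap ℂ A c)) = fun _ => algebraMap ℂ X c := by
          ext n
          simp only [Ψn, Algebra.algebraMap_eq_smul_one, map_smul, map_one, mul_smul_comm, mul_one,
            smul_mul_assoc, Unitary.mul_star_self_of_mem (hV n)]
        rw [this]; exact .const _)
      map_star' := fun x => (hΨ _).unique (by
        have := (hΨ x).star
        simpa only [Ψn, star_mul, star_star, map_star, mul_assoc] using this) }
  have hΦ : ∀ x, Y.Converges (fun n => Ψn n x) (Φ x) := hΨ
  have hΨE : ∀ n x, Y.E (Ψn n x) = B.E x := by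
    intro n x
    simp only [Ψn]
    rw [Y.E_comm, ← mul_assoc, Unitary.star_mul_self_of_mem (hV n), one_mul]
    exact ContinuousMap.ext fun k => hι x k
  have hΦE : ∀ x, Y.E (Φ x) = B.E x := fun x => (hΦ x).E_eq fun n => hΨE n x
  have hΦI : B.IntertwinesE Y id Φ := fun x k => by rw [hΦE]; rfl
  have hΦn : ∀ x, Y.norm2u (Φ x) = B.norm2u x := fun x => by
    rw [norm2u, ← map_star, ← map_mul, hΦE, norm2u]
  -- the elements `s(V_n* y V_n)` witness surjectivity
  let e : ℕ → X → A := fun n y => s (star (V n) * y * V n)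
  have hconj : ∀ n y, Y.norm2u (star (V n) * y * V n) = Y.norm2u y := fun n y => by
    have := norm2u_conj (B := Y) (Unitary.star_mem (hV n)) y
    rwa [star_star] at this
  have he : ∀ n y y', B.norm2u (e n y - e n y') ≤ Y.norm2u (y - y') := fun n y y' => by
    refine (hs.norm2u_sub_le _ _).trans (le_of_eq ?_)
    rw [← sub_mul, ← mul_sub, hconj]
  have hΨe : ∀ j, ∀ n ≥ j + 1, Y.norm2u (Φ (e n (b j)) - b j) ≤ 6 * (1 / 2) ^ n := by
    intro j n hn
    obtain ⟨n, rfl⟩ := Nat.exists_eq_add_of_lt (Nat.lt_of_succ_le hn)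
    set m := j + n with hm
    obtain ⟨c, hc⟩ := h₂ m j (by omega)
    have h4 := hs.norm2u_sub_ι_le hιn (star (V (m + 1)) * b j * V (m + 1)) c
    have h5 : Y.norm2u (Ψn (m + 1) (e (m + 1) (b j)) - b j) ≤ 2 * (1 / 2) ^ m := by
      have h6 : Ψn (m + 1) (e (m + 1) (b j)) - b j = -(V (m + 1) *
          (star (V (m + 1)) * b j * V (m + 1) - ι (e (m + 1) (b j))) * star (V (m + 1))) := by
        have h7 : V (m + 1) * (star (V (m + 1)) * b j * V (m + 1)) * star (V (m + 1)) = b j := by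
          calc _ = (V (m + 1) * star (V (m + 1))) * b j * (V (m + 1) * star (V (m + 1))) := by
                noncomm_ring
            _ = _ := by rw [Unitary.mul_star_self_of_mem (hV _), one_mul, mul_one]
        rw [mul_sub, sub_mul, h7, neg_sub]
      rw [h6, norm2u_neg, norm2u_conj (hV _)]
      linarith
    have h6 : Y.norm2u (Φ (e (m + 1) (b j)) - Ψn (m + 1) (e (m + 1) (b j))) ≤
        2 * (1 / 2) ^ (m + 1) := by
      have h7 := (hΦ (e (m + 1) (b j))).add (.const (-Ψn (m + 1) (e (m + 1) (b j))))
      rw [sub_eq_add_neg]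
      refine h7.norm2u_le ?_
      filter_upwards [eventually_ge_atTop (m + 1)] with l hl
      rw [← sub_eq_add_neg]
      exact hgeo (m + 1) _ (hsF (m + 1) j (by omega)) (m + 1) le_rfl l hl
    have h8 := Y.norm2u_sub_le (Φ (e (m + 1) (b j))) (Ψn (m + 1) (e (m + 1) (b j))) (b j)
    have h9 : (1 / 2 : ℝ) ^ (m + 1) = (1 / 2) * (1 / 2) ^ m := by ring
    linarith
  have hΦe : ∀ y, Y.Converges (fun n => Φ (e n y)) y := by
    intro y
    rw [Converges, Metric.tendsto_atTop]
    intro ε hε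
    obtain ⟨j, hj⟩ := hb y (ε / 4) (by positivity)
    obtain ⟨N, hN⟩ := eventually_atTop.1
      ((sub_tendsto_pow_half 6).eventually_lt_const (show 0 < ε / 4 by positivity))
    refine ⟨max N (j + 1), fun n hn => ?_⟩
    rw [Real.dist_eq, sub_zero, abs_of_nonneg (Y.norm2u_nonneg _)]
    have h4 := hN n ((le_max_left _ _).trans hn)
    have h5 := hΨe j n ((le_max_right _ _).trans hn)
    have h6 := he n y (b j)
    rw [← hΦn, map_sub] at h6
    have h7 := Y.norm2u_sub_le (Φ (e n y)) (Φ (e n (b j))) y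
    have h8 := Y.norm2u_sub_le (Φ (e n (b j))) (b j) y
    rw [Y.norm2u_sub_comm (b j)] at h8
    linarith
  have hsurj : Function.Surjective Φ := by
    intro y
    obtain ⟨C, hC⟩ := IsBounded.bdd (B := Y) y
    have hbe : ∀ n, B.OpBound C (e n y) := by
      intro n
      refine hs.opBound ?_
      have := ((opBound_of_mem_unitary (B := Y) (Unitary.star_mem (hV n))).mul hC).mul
        (opBound_of_mem_unitary (B := Y) (hV n))
      rwa [one_mul, mul_one] at this
    obtain ⟨x, -, hx⟩ := IsStrictlyComplete.complete (B := B) C (fun n => e n y) hbe (by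
      intro ε hε
      obtain ⟨N, hN⟩ := eventually_atTop.1 ((hΦe y).eventually_near (half_pos hε))
      refine ⟨N, fun m hm n hn => ?_⟩
      rw [← hΦn, map_sub]
      have h4 := hN n hn
      rw [Y.norm2u_sub_comm] at h4
      linarith [hN m hm, Y.norm2u_sub_le (Φ (e m y)) y (Φ (e n y))])
    refine ⟨x, Converges.unique (B := Y) (x := fun n => Φ (e n y)) ?_ (hΦe y)⟩
    simpa only [Converges, ← map_sub, hΦn] using hx
  have hinj : Function.Injective Φ := by
    rw [injective_iff_map_eq_zero]
    intro x hx
    refine IsStrictlyComplete.faithful (B := B) x ?_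
    rw [← hΦn, hx, norm2u_zero]
  let φ : A ≃⋆ₐ[ℂ] X := StarAlgEquiv.ofBijective Φ ⟨hinj, hsurj⟩
  have hφ : ∀ x, φ x = Φ x := fun _ => rfl
  -- the cocycle, first in `X`
  let Un : G → ℕ → X := fun h n => β h (V n) * star (V n)
  have hUn : ∀ h n, Un h n ∈ unitary X := fun h n =>
    mul_mem (Unitary.map_mem (β h) (hV n)) (Unitary.star_mem (hV n))
  have hUlim : ∀ h, ∃ y, Y.Converges (Un h) y := by
    intro h
    obtain ⟨j, rfl⟩ := hg h
    obtain ⟨y, -, hy⟩ := IsStrictlyComplete.complete (B := Y) 1 (Un (g j))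
      (fun n => opBound_of_mem_unitary (hUn _ n)) (by
        have h4 := isCauchy_of_geometric (B := Y) (x := Un (g j)) (C := 1) (N := j)
          (fun n hn => by rw [one_mul]; exact h₃ n j hn)
        intro ε hε
        obtain ⟨N, hN⟩ := eventually_atTop.1
          ((sub_tendsto_pow_half (2 * 1)).eventually_lt_const (half_pos hε))
        have key : ∀ n ≥ max N j, Y.norm2u (Un (g j) n - Un (g j) (max N j)) < ε / 2 := by
          intro n hn
          have h5 := h4 (max N j) (le_max_right _ _) n hn
          have h6 := hN (max N j) (le_max_left _ _)
          have h7 : (0 : ℝ) ≤ 2 * 1 * (1 / 2) ^ n := by positivity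
          linarith
        refine ⟨max N j, fun m hm n hn => ?_⟩
        have h5 := key n hn
        rw [Y.norm2u_sub_comm] at h5
        linarith [key m hm, Y.norm2u_sub_le (Un (g j) m) (Un (g j) (max N j)) (Un (g j) n)])
    exact ⟨y, hy⟩
  choose U hU using hUlim
  have hUb : ∀ h n, Y.OpBound 1 (Un h n) := fun h n => opBound_of_mem_unitary (hUn h n)
  have hUu : ∀ h, U h ∈ unitary X := by
    intro h
    rw [Unitary.mem_iff]
    constructor
    · refine Converges.unique (B := Y)
        ((hU h).star.mul (fun n => (hUb h n).star) (IsBounded.bdd _) (hU h)) ?_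
      simp only [Unitary.star_mul_self_of_mem (hUn h _)]
      exact .const 1
    · refine Converges.unique (B := Y)
        ((hU h).mul (hUb h) (IsBounded.bdd _) (hU h).star) ?_
      simp only [Unitary.mul_star_self_of_mem (hUn h _)]
      exact .const 1
  have hβn : ∀ h {x : ℕ → X} {y : X}, Y.Converges x y →
      Y.Converges (fun n => β h (x n)) (β h y) := by
    intro h x y hx
    simpa only [Converges, ← map_sub, norm2u_map (hβ h)] using hx
  have hβΦ : ∀ h x, β h (Φ x) = U h * Φ (α h x) * star (U h) := by
    intro h x
    refine Converges.unique (B := Y) (hβn h (hΦ x)) ?_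
    obtain ⟨C, hC⟩ := IsBounded.bdd (B := B) (α h x)
    have h4 := ((hU h).mul (hUb h) (IsBounded.bdd _) (hΦ (α h x))).mul
      (fun n => (hUb h n).mul (hΨb hC n)) (IsBounded.bdd _) (hU h).star
    have h5 : ∀ n, Un h n * Ψn n (α h x) * star (Un h n) = β h (Ψn n x) := by
      intro n
      simp only [Un, Ψn, map_mul, map_star, heq, star_mul, star_star]
      calc _ = β h (V n) * (star (V n) * V n) * ι (α h x) * (star (V n) * V n) *
            star (β h (V n)) := by noncomm_ring
        _ = _ := by rw [Unitary.star_mul_self_of_mem (hV n), mul_one, mul_one]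
    simpa only [h5] using h4
  have hUc : ∀ h h', U (h * h') = β h (U h') * U h := by
    intro h h'
    refine Converges.unique (B := Y) (hU (h * h')) ?_
    have h4 := (hβn h (hU h')).mul
      (fun n => opBound_of_mem_unitary (Unitary.map_mem (β h) (hUn h' n))) (IsBounded.bdd _) (hU h)
    have h5 : ∀ n, β h (Un h' n) * Un h n = Un (h * h') n := by
      intro n
      simp only [Un, map_mul, map_star, StarAlgEquiv.mul_apply]
      calc _ = β h (β h' (V n)) * (star (β h (V n)) * β h (V n)) * star (V n) := by noncomm_ring
        _ = _ := by
          rw [Unitary.star_mul_self_of_mem (Unitary.map_mem (β h) (hV n)), mul_one]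
    simpa only [h5] using h4
  have hφs : ∀ y, Φ (φ.symm y) = y := fun y => φ.apply_symm_apply y
  refine ⟨fun h => ⟨φ.symm (U h), Unitary.map_mem φ.symm (hUu h)⟩, fun h h' => ?_, φ, hΦE,
    fun h x => ?_⟩
  · apply hinj
    change Φ (φ.symm (U (h * h'))) = Φ (φ.symm (U h) * α h (φ.symm (U h')))
    rw [map_mul, hφs, hφs, hUc]
    have h4 := hβΦ h (φ.symm (U h'))
    rw [hφs] at h4
    rw [h4, mul_assoc, Unitary.star_mul_self_of_mem (hUu h), mul_one]
  · change β h (Φ x) = Φ (φ.symm (U h) * α h x * star (φ.symm (U h)))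
    rw [map_mul, map_mul, map_star, hφs, hβΦ]

end intertwining

end TracialAlgebra

namespace TracialAlgebra

/-! ### Slice maps and separability -/


section slice

variable {K : Type u} [TopologicalSpace K] {A : Type v} [Ring A] [StarRing A]
  [Algebra ℂ A] [StarModule ℂ A] {B : TracialAlgebra K A}
  {D : Type w} [Ring D] [StarRing D] [Algebra ℂ D] [StarModule ℂ D] {T : TracialAlgebra Unit D}

variable (A T) in
/-- The slice map `a ⊗ d ↦ τ(d) a` on the algebraic tensor product. -/
noncomputable def algSlice : A ⊗[ℂ] D →ₗ[ℂ] A :=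
  TensorProduct.lift (LinearMap.mk₂ ℂ (fun a d => T.E d () • a)
    (fun _ _ _ => smul_add _ _ _) (fun _ _ _ => smul_comm _ _ _)
    (fun _ _ _ => by rw [LinearMap.map_add, ContinuousMap.add_apply, add_smul])
    (fun _ _ _ => by rw [LinearMap.map_smul, ContinuousMap.smul_apply, smul_assoc]))

theorem algSlice_tmul (a : A) (d : D) : algSlice A T (a ⊗ₜ d) = T.E d () • a := rfl

theorem E_mul_algSlice (a : A) (t : A ⊗[ℂ] D) :
    B.E (a * algSlice A T t) = (B.algTensor T).E ((a ⊗ₜ 1) * t) := by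
  induction t with
  | zero => simp
  | add s t hs ht => rw [map_add, mul_add, map_add, mul_add, map_add, hs, ht]
  | tmul a' d =>
    rw [algSlice_tmul, mul_smul_comm, map_smul, Algebra.TensorProduct.tmul_mul_tmul, one_mul]
    rfl

variable [CompactSpace K] [B.IsBounded] [T.IsBounded]

variable (B T) in
/-- `y` is the image of `x` under the conditional expectation of the strict tensor product onto its
first factor. -/
def IsSliceOf (x : (B.algTensor T).Completion) (y : A) : Prop :=
  ∀ a, B.E (a * y) = (B.algTensor T).completion.E (B.inlHom T a * x)

namespace IsSliceOf

theorem of (t : A ⊗[ℂ] D) :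
    B.IsSliceOf T (TracialAlgebra.of IsBounded.bdd t) (algSlice A T t) := fun a => by
  change _ = (B.algTensor T).completion.E (TracialAlgebra.of IsBounded.bdd (a ⊗ₜ 1) *
    TracialAlgebra.of IsBounded.bdd t)
  rw [E_mul_algSlice, ← map_mul, E_of]

variable {x x' : (B.algTensor T).Completion} {y y' : A}

theorem sub (h : B.IsSliceOf T x y) (h' : B.IsSliceOf T x' y') :
    B.IsSliceOf T (x - x') (y - y') := fun a => by
  rw [mul_sub, map_sub, h, h', mul_sub, map_sub]

theorem seminorm_mul_le (h : B.IsSliceOf T x y) (k : K) (c : A) : B.seminorm k (y * c) ≤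
    (B.algTensor T).completion.seminorm k (x * B.inlHom T c) := by
  have h1 : B.seminorm k (y * c) ^ 2 ≤ B.seminorm k (y * c) *
      (B.algTensor T).completion.seminorm k (x * B.inlHom T c) := by
    have e : B.E (star (y * c) * (y * c)) = (B.algTensor T).completion.E
        (star (B.inlHom T (y * c)) * (x * B.inlHom T c)) := by
      rw [← mul_assoc, B.E_comm, ← mul_assoc, h, map_mul (B.inlHom T) c, ← map_star (B.inlHom T),
        mul_assoc, E_comm _ (B.inlHom T c), mul_assoc]
    rw [← norm_E_apply_self, e]
    refine (norm_E_mul_le _ k _ _).trans (le_of_eq ?_)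
    rw [seminorm_inl]
  rcases (B.seminorm_nonneg k (y * c)).eq_or_lt with h0 | h0
  · rw [← h0]; exact seminorm_nonneg _ _ _
  · rw [sq] at h1
    exact le_of_mul_le_mul_left h1 h0

theorem norm2u_le (h : B.IsSliceOf T x y) : B.norm2u y ≤ (B.algTensor T).completion.norm2u x :=
  B.norm2u_le (norm2u_nonneg _ _) fun k => by
    have := h.seminorm_mul_le k 1
    rw [map_one, mul_one, mul_one] at this
    exact this.trans (seminorm_le_norm2u _ _ _)

theorem opBound (h : B.IsSliceOf T x y) {C : ℝ} (hx : (B.algTensor T).completion.OpBound C x) :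
    B.OpBound C y :=
  ⟨hx.1, fun c k => (h.seminorm_mul_le k c).trans ((hx.2 _ k).trans (le_of_eq (by
    rw [seminorm_inl])))⟩

theorem unique [B.IsStrictlyComplete] (h : B.IsSliceOf T x y) (h' : B.IsSliceOf T x y') :
    y = y' := by
  rw [← sub_eq_zero]
  refine IsStrictlyComplete.faithful (B := B) _ (le_antisymm ?_ (B.norm2u_nonneg _))
  have := (h.sub h').norm2u_le
  rwa [sub_self, norm2u_zero] at this

theorem exists_slice [B.IsStrictlyComplete] (x : (B.algTensor T).Completion) :
    ∃ y, B.IsSliceOf T x y := by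
  obtain ⟨t, rfl⟩ := (B.algTensor T).cls_surjective x
  obtain ⟨C, hC⟩ := t.2.1
  obtain ⟨y, -, hy⟩ := IsStrictlyComplete.complete (B := B) C (fun n => algSlice A T (t.1 n))
    (fun n => (of (t.1 n)).opBound ((hC n).of _)) (fun ε hε => by
      obtain ⟨N, hN⟩ := t.2.2 ε hε
      refine ⟨N, fun m hm n hn => lt_of_le_of_lt ?_ (hN m hm n hn)⟩
      refine ((of (B := B) (t.1 m)).sub (of (t.1 n))).norm2u_le.trans (le_of_eq ?_)
      rw [← map_sub, norm2u_of])
  refine ⟨y, fun a => ?_⟩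
  obtain ⟨Ca, hCa⟩ := IsBounded.bdd (B := B) a
  have h1 : Tendsto (fun n => B.E (a * algSlice A T (t.1 n))) atTop (𝓝 (B.E (a * y))) := by
    rw [tendsto_iff_norm_sub_tendsto_zero]
    refine squeeze_zero (fun _ => norm_nonneg _) (fun n => ?_) (by simpa using hy.const_mul Ca)
    rw [← map_sub, ← mul_sub]
    exact (B.norm_E_le _).trans (hCa.norm2u_mul_le _)
  have h2 := tendsto_of_cls (B := B.algTensor T) IsBounded.bdd t
  refine tendsto_nhds_unique h1 ?_
  rw [tendsto_iff_norm_sub_tendsto_zero]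
  refine squeeze_zero (fun _ => norm_nonneg _) (fun n => ?_) (by simpa using h2.const_mul Ca)
  rw [of (t.1 n) a, ← map_sub, ← mul_sub, ← norm2u_neg, neg_sub]
  exact (norm_E_le _ _).trans (hCa.inl.norm2u_mul_le _)

end IsSliceOf

/-- The first factor embedding has a slice, namely the conditional expectation onto the first factor. -/
theorem exists_isSlice [B.IsStrictlyComplete] :
    ∃ s, IsSlice B (B.algTensor T).completion (B.inlHom T) s := by
  choose s hs using IsSliceOf.exists_slice (B := B) (T := T)
  refine ⟨s, fun {C x} hx => (hs x).opBound hx, fun x y => ((hs x).sub (hs y)).norm2u_le,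
    fun a => (hs _).unique fun b => ?_⟩
  rw [← map_mul]
  exact (ContinuousMap.ext fun k => inl_intertwinesE (B := B) (T := T) _ k).symm

end slice

section separable

variable {K : Type u} [TopologicalSpace K] [CompactSpace K] {A : Type v} [Ring A] [StarRing A]
  [Algebra ℂ A] [StarModule ℂ A] {B : TracialAlgebra K A}
  {D : Type w} [Ring D] [StarRing D] [Algebra ℂ D] [StarModule ℂ D] {T : TracialAlgebra Unit D}

variable (B) in
/-- Some sequence is dense in the uniform 2-norm. -/
def IsSeparable : Prop := ∃ a : ℕ → A, ∀ x, ∀ ε > 0, ∃ n, B.norm2u (x - a n) < ε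

theorem isSeparable_of_countable (s : Set A) (hs : s.Countable)
    (h : ∀ a, ∀ ε > 0, ∃ b ∈ s, B.norm2u (a - b) < ε) : B.IsSeparable := by
  have hne : s.Nonempty := (h 0 1 one_pos).imp fun _ hb => hb.1
  obtain ⟨f, rfl⟩ := hs.exists_eq_range hne
  refine ⟨f, fun x ε hε => ?_⟩
  obtain ⟨_, ⟨n, rfl⟩, hn⟩ := h x ε hε
  exact ⟨n, hn⟩

theorem IsSeparable.completion [hB : B.IsBounded] (h : B.IsSeparable) :
    B.completion.IsSeparable := by
  obtain ⟨a, ha⟩ := h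
  refine ⟨fun n => of hB.bdd (a n), fun x ε hε => ?_⟩
  obtain ⟨y, hy⟩ := exists_of_near x (half_pos hε)
  obtain ⟨n, hn⟩ := ha y (ε / 2) (half_pos hε)
  refine ⟨n, ?_⟩
  have h1 := norm2u_sub_le B.completion x (of hB.bdd y) (of hB.bdd (a n))
  rw [← map_sub, norm2u_of] at h1
  linarith

theorem norm2u_tmul_le (a : A) (d : D) :
    (B.algTensor T).norm2u (a ⊗ₜ d) ≤ B.norm2u a * T.norm2u d :=
  norm2u_le _ (mul_nonneg (norm2u_nonneg _ _) (norm2u_nonneg _ _)) fun k => by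
    rw [seminorm_tmul]
    exact mul_le_mul (seminorm_le_norm2u _ _ _) (seminorm_le_norm2u _ _ _) (seminorm_nonneg _ _ _)
      (norm2u_nonneg _ _)

theorem IsSeparable.algTensor (hB : B.IsSeparable) (hT : T.IsSeparable) :
    (B.algTensor T).IsSeparable := by
  obtain ⟨a, ha⟩ := hB
  obtain ⟨d, hd⟩ := hT
  refine isSeparable_of_countable
    (Set.range fun l : List (ℕ × ℕ) => (l.map fun p => a p.1 ⊗ₜ[ℂ] d p.2).sum)
    (Set.countable_range _) fun t => ?_
  induction t with
  | zero => exact fun ε hε => ⟨_, ⟨[], rfl⟩, by simpa [norm2u_zero] using hε⟩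
  | add s t hs ht =>
    intro ε hε
    obtain ⟨_, ⟨l, rfl⟩, hl⟩ := hs (ε / 2) (half_pos hε)
    obtain ⟨_, ⟨l', rfl⟩, hl'⟩ := ht (ε / 2) (half_pos hε)
    refine ⟨_, ⟨l ++ l', rfl⟩, ?_⟩
    beta_reduce
    rw [List.map_append, List.sum_append, add_sub_add_comm]
    linarith [(B.algTensor T).norm2u_add_le (s - (l.map fun p => a p.1 ⊗ₜ[ℂ] d p.2).sum)
      (t - (l'.map fun p => a p.1 ⊗ₜ[ℂ] d p.2).sum)]
  | tmul x y =>
    intro ε hε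
    have h0 := B.norm2u_nonneg x
    have h0' := T.norm2u_nonneg y
    obtain ⟨n, hn⟩ := hd y (ε / (2 * (B.norm2u x + 1))) (by positivity)
    have h1 := T.norm2u_nonneg (d n)
    obtain ⟨m, hm⟩ := ha x (ε / (2 * (T.norm2u (d n) + 1))) (by positivity)
    refine ⟨_, ⟨[(m, n)], rfl⟩, ?_⟩
    have e : x ⊗ₜ[ℂ] y - ([(m, n)].map fun p => a p.1 ⊗ₜ[ℂ] d p.2).sum =
        x ⊗ₜ (y - d n) + (x - a m) ⊗ₜ d n := by
      simp [TensorProduct.tmul_sub, TensorProduct.sub_tmul]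
    beta_reduce
    rw [e]
    rw [lt_div_iff₀ (by positivity)] at hn hm
    have h2 := norm2u_tmul_le (B := B) (T := T) x (y - d n)
    have h3 := norm2u_tmul_le (B := B) (T := T) (x - a m) (d n)
    have h4 := (B.algTensor T).norm2u_add_le (x ⊗ₜ (y - d n)) ((x - a m) ⊗ₜ d n)
    nlinarith [T.norm2u_nonneg (y - d n), B.norm2u_nonneg (x - a m)]

end separable

end TracialAlgebra

namespace TracialSystem

open TracialAlgebra

/-! ### Cocycle conjugacy -/

variable {G : Type*} [Group G] {K : Type u} [TopologicalSpace K]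

instance (S : TracialSystem G K) : S.alg.IsBounded := ⟨S.bdd⟩

instance [CompactSpace K] (S : TracialSystem G K) (T : TracialSystem G Unit) :
    (S.tensor T).alg.IsStrictlyComplete :=
  isStrictlyComplete_completion (S.alg.algTensor T.alg)

theorem CocycleConjugate.symm {S : TracialSystem G K} {T : TracialSystem G K}
    (h : S.CocycleConjugate T) : T.CocycleConjugate S := by
  obtain ⟨u, hu, φ, hφ, h⟩ := h
  refine ⟨fun g => ⟨φ (star (u g : S.carrier)), Unitary.map_mem φ (star (u g)).2⟩, fun g k => ?_,
    φ.symm, fun a => ?_, fun g a => ?_⟩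
  · change φ (star (u (g * k) : S.carrier)) =
      φ (star (u g : S.carrier)) * T.act g (φ (star (u k : S.carrier)))
    rw [hu, h, ← map_mul, star_mul, ← map_star]
    congr 1
    rw [← mul_assoc, ← mul_assoc, Unitary.coe_star_mul_self, one_mul]
  · rw [← hφ, φ.apply_symm_apply]
  · obtain ⟨a, rfl⟩ := φ.surjective a
    change S.act g (φ.symm (φ a)) = φ.symm (φ (star (u g : S.carrier)) * T.act g (φ a) *
      star (φ (star (u g : S.carrier))))
    rw [φ.symm_apply_apply, h, ← map_star, star_star, ← map_mul, ← map_mul, φ.symm_apply_apply]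
    calc S.act g a = (star (u g : S.carrier) * u g) * S.act g a *
          (star (u g : S.carrier) * u g) := by
          rw [Unitary.coe_star_mul_self, one_mul, mul_one]
      _ = _ := by noncomm_ring

theorem CocycleConjugate.trans {S : TracialSystem G K} {T : TracialSystem G K}
    {R : TracialSystem G K} (h : S.CocycleConjugate T) (h' : T.CocycleConjugate R) :
    S.CocycleConjugate R := by
  obtain ⟨u, hu, φ, hφ, h⟩ := h
  obtain ⟨v, hv, ψ, hψ, h'⟩ := h'
  have hs : ∀ g, φ.symm (T.act g (φ (φ.symm (v g : T.carrier)))) = φ.symm (T.act g (v g)) :=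
    fun g => by rw [φ.apply_symm_apply]
  refine ⟨fun g => ⟨φ.symm (v g : T.carrier) * u g,
    mul_mem (Unitary.map_mem φ.symm (v g).2) (u g).2⟩, fun g k => ?_, φ.trans ψ, fun a => ?_,
    fun g a => ?_⟩
  · change φ.symm (v (g * k) : T.carrier) * u (g * k) = φ.symm (v g : T.carrier) * u g *
      S.act g (φ.symm (v k : T.carrier) * u k)
    have e := h g (φ.symm (v k : T.carrier))
    rw [φ.apply_symm_apply] at e
    rw [hv, hu, map_mul, map_mul, e, φ.symm_apply_apply]
    calc _ = φ.symm (v g : T.carrier) * u g * S.act g (φ.symm (v k : T.carrier)) *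
          (star (u g : S.carrier) * u g) * S.act g (u k) := by noncomm_ring
      _ = _ := by rw [Unitary.coe_star_mul_self]; noncomm_ring
  · change R.alg.E (ψ (φ a)) = _
    rw [hψ, hφ]
  · change R.act g (ψ (φ a)) = ψ (φ (φ.symm (v g : T.carrier) * u g * S.act g a *
      star (φ.symm (v g : T.carrier) * (u g : S.carrier))))
    rw [h', h]
    congr 1
    simp only [map_mul, star_mul, map_star, φ.apply_symm_apply]
    noncomm_ring

variable [CompactSpace K]

theorem CocycleConjugate.tensor_left (S : TracialSystem G K) {T T' : TracialSystem G Unit}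
    (h : T.CocycleConjugate T') : (S.tensor T).CocycleConjugate (S.tensor T') := by
  obtain ⟨u, hu, θ, hθ, h⟩ := h
  have hid : S.alg.IntertwinesE S.alg id (StarAlgHom.id ℂ S.carrier) := fun _ _ => rfl
  have hθ' : T.alg.IntertwinesE T'.alg id (θ : T.carrier →⋆ₐ[ℂ] T'.carrier) := fun a k => by
    change T'.alg.E (θ a) k = _
    rw [hθ, id]
  have hθ'' : T'.alg.IntertwinesE T.alg id (θ.symm : T'.carrier →⋆ₐ[ℂ] T.carrier) := fun a k => by
    change T.alg.E (θ.symm a) k = _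
    rw [← hθ, θ.apply_symm_apply, id]
  let Θ : (S.alg.algTensor T.alg).Completion ≃⋆ₐ[ℂ] (S.alg.algTensor T'.alg).Completion :=
    completionEquiv (hid.tensor hθ') (hid.tensor hθ'')
      (fun t => by
        induction t with
        | zero => simp
        | add s t hs ht => rw [map_add, map_add, hs, ht]
        | tmul a d =>
          rw [starTensorMap_tmul, starTensorMap_tmul]
          change a ⊗ₜ θ.symm (θ d) = _
          rw [θ.symm_apply_apply])
      (fun t => by
        induction t with
        | zero => simp
        | add s t hs ht => rw [map_add, map_add, hs, ht]
        | tmul a d =>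
          rw [starTensorMap_tmul, starTensorMap_tmul]
          change a ⊗ₜ θ (θ.symm d) = _
          rw [θ.apply_symm_apply])
  let ι : T.carrier →⋆ₐ[ℂ] (S.alg.algTensor T.alg).Completion := S.alg.inrHom T.alg
  refine ⟨fun g => ⟨ι (u g : T.carrier), Unitary.map_mem ι (u g).2⟩, fun g k => ?_, Θ,
    fun a => ?_, fun g x => ?_⟩
  · change ι (u (g * k) : T.carrier) =
      ι (u g : T.carrier) * tensorAct S.act T.act S.E_act T.E_act g (ι (u k : T.carrier))
    rw [tensorAct_inr, ← map_mul, hu]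
  · exact ContinuousMap.ext fun k => (hid.tensor hθ').completion a k
  · change tensorAct S.act T'.act S.E_act T'.E_act g (Θ x) = Θ (ι (u g : T.carrier) *
      tensorAct S.act T.act S.E_act T.E_act g x * star (ι (u g : T.carrier)))
    obtain ⟨x, rfl⟩ := (S.alg.algTensor T.alg).cls_surjective x
    refine congrArg (Quotient.mk _) (Subtype.ext (funext fun n => ?_))
    change actTensor S.act T'.act g (starTensorMap _ _ (x.1 n)) =
      starTensorMap (StarAlgHom.id ℂ S.carrier) (θ : T.carrier →⋆ₐ[ℂ] T'.carrier)
        (((1 : S.carrier) ⊗ₜ (u g : T.carrier)) * actTensor S.act T.act g (x.1 n) *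
        star ((1 : S.carrier) ⊗ₜ (u g : T.carrier)))
    generalize x.1 n = t
    induction t with
    | zero => simp
    | add a b ha hb => simp only [map_add, mul_add, add_mul, ha, hb]
    | tmul a d =>
      change (S.act g a) ⊗ₜ (T'.act g (θ d)) = starTensorMap (StarAlgHom.id ℂ S.carrier)
        (θ : T.carrier →⋆ₐ[ℂ] T'.carrier) (((1 : S.carrier) ⊗ₜ (u g : T.carrier)) *
        (S.act g a ⊗ₜ T.act g d) * star ((1 : S.carrier) ⊗ₜ (u g : T.carrier)))
      rw [TensorProduct.star_tmul, star_one, Algebra.TensorProduct.tmul_mul_tmul,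
        Algebra.TensorProduct.tmul_mul_tmul, one_mul, mul_one, starTensorMap_tmul, h]
      rfl

/-- A separable strictly complete system is cocycle conjugate to its tensor product with `T`, once
the first factor embedding is absorbing. -/
theorem cocycleConjugate_tensor_of_isAbsorbing [Countable G] {S : TracialSystem G K}
    [S.alg.IsStrictlyComplete] {T : TracialSystem G Unit} (hS : S.alg.IsSeparable)
    (hT : T.alg.IsSeparable) (H : IsAbsorbing (S.alg.algTensor T.alg).completion
      (S.alg.inlHom T.alg) (tensorAct S.act T.act S.E_act T.E_act)) :
    S.CocycleConjugate (S.tensor T) := by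
  obtain ⟨s, hs⟩ := exists_isSlice (B := S.alg) (T := T.alg)
  exact IsAbsorbing.exists_cocycle_conjugacy inl_intertwinesE
    (E_tensorAct S.E_act T.E_act) (fun g a => tensorAct_inl S.E_act T.E_act g a) hs hS
    (hS.algTensor hT).completion H

end TracialSystem

namespace TracialAlgebra

section commutators

variable {K : Type u} [TopologicalSpace K] [CompactSpace K] {A : Type v} [Ring A] [StarRing A]
  [Algebra ℂ A] [StarModule ℂ A] {B : TracialAlgebra K A}
  {D : Type w} [Ring D] [StarRing D] [Algebra ℂ D] [StarModule ℂ D] {T : TracialAlgebra Unit D}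

theorem exists_opBound_forall [hB : B.IsBounded] (F : Finset A) :
    ∃ C, 0 < C ∧ ∀ a ∈ F, B.OpBound C a := by
  classical
  induction F using Finset.induction_on with
  | empty => exact ⟨1, one_pos, by simp⟩
  | insert a s _ ih =>
    obtain ⟨C, hC0, hC⟩ := ih
    obtain ⟨C', hC'⟩ := hB.bdd a
    refine ⟨max C C', lt_max_of_lt_left hC0, fun b hb => ?_⟩
    rcases Finset.mem_insert.1 hb with rfl | hb
    · exact hC'.mono (le_max_right _ _)
    · exact (hC b hb).mono (le_max_left _ _)

theorem OpBound.norm2u_commutator_le {C : ℝ} {a : A} (h : B.OpBound C a) (x y : A) :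
    B.norm2u (a * x - x * a) ≤ B.norm2u (a * y - y * a) + 2 * C * B.norm2u (x - y) := by
  have e : a * x - x * a = (a * y - y * a) + (a * (x - y) - (x - y) * a) := by noncomm_ring
  have h1 := B.norm2u_add_le (a * y - y * a) (a * (x - y) - (x - y) * a)
  have h2 := B.norm2u_sub_le (a * (x - y)) 0 ((x - y) * a)
  rw [sub_zero, zero_sub, norm2u_neg] at h2
  rw [e]
  linarith [h.norm2u_mul_le (x - y), h.norm2u_mul_right_le (x - y)]

theorem norm2u_conj_sub_conj_le {C : ℝ} {a u v : A} (h : B.OpBound C a) (hu : u ∈ unitary A)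
    (hv : v ∈ unitary A) :
    B.norm2u (star u * a * u - star v * a * v) ≤ 2 * C * B.norm2u (u - v) := by
  have e : star u * a * u - star v * a * v = star u * (a * (u - v)) + star (u - v) * a * v := by
    rw [star_sub]; noncomm_ring
  rw [e]
  refine (B.norm2u_add_le _ _).trans ?_
  rw [norm2u_mul_unitary hv, norm2u_unitary_mul (Unitary.star_mem hu)]
  have h1 := h.norm2u_mul_le (u - v)
  have h2 := h.norm2u_mul_right_le (star (u - v))
  rw [norm2u_star] at h2
  linarith

variable [B.IsBounded] [T.IsBounded]

theorem exists_commutator_inr_le (t : A ⊗[ℂ] D) : ∃ (F : Finset D) (M : ℝ), 0 ≤ M ∧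
    ∀ (d : D) (δ : ℝ), (∀ r ∈ F, T.norm2u (d * r - r * d) ≤ δ) →
      (B.algTensor T).completion.norm2u
        (B.inrHom T d * of IsBounded.bdd t - of IsBounded.bdd t * B.inrHom T d) ≤ M * δ := by
  classical
  induction t with
  | zero => exact ⟨∅, 0, le_rfl, fun d δ _ => by simp [norm2u_zero]⟩
  | add s t hs ht =>
    obtain ⟨F, M, hM, h⟩ := hs
    obtain ⟨F', M', hM', h'⟩ := ht
    refine ⟨F ∪ F', M + M', add_nonneg hM hM', fun d δ hd => ?_⟩
    rw [map_add, mul_add, add_mul, add_sub_add_comm, add_mul]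
    exact (norm2u_add_le _ _ _).trans (add_le_add
      (h d δ fun r hr => hd r (Finset.mem_union_left _ hr))
      (h' d δ fun r hr => hd r (Finset.mem_union_right _ hr)))
  | tmul a r =>
    refine ⟨{r}, B.norm2u a, B.norm2u_nonneg a, fun d δ hd => ?_⟩
    have e : B.inrHom T d * of IsBounded.bdd (a ⊗ₜ r) - of IsBounded.bdd (a ⊗ₜ r) * B.inrHom T d =
        of IsBounded.bdd (a ⊗ₜ (d * r - r * d)) := by
      change of IsBounded.bdd (1 ⊗ₜ d) * _ - _ * of IsBounded.bdd (1 ⊗ₜ d) = _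
      rw [← map_mul, ← map_mul, ← map_sub, Algebra.TensorProduct.tmul_mul_tmul,
        Algebra.TensorProduct.tmul_mul_tmul, one_mul, mul_one, TensorProduct.tmul_sub]
    rw [e, norm2u_of]
    exact (norm2u_tmul_le _ _).trans (mul_le_mul_of_nonneg_left (hd r (Finset.mem_singleton_self r))
      (B.norm2u_nonneg a))

/-- A bounded element of the second tensor factor which almost commutes with finitely many elements
of that factor almost commutes with a given finite subset of the tensor product. -/
theorem exists_commutator_inr_lt (s : Finset (B.algTensor T).Completion) {C : ℝ} (hC : 0 < C)
    {ε : ℝ} (hε : 0 < ε) : ∃ (F : Finset D) (δ : ℝ), 0 < δ ∧ ∀ d, T.OpBound C d →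
      (∀ r ∈ F, T.norm2u (d * r - r * d) ≤ δ) → ∀ x ∈ s,
        (B.algTensor T).completion.norm2u (B.inrHom T d * x - x * B.inrHom T d) < ε := by
  classical
  induction s using Finset.induction_on with
  | empty => exact ⟨∅, 1, one_pos, by simp⟩
  | insert x s _ ih =>
    obtain ⟨F, δ, hδ, h⟩ := ih
    obtain ⟨t, ht⟩ := exists_of_near x (show 0 < ε / (4 * C) by positivity)
    obtain ⟨F', M, hM, h'⟩ := exists_commutator_inr_le (B := B) (T := T) t
    refine ⟨F ∪ F', min δ (ε / (4 * (M + 1))), lt_min hδ (by positivity), fun d hd hr y hy => ?_⟩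
    rcases Finset.mem_insert.1 hy with rfl | hy
    · have h1 := h' d (ε / (4 * (M + 1))) fun r hr' =>
        (hr r (Finset.mem_union_right _ hr')).trans (min_le_right _ _)
      have h2 := (hd.inr (B := B)).norm2u_commutator_le y (of IsBounded.bdd t)
      have h3 : M * (ε / (4 * (M + 1))) ≤ ε / 4 := by
        rw [mul_div_assoc', div_le_div_iff₀ (by positivity) (by positivity)]
        nlinarith
      rw [lt_div_iff₀ (by positivity)] at ht
      linarith
    · exact h d hd (fun r hr' => (hr r (Finset.mem_union_left _ hr')).trans (min_le_left _ _)) y hy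

variable (T) in
/-- The flip automorphism of the algebraic tensor square. -/
noncomputable def algFlip : D ⊗[ℂ] D →⋆ₐ[ℂ] D ⊗[ℂ] D :=
  { (Algebra.TensorProduct.comm ℂ D D).toAlgHom with
    map_star' := fun t => by
      change Algebra.TensorProduct.comm ℂ D D (star t) = star (Algebra.TensorProduct.comm ℂ D D t)
      induction t with
      | zero => simp
      | tmul a d => simp [TensorProduct.star_tmul]
      | add s t hs ht => rw [star_add, map_add, map_add, star_add, hs, ht] }

theorem algFlip_algFlip (t : D ⊗[ℂ] D) : algFlip (algFlip t) = t :=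
  (Algebra.TensorProduct.comm ℂ D D).symm_apply_apply t

theorem algFlip_intertwinesE : (T.algTensor T).IntertwinesE (T.algTensor T) id algFlip := by
  intro t k
  induction t with
  | zero => simp
  | add s t hs ht =>
    rw [map_add algFlip, LinearMap.map_add, LinearMap.map_add, ContinuousMap.add_apply, hs, ht]
    rfl
  | tmul a d =>
    change (T.E a () • T.E d) k = (T.E d () • T.E a) k
    rw [ContinuousMap.smul_apply, ContinuousMap.smul_apply, smul_eq_mul, smul_eq_mul, mul_comm]

variable (T) in
/-- The flip automorphism of the strict tensor square. -/
noncomputable def flip : (T.algTensor T).Completion →⋆ₐ[ℂ] (T.algTensor T).Completion :=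
  (algFlip_intertwinesE (T := T)).completionMap

theorem flip_flip (x : (T.algTensor T).Completion) : T.flip (T.flip x) = x := by
  obtain ⟨x⟩ := x
  exact congrArg (Quotient.mk _) (Subtype.ext (funext fun _ => algFlip_algFlip _))

theorem flip_inr (d : D) : T.flip (T.inrHom T d) = T.inlHom T d := rfl

theorem norm2u_flip_le (x : (T.algTensor T).Completion) :
    (T.algTensor T).completion.norm2u (T.flip x) ≤ (T.algTensor T).completion.norm2u x :=
  algFlip_intertwinesE.completion.norm2u_map_le x

theorem flip_tensorAct {G : Type*} [Group G] {δ : G →* (D ≃⋆ₐ[ℂ] D)}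
    (hδ : ∀ g d, T.E (δ g d) = T.E d) (g : G) (x : (T.algTensor T).Completion) :
    T.flip (tensorAct δ δ hδ hδ g x) = tensorAct δ δ hδ hδ g (T.flip x) := by
  obtain ⟨x⟩ := x
  refine congrArg (Quotient.mk _) (Subtype.ext (funext fun n => ?_))
  change algFlip (actTensor δ δ g (x.1 n)) = actTensor δ δ g (algFlip (x.1 n))
  generalize x.1 n = t
  induction t with
  | zero => simp
  | add a b ha hb => simp only [map_add, ha, hb]
  | tmul a d => rfl

/-- The inner automorphism `a ↦ u* a u`. -/
def conjHom {u : A} (hu : u ∈ unitary A) : A →⋆ₐ[ℂ] A where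
  toFun a := star u * a * u
  map_one' := by rw [mul_one, Unitary.star_mul_self_of_mem hu]
  map_mul' a b := by
    calc _ = star u * a * 1 * b * u := by noncomm_ring
      _ = _ := by rw [← Unitary.mul_star_self_of_mem hu]; noncomm_ring
  map_zero' := by simp
  map_add' a b := by rw [mul_add, add_mul]
  commutes' c := by
    rw [Algebra.algebraMap_eq_smul_one, mul_smul_comm, smul_mul_assoc, mul_one,
      Unitary.star_mul_self_of_mem hu]
  map_star' a := by rw [star_mul, star_mul, star_star, mul_assoc]

theorem conjHom_intertwinesE {u : A} (hu : u ∈ unitary A) :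
    B.IntertwinesE B id (conjHom hu) := fun a k => by
  change B.E (star u * a * u) k = B.E a k
  rw [B.E_comm, ← mul_assoc, Unitary.mul_star_self_of_mem hu, one_mul]

end commutators

section tensorAut

variable {K : Type u} [TopologicalSpace K] [CompactSpace K] {A : Type v} [Ring A] [StarRing A]
  [Algebra ℂ A] [StarModule ℂ A] {B : TracialAlgebra K A}
  {D : Type w} [Ring D] [StarRing D] [Algebra ℂ D] [StarModule ℂ D] {T : TracialAlgebra Unit D}
  {G : Type*} [Group G]

/-- A single automorphism of the tensor product action. -/
noncomputable abbrev tensorAut (γ : G →* (A ≃⋆ₐ[ℂ] A)) (δ : G →* (D ≃⋆ₐ[ℂ] D))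
    (hγ : ∀ g a, B.E (γ g a) = B.E a) (hδ : ∀ g d, T.E (δ g d) = T.E d) (g : G) :
    (B.algTensor T).Completion ≃⋆ₐ[ℂ] (B.algTensor T).Completion :=
  tensorAct γ δ hγ hδ g

end tensorAut

section absorption

variable {G : Type*} [Group G] {X : Type v} [Ring X] [StarRing X] [Algebra ℂ X] [StarModule ℂ X]
  {Y : TracialAlgebra Unit X} {D : Type w} [Ring D] [StarRing D] [Algebra ℂ D] [StarModule ℂ D]
  {T : TracialAlgebra Unit D} [Y.IsBounded] [T.IsBounded]

/-- If a unitary `w` conjugates both `a` and `F a` close to `r` and `r'`, for an involution `F`,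
then `w (F w)*` carries `F r'` to `r`. -/
theorem norm2u_conj_involution_lt {F : X →⋆ₐ[ℂ] X} (hFF : ∀ x, F (F x) = x)
    (hF : ∀ x, Y.norm2u (F x) ≤ Y.norm2u x) {w : X} (hw : w ∈ unitary X) {a r r' : X} {ε : ℝ}
    (h : Y.norm2u (w * a * star w - r) < ε / 2) (h' : Y.norm2u (w * F a * star w - r') < ε / 2) :
    Y.norm2u (star (w * star (F w)) * r * (w * star (F w)) - F r') < ε := by
  have hFw : F w ∈ unitary X := Unitary.map_mem F hw
  have e₃ : Y.norm2u (star w * r * w - a) < ε / 2 := by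
    have := norm2u_conj (B := Y) (Unitary.star_mem hw) (w * a * star w - r)
    rw [star_star, mul_sub, sub_mul] at this
    have e : star w * (w * a * star w) * w = a := by
      calc _ = (star w * w) * a * (star w * w) := by noncomm_ring
        _ = _ := by rw [Unitary.star_mul_self_of_mem hw, one_mul, mul_one]
    rw [e] at this
    rw [Y.norm2u_sub_comm, this]
    exact h
  have e₄ : Y.norm2u (F w * a * star (F w) - F r') < ε / 2 := by
    have : F w * a * star (F w) - F r' = F (w * F a * star w - r') := by
      rw [map_sub, map_mul, map_mul, map_star, hFF]
    rw [this]
    exact (hF _).trans_lt h'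
  have e₅ : star (w * star (F w)) * r * (w * star (F w)) - F r' =
      F w * (star w * r * w - a) * star (F w) + (F w * a * star (F w) - F r') := by
    rw [star_mul, star_star]; noncomm_ring
  rw [e₅]
  refine (Y.norm2u_add_le _ _).trans_lt ?_
  have e₆ := norm2u_conj (B := Y) hFw (star w * r * w - a)
  linarith

/-- If `w` is almost fixed by an automorphism commuting with the involution `F`, then so is
`w (F w)*`. -/
theorem norm2u_map_mul_star_involution_lt {F : X →⋆ₐ[ℂ] X}
    (hF : ∀ x, Y.norm2u (F x) ≤ Y.norm2u x) {β : X ≃⋆ₐ[ℂ] X} (hβF : ∀ x, F (β x) = β (F x)) {w : X}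
    (hw : w ∈ unitary X) {ε : ℝ} (h : Y.norm2u (β w - w) < ε / 2) :
    Y.norm2u (β (w * star (F w)) - w * star (F w)) < ε := by
  have e₂ : β (w * star (F w)) - w * star (F w) =
      (β w - w) * star (F (β w)) + w * star (F (β w - w)) := by
    rw [map_mul, map_star, ← hβF, map_sub, star_sub]; noncomm_ring
  have hβw : F (β w) ∈ unitary X := Unitary.map_mem F (Unitary.map_mem β hw)
  rw [e₂]
  refine (Y.norm2u_add_le _ _).trans_lt ?_
  rw [norm2u_mul_unitary (Unitary.star_mem hβw), norm2u_unitary_mul hw, norm2u_star]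
  linarith [hF (β w - w)]

theorem norm2u_equiv {φ : D ≃⋆ₐ[ℂ] X} (hE : ∀ a, Y.E (φ a) = T.E a) (x : D) :
    Y.norm2u (φ x) = T.norm2u x := by
  rw [norm2u, ← map_star, ← map_mul, hE, norm2u]

theorem intertwinesE_symm {φ : D ≃⋆ₐ[ℂ] X} (hE : ∀ a, Y.E (φ a) = T.E a) :
    Y.IntertwinesE T id (φ.symm : X →⋆ₐ[ℂ] D) := fun x k => by
  change T.E (φ.symm x) k = _
  rw [← hE, φ.apply_symm_apply, id]

/-- If an equivariant isomorphism `φ : D ≃ X` is approximately conjugate to `r`, then conjugating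
`φ⁻¹ ∘ l` yields approximately central and equivariant endomorphisms of `D`, as soon as `l` and `r`
commute. -/
theorem exists_central_endomorphism {δ : G →* (D ≃⋆ₐ[ℂ] D)} (hδ : ∀ g d, T.E (δ g d) = T.E d)
    {β : G → (X ≃⋆ₐ[ℂ] X)} {φ : D ≃⋆ₐ[ℂ] X} (hE : ∀ a, Y.E (φ a) = T.E a)
    (hact : ∀ g a, β g (φ a) = φ (δ g a)) {l r : D →⋆ₐ[ℂ] X} (hl : T.IntertwinesE Y id l)
    (hlβ : ∀ g d, β g (l d) = l (δ g d)) (hlr : ∀ d d', l d * r d' = r d' * l d)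
    (F Q : Finset D) (L : Finset G) {C : ℝ} (hC : 0 < C) (hQ : ∀ y ∈ Q, T.OpBound C y) {ε : ℝ}
    {w : X} (hw : w ∈ unitary X)
    (h₁ : ∀ x ∈ F, Y.norm2u (w * φ x * star w - r x) < ε / (2 * C))
    (h₂ : ∀ g ∈ L, Y.norm2u (β g w - w) < ε / (2 * C)) :
    ∃ ψ : D →⋆ₐ[ℂ] D, T.IntertwinesE T id ψ ∧
      (∀ y ∈ Q, ∀ x ∈ F, T.norm2u (ψ y * x - x * ψ y) < ε) ∧
      ∀ g ∈ L, ∀ y ∈ Q, T.norm2u (δ g (ψ y) - ψ (δ g y)) < ε := by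
  set w' := φ.symm w with hw'
  have hw'u : w' ∈ unitary D := Unitary.map_mem φ.symm hw
  have hφw : φ w' = w := φ.apply_symm_apply w
  have hφn : ∀ x, Y.norm2u (φ x) = T.norm2u x := norm2u_equiv hE
  have hact' : ∀ g x, δ g (φ.symm x) = φ.symm (β g x) := fun g x => by
    rw [← φ.apply_symm_apply x, hact, φ.symm_apply_apply, φ.symm_apply_apply]
  let ψ₀ : D →⋆ₐ[ℂ] D := (φ.symm : X →⋆ₐ[ℂ] D).comp l
  have hψ₀ : T.IntertwinesE T id ψ₀ := (intertwinesE_symm hE).comp hl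
  have hψa : ∀ y, (conjHom hw'u).comp ψ₀ y = star w' * φ.symm (l y) * w' := fun _ => rfl
  have hI : T.IntertwinesE T id ((conjHom hw'u).comp ψ₀) := (conjHom_intertwinesE hw'u).comp hψ₀
  have hη : 2 * C * (ε / (2 * C)) = ε := by field_simp
  refine ⟨(conjHom hw'u).comp ψ₀, hI, fun y hy x hx => ?_, fun g hg y hy => ?_⟩
  · have e₁ := (hI.opBound_map (hQ y hy)).norm2u_commutator_le x (star w' * φ.symm (r x) * w')
    have e₂ : (conjHom hw'u).comp ψ₀ y * (star w' * φ.symm (r x) * w') =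
        (star w' * φ.symm (r x) * w') * (conjHom hw'u).comp ψ₀ y := by
      have : ∀ p q : D, star w' * p * w' * (star w' * q * w') = star w' * (p * q) * w' := by
        intro p q
        calc _ = star w' * p * (w' * star w') * q * w' := by noncomm_ring
          _ = _ := by rw [Unitary.mul_star_self_of_mem hw'u]; noncomm_ring
      rw [hψa, this, this, ← map_mul, ← map_mul, hlr]
    have e₃ : T.norm2u (x - star w' * φ.symm (r x) * w') < ε / (2 * C) := by
      rw [← norm2u_conj (B := T) hw'u (x - star w' * φ.symm (r x) * w'), ← hφn]
      refine lt_of_eq_of_lt ?_ (h₁ x hx)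
      have : w' * (star w' * φ.symm (r x) * w') * star w' = φ.symm (r x) := by
        calc _ = (w' * star w') * φ.symm (r x) * (w' * star w') := by noncomm_ring
          _ = _ := by rw [Unitary.mul_star_self_of_mem hw'u, one_mul, mul_one]
      rw [mul_sub, sub_mul, map_sub, map_mul, map_mul, map_star, hφw, this, φ.apply_symm_apply]
    rw [e₂, sub_self, norm2u_zero, zero_add] at e₁
    refine e₁.trans_lt (lt_of_lt_of_eq ?_ hη)
    gcongr
  · have e₁ : δ g ((conjHom hw'u).comp ψ₀ y) = star (δ g w') * φ.symm (l (δ g y)) * δ g w' := by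
      rw [hψa, map_mul, map_mul, map_star, hact' g (l y), hlβ]
    have e₂ : T.norm2u (δ g w' - w') < ε / (2 * C) := by
      rw [hw', hact', ← map_sub, ← hφn, φ.apply_symm_apply]
      exact h₂ g hg
    rw [e₁, hψa]
    have hb : T.OpBound C (φ.symm (l (δ g y))) := hψ₀.opBound_map ((hQ y hy).map (hδ g))
    refine (norm2u_conj_sub_conj_le hb (Unitary.map_mem (δ g) hw'u) hw'u).trans_lt
      (lt_of_lt_of_eq ?_ hη)
    gcongr

variable {A : Type v'} [Ring A] [StarRing A] [Algebra ℂ A] [StarModule ℂ A]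
  {B : TracialAlgebra Unit A} [B.IsBounded]

/-- A cocycle conjugacy `φ : A ≃ X` pulls an almost equivariant embedding into `X`, almost commuting
with the image of the cocycle, back to an almost equivariant embedding into `A`. -/
theorem exists_central_hom_of_cocycle {γ : G →* (A ≃⋆ₐ[ℂ] A)} {δ : G →* (D ≃⋆ₐ[ℂ] D)}
    {β : G → (X ≃⋆ₐ[ℂ] X)} {φ : A ≃⋆ₐ[ℂ] X} (hE : ∀ a, Y.E (φ a) = B.E a) {u : G → A}
    (hu : ∀ g, u g ∈ unitary A) (hφ : ∀ g a, β g (φ a) = φ (u g * γ g a * star (u g)))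
    {ρ : D →⋆ₐ[ℂ] X} (hρ : T.IntertwinesE Y id ρ) {F : Finset A} {Q : Finset D} {L : Finset G}
    {ε : ℝ} (h₁ : ∀ y ∈ Q, ∀ x ∈ F, Y.norm2u (ρ y * φ x - φ x * ρ y) < ε)
    (h₂ : ∀ g ∈ L, ∀ y ∈ Q, Y.norm2u (ρ (δ g y) * φ (u g) - φ (u g) * ρ (δ g y)) < ε / 2)
    (h₃ : ∀ g ∈ L, ∀ y ∈ Q, Y.norm2u (β g (ρ y) - ρ (δ g y)) < ε / 2) :
    ∃ χ : D →⋆ₐ[ℂ] A, T.IntertwinesE B id χ ∧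
      (∀ y ∈ Q, ∀ x ∈ F, B.norm2u (χ y * x - x * χ y) < ε) ∧
      ∀ g ∈ L, ∀ y ∈ Q, B.norm2u (γ g (χ y) - χ (δ g y)) < ε := by
  have hφn : ∀ x, Y.norm2u (φ x) = B.norm2u x := norm2u_equiv hE
  let χ : D →⋆ₐ[ℂ] A := (φ.symm : X →⋆ₐ[ℂ] A).comp ρ
  have hφχ : ∀ y, φ (χ y) = ρ y := fun y => φ.apply_symm_apply _
  refine ⟨χ, (intertwinesE_symm hE).comp hρ, fun y hy x hx => ?_, fun g hg y hy => ?_⟩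
  · rw [← hφn, map_sub, map_mul, map_mul, hφχ]
    exact h₁ y hy x hx
  · have e₂ : B.norm2u (u g * γ g (χ y) * star (u g) - χ (δ g y)) < ε / 2 := by
      rw [← hφn, map_sub, ← hφ, hφχ, hφχ]
      exact h₃ g hg y hy
    have e₃ : B.norm2u (χ (δ g y) * u g - u g * χ (δ g y)) < ε / 2 := by
      rw [← hφn, map_sub, map_mul, map_mul, hφχ]
      exact h₂ g hg y hy
    have e₄ : γ g (χ y) - χ (δ g y) = star (u g) * ((u g * γ g (χ y) * star (u g) - χ (δ g y)) *
        u g + (χ (δ g y) * u g - u g * χ (δ g y))) := by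
      calc _ = (star (u g) * u g) * γ g (χ y) * (star (u g) * u g) -
            (star (u g) * u g) * χ (δ g y) := by
            rw [Unitary.star_mul_self_of_mem (hu g), one_mul, mul_one, one_mul]
        _ = _ := by noncomm_ring
    rw [e₄, norm2u_unitary_mul (Unitary.star_mem (hu g))]
    refine (B.norm2u_add_le _ _).trans_lt ?_
    rw [norm2u_mul_unitary (hu g)]
    linarith

end absorption

section tensorHom

variable {G : Type*} [Group G] {A : Type v} [Ring A] [StarRing A] [Algebra ℂ A] [StarModule ℂ A]
  {B : TracialAlgebra Unit A} {D : Type w} [Ring D] [StarRing D] [Algebra ℂ D] [StarModule ℂ D]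
  {T : TracialAlgebra Unit D} [B.IsBounded] [T.IsBounded]

theorem inr_intertwinesE : T.IntertwinesE (B.algTensor T).completion id (B.inrHom T) :=
  fun d k => by
    have := E_inl_mul_inr (B := B) (T := T) 1 d
    rw [map_one, one_mul, B.E_one] at this
    rw [this]
    simp

/-- The map `χ ⊗ id` sends `t` to an almost central, almost fixed
element when `χ` is almost central and almost equivariant. -/
theorem exists_tensorMap_le {α : G →* (A ≃⋆ₐ[ℂ] A)} {σ : G →* (D ≃⋆ₐ[ℂ] D)}
    (hα : ∀ g a, B.E (α g a) = B.E a) (hσ : ∀ g d, T.E (σ g d) = T.E d) (t : D ⊗[ℂ] D) :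
    ∃ (Q : Finset D) (M : ℝ), 0 ≤ M ∧ ∀ (χ : D →⋆ₐ[ℂ] A)
      (hχ : T.IntertwinesE B id χ) (hid : T.IntertwinesE T id (.id ℂ D)) (δ : ℝ),
      (∀ x, (∀ y ∈ Q, B.norm2u (χ y * x - x * χ y) ≤ δ) →
        (B.algTensor T).completion.norm2u
          (tensorMap hχ hid (of IsBounded.bdd t) * B.inlHom T x -
            B.inlHom T x * tensorMap hχ hid (of IsBounded.bdd t)) ≤ M * δ) ∧
      ∀ g, (∀ y ∈ Q, B.norm2u (α g (χ y) - χ (σ g y)) ≤ δ) →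
        (B.algTensor T).completion.norm2u
          (tensorAut α σ hα hσ g (tensorMap hχ hid (of IsBounded.bdd t)) -
            tensorMap hχ hid (tensorAut σ σ hσ hσ g (of IsBounded.bdd t))) ≤
          M * δ := by
  classical
  induction t with
  | zero => exact ⟨∅, 0, le_rfl, fun χ _ _ δ => ⟨fun _ _ => by simp [norm2u_zero],
      fun _ _ => by simp [norm2u_zero]⟩⟩
  | add s t hs ht =>
    obtain ⟨Q, M, hM, h⟩ := hs
    obtain ⟨Q', M', hM', h'⟩ := ht
    refine ⟨Q ∪ Q', M + M', add_nonneg hM hM', fun χ hχ hid δ => ⟨fun x hx => ?_, fun g hg => ?_⟩⟩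
    · rw [map_add (of IsBounded.bdd), map_add (tensorMap hχ hid), mul_add, add_mul,
        add_sub_add_comm, add_mul]
      exact (norm2u_add_le _ _ _).trans (add_le_add
        ((h χ hχ hid δ).1 x fun r hr => hx r (Finset.mem_union_left _ hr))
        ((h' χ hχ hid δ).1 x fun r hr => hx r (Finset.mem_union_right _ hr)))
    · rw [map_add (of IsBounded.bdd), map_add (tensorMap hχ hid), map_add (tensorAut α σ hα hσ g),
        map_add (tensorAut σ σ hσ hσ g), map_add (tensorMap hχ hid), add_sub_add_comm, add_mul]
      exact (norm2u_add_le _ _ _).trans (add_le_add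
        ((h χ hχ hid δ).2 g fun r hr => hg r (Finset.mem_union_left _ hr))
        ((h' χ hχ hid δ).2 g fun r hr => hg r (Finset.mem_union_right _ hr)))
  | tmul y r =>
    refine ⟨{y}, T.norm2u r, T.norm2u_nonneg r, fun χ hχ hid δ =>
      ⟨fun x hx => ?_, fun g hg => ?_⟩⟩
    · have e : tensorMap hχ hid (of IsBounded.bdd (y ⊗ₜ r)) * B.inlHom T x -
          B.inlHom T x * tensorMap hχ hid (of IsBounded.bdd (y ⊗ₜ r)) =
          of IsBounded.bdd ((χ y * x - x * χ y) ⊗ₜ r) := by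
        change of IsBounded.bdd (χ y ⊗ₜ r) * of IsBounded.bdd (x ⊗ₜ 1) -
          of IsBounded.bdd (x ⊗ₜ 1) * of IsBounded.bdd (χ y ⊗ₜ r) = _
        rw [← map_mul, ← map_mul, ← map_sub, Algebra.TensorProduct.tmul_mul_tmul,
          Algebra.TensorProduct.tmul_mul_tmul, one_mul, mul_one, TensorProduct.sub_tmul]
      rw [e, norm2u_of, mul_comm]
      exact (norm2u_tmul_le _ _).trans (mul_le_mul_of_nonneg_right
        (hx y (Finset.mem_singleton_self y)) (T.norm2u_nonneg r))
    · have e : tensorAut α σ hα hσ g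
          (tensorMap hχ hid (of IsBounded.bdd (y ⊗ₜ r))) - tensorMap hχ hid
            (tensorAut σ σ hσ hσ g (of IsBounded.bdd (y ⊗ₜ r))) =
          of IsBounded.bdd ((α g (χ y) - χ (σ g y)) ⊗ₜ σ g r) := by
        change of IsBounded.bdd (α g (χ y) ⊗ₜ σ g r) -
          of IsBounded.bdd (χ (σ g y) ⊗ₜ σ g r) = _
        rw [← map_sub, TensorProduct.sub_tmul]
      rw [e, norm2u_of, mul_comm]
      refine (norm2u_tmul_le _ _).trans ?_
      rw [norm2u_map (hσ g)]
      exact mul_le_mul_of_nonneg_right (hg y (Finset.mem_singleton_self y)) (T.norm2u_nonneg r)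

/-- If the unitaries `w` almost conjugate `φ` to the second factor embedding, then `w (flip w)*` almost
conjugates the second factor into the first one. -/
theorem exists_flip_unitary_of_equiv {σ : G →* (D ≃⋆ₐ[ℂ] D)} (hσ : ∀ g d, T.E (σ g d) = T.E d)
    (φ : D ≃⋆ₐ[ℂ] (T.algTensor T).Completion)
    (hφ : ∀ (F : Finset D) (L : Finset G) (ε : ℝ), 0 < ε →
      ∃ w ∈ unitary (T.algTensor T).Completion,
        (∀ x ∈ F, (T.algTensor T).completion.norm2u (w * φ x * star w - T.inrHom T x) < ε) ∧
        ∀ g ∈ L, (T.algTensor T).completion.norm2u (tensorAut σ σ hσ hσ g w - w) < ε)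
    (P : Finset D) (L : Finset G) {ε : ℝ} (hε : 0 < ε) :
    ∃ z ∈ unitary (T.algTensor T).Completion,
      (∀ d ∈ P, ∃ c, (T.algTensor T).completion.norm2u
        (star z * T.inrHom T d * z - T.inlHom T c) < ε) ∧
      ∀ g ∈ L, (T.algTensor T).completion.norm2u (tensorAut σ σ hσ hσ g z - z) < ε := by
  classical
  let α : D → D := fun d => φ.symm (T.flip (φ d))
  have hα : ∀ d, φ (α d) = T.flip (φ d) := fun d => φ.apply_symm_apply _
  obtain ⟨w, hw, h₁, h₂⟩ := hφ (P ∪ P.image α) L (ε / 2) (half_pos hε)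
  have hFw : T.flip w ∈ unitary (T.algTensor T).Completion := Unitary.map_mem T.flip hw
  refine ⟨w * star (T.flip w), mul_mem hw (Unitary.star_mem hFw), fun d hd => ⟨α d, ?_⟩,
    fun g hg => ?_⟩
  · have e₂ := h₁ (α d) (Finset.mem_union_right _ (Finset.mem_image_of_mem α hd))
    rw [hα] at e₂
    rw [← flip_inr]
    exact norm2u_conj_involution_lt (Y := (T.algTensor T).completion) (F := T.flip) flip_flip
      norm2u_flip_le hw (h₁ d (Finset.mem_union_left _ hd)) e₂
  · exact norm2u_map_mul_star_involution_lt (Y := (T.algTensor T).completion) (F := T.flip)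
      norm2u_flip_le (flip_tensorAct hσ g) hw (h₂ g hg)

section contraction

variable {K : Type*} [TopologicalSpace K] [CompactSpace K] {W Z : Type*} [Ring W] [StarRing W]
  [Algebra ℂ W] [StarModule ℂ W] [Ring Z] [StarRing Z] [Algebra ℂ Z] [StarModule ℂ Z]
  {P : TracialAlgebra Unit W} {Q : TracialAlgebra K Z} {θ : W →⋆ₐ[ℂ] Z}

theorem map_conj_sub (θ : W →⋆ₐ[ℂ] Z) (z b c : W) :
    θ (star z * b * z - c) = star (θ z) * θ b * θ z - θ c := by
  rw [map_sub, map_mul, map_mul, map_star]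

theorem norm2u_map_sub_map_le (hθ : ∀ x, Q.norm2u (θ x) ≤ P.norm2u x) (x y : W) :
    Q.norm2u (θ x - θ y) ≤ P.norm2u (x - y) := by
  rw [← map_sub]
  exact hθ _

/-- A contraction which is almost equivariant at some `o` near `z` maps `z` to an almost fixed
element if `z` is almost fixed. -/
theorem norm2u_act_map_sub_le (hθ : ∀ x, Q.norm2u (θ x) ≤ P.norm2u x) {β : Z ≃⋆ₐ[ℂ] Z}
    (hβ : ∀ x, Q.E (β x) = Q.E x) {β' : W ≃⋆ₐ[ℂ] W} (hβ' : ∀ x, P.E (β' x) = P.E x) (z o : W) :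
    Q.norm2u (β (θ z) - θ z) ≤
      2 * P.norm2u (z - o) + Q.norm2u (β (θ o) - θ (β' o)) + P.norm2u (β' z - z) := by
  have e : β (θ z) - θ z = β (θ (z - o)) + (β (θ o) - θ (β' o)) + θ (β' (o - z)) +
      θ (β' z - z) := by
    simp only [map_sub]; abel
  have e₁ := hθ (z - o)
  rw [← norm2u_map hβ] at e₁
  have e₂ := hθ (β' (o - z))
  rw [norm2u_map hβ', norm2u_sub_comm] at e₂
  have e₃ := hθ (β' z - z)
  rw [e]
  have e₆ := Q.norm2u_add_le (β (θ (z - o)) + (β (θ o) - θ (β' o)) + θ (β' (o - z))) (θ (β' z - z))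
  have e₇ := Q.norm2u_add_le (β (θ (z - o)) + (β (θ o) - θ (β' o))) (θ (β' (o - z)))
  have e₈ := Q.norm2u_add_le (β (θ (z - o))) (β (θ o) - θ (β' o))
  linarith

end contraction

/-- An almost fixed unitary implementing the flip of `T ⊗̄ T`, pushed to `B ⊗̄ T` along almost
central and almost equivariant maps, almost commutes with the first factor and almost conjugates
the second factor into the first. -/
theorem exists_unitary_of_central_hom {α : G →* (A ≃⋆ₐ[ℂ] A)} {σ : G →* (D ≃⋆ₐ[ℂ] D)}
    (hα : ∀ g a, B.E (α g a) = B.E a) (hσ : ∀ g d, T.E (σ g d) = T.E d) (F : Finset A)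
    (P : Finset D) (L : Finset G) {ε : ℝ} (hε : 0 < ε)
    (H : ∀ (Q : Finset D) (δ : ℝ), 0 < δ → ∃ χ : D →⋆ₐ[ℂ] A, T.IntertwinesE B id χ ∧
      (∀ y ∈ Q, ∀ x ∈ F, B.norm2u (χ y * x - x * χ y) < δ) ∧
      ∀ g ∈ L, ∀ y ∈ Q, B.norm2u (α g (χ y) - χ (σ g y)) < δ)
    {z : (T.algTensor T).Completion} (hz : z ∈ unitary (T.algTensor T).Completion)
    (h₁ : ∀ d ∈ P, ∃ c, (T.algTensor T).completion.norm2u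
      (star z * T.inrHom T d * z - T.inlHom T c) < ε / 4)
    (h₂ : ∀ g ∈ L, (T.algTensor T).completion.norm2u (tensorAut σ σ hσ hσ g z - z) < ε / 4) :
    ∃ v ∈ unitary (B.algTensor T).Completion,
      (∀ x ∈ F, (B.algTensor T).completion.norm2u
        (v * B.inlHom T x - B.inlHom T x * v) < ε) ∧
      (∀ d ∈ P, ∃ c, (B.algTensor T).completion.norm2u
        (star v * B.inrHom T d * v - B.inlHom T c) < ε) ∧
      ∀ g ∈ L, (B.algTensor T).completion.norm2u (tensorAut α σ hα hσ g v - v) < ε := by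
  obtain ⟨C, hC, hF⟩ := exists_opBound_forall (B := B) F
  set η := min (ε / 8) (ε / (8 * C))
  have hη : 0 < η := lt_min (by positivity) (by positivity)
  obtain ⟨t, ht⟩ := exists_of_near z hη
  obtain ⟨Q, M, hM, hQ⟩ := exists_tensorMap_le hα hσ t
  obtain ⟨δ, hδ'⟩ : ∃ δ, δ = ε / (4 * (M + 1)) := ⟨_, rfl⟩
  have hδ : 0 < δ := by rw [hδ']; positivity
  have hMδ : M * δ ≤ ε / 4 := by
    rw [hδ', mul_div_assoc', div_le_div_iff₀ (by positivity) (by positivity)]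
    nlinarith
  obtain ⟨χ, hχ, hχ₁, hχ₂⟩ := H Q δ hδ
  have hid : T.IntertwinesE T id (.id ℂ D) := fun _ _ => rfl
  obtain ⟨hQ₁, hQ₂⟩ := hQ χ hχ hid δ
  have hθ := (tensorMap_intertwinesE hχ hid).norm2u_map_le
  have hθl := tensorMap_inl hχ hid
  have hθr := tensorMap_inr hχ hid
  generalize tensorMap hχ hid = θ at hQ₁ hQ₂ hθ hθl hθr
  refine ⟨θ z, Unitary.map_mem θ hz, fun x hx => ?_, fun d hd => ?_, fun g hg => ?_⟩
  · have e₁ := hQ₁ x fun y hy => (hχ₁ y hy x hx).le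
    have e₂ := ((hF x hx).inl (T := T)).norm2u_commutator_le (θ z) (θ (of IsBounded.bdd t))
    rw [norm2u_sub_comm _ (B.inlHom T x * _), norm2u_sub_comm _ (B.inlHom T x * _)] at e₂
    have e₃ := ((norm2u_map_sub_map_le hθ z (of IsBounded.bdd t)).trans ht.le).trans
      (min_le_right _ _)
    rw [le_div_iff₀ (by positivity)] at e₃
    linarith
  · obtain ⟨c, hc⟩ := h₁ d hd
    refine ⟨χ c, ?_⟩
    have e := hθ (star z * T.inrHom T d * z - T.inlHom T c)
    rw [map_conj_sub, hθr, hθl] at e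
    exact e.trans_lt (hc.trans (by linarith))
  · have e₁ := norm2u_act_map_sub_le (P := (T.algTensor T).completion)
      (Q := (B.algTensor T).completion) (θ := θ) hθ (β := tensorAut α σ hα hσ g)
      (E_tensorAct hα hσ g) (β' := tensorAut σ σ hσ hσ g) (E_tensorAct hσ hσ g) z
      (of IsBounded.bdd t)
    have e₂ := hQ₂ g fun y hy => (hχ₂ g hg y hy).le
    have e₃ := ht.trans_le (min_le_left _ _)
    refine (e₁.trans_lt (add_lt_add (add_lt_add_of_lt_of_le (mul_lt_mul_of_pos_left e₃ two_pos) e₂)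
      (h₂ g hg))).trans_le ?_
    linarith

end tensorHom

end TracialAlgebra

namespace TracialSystem

open TracialAlgebra

/-! ### Consequences of strong McDuffness -/

variable {G : Type*} [Group G]

theorem IsStronglyMcDuff.exists_equiv {T : TracialSystem G Unit} (h : T.IsStronglyMcDuff) :
    ∃ φ : T.carrier ≃⋆ₐ[ℂ] (T.alg.algTensor T.alg).Completion,
      (∀ a, (T.alg.algTensor T.alg).completion.E (φ a) = T.alg.E a) ∧
      (∀ g a, tensorAut T.act T.act T.E_act T.E_act g (φ a) = φ (T.act g a)) ∧
      ∀ (F : Finset T.carrier) (L : Finset G) (ε : ℝ), 0 < ε →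
        ∃ w ∈ unitary (T.alg.algTensor T.alg).Completion,
          (∀ x ∈ F, (T.alg.algTensor T.alg).completion.norm2u
            (w * φ x * star w - T.alg.inrHom T.alg x) < ε) ∧
          ∀ g ∈ L, (T.alg.algTensor T.alg).completion.norm2u
            (tensorAut T.act T.act T.E_act T.E_act g w - w) < ε := by
  obtain ⟨φ, hE, hact, w, h₁, h₂⟩ := h
  refine ⟨φ, hE, hact, fun F L ε hε => ?_⟩
  have e₁ := (F.eventually_all (l := atTop)
    (p := fun x n => (T.tensor T).alg.norm2u ((w n : (T.tensor T).carrier) * φ x *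
      star (w n : (T.tensor T).carrier) - T.inr T x) < ε)).2
    fun x _ => (h₁ x).eventually_lt_const hε
  have e₂ := (L.eventually_all (l := atTop)
    (p := fun g n => (T.tensor T).alg.norm2u ((T.tensor T).act g (w n : (T.tensor T).carrier) -
      (w n : (T.tensor T).carrier)) < ε)).2 fun g _ => (h₂ g).eventually_lt_const hε
  obtain ⟨n, hn₁, hn₂⟩ := (e₁.and e₂).exists
  exact ⟨(w n : (T.tensor T).carrier), (w n).2, hn₁, hn₂⟩

/-- A strongly McDuff system has an approximately fixed unitary of its tensor square which
implements the flip, up to an automorphism, on finite sets. -/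
theorem IsStronglyMcDuff.exists_flip_unitary {T : TracialSystem G Unit} (h : T.IsStronglyMcDuff)
    (D : Finset T.carrier) (L : Finset G) {ε : ℝ} (hε : 0 < ε) :
    ∃ z ∈ unitary (T.alg.algTensor T.alg).Completion,
      (∀ d ∈ D, ∃ c, (T.alg.algTensor T.alg).completion.norm2u
        (star z * T.alg.inrHom T.alg d * z - T.alg.inlHom T.alg c) < ε) ∧
      ∀ g ∈ L, (T.alg.algTensor T.alg).completion.norm2u
        (tensorAut T.act T.act T.E_act T.E_act g z - z) < ε := by
  obtain ⟨φ, -, -, hφ⟩ := h.exists_equiv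
  exact exists_flip_unitary_of_equiv T.E_act φ hφ D L hε

/-- A strongly McDuff system has approximately central, approximately equivariant, trace-preserving
endomorphisms. -/
theorem IsStronglyMcDuff.exists_central_endomorphism {T : TracialSystem G Unit}
    (h : T.IsStronglyMcDuff) (F Q : Finset T.carrier) (L : Finset G) {ε : ℝ} (hε : 0 < ε) :
    ∃ ψ : T.carrier →⋆ₐ[ℂ] T.carrier, T.alg.IntertwinesE T.alg id ψ ∧
      (∀ y ∈ Q, ∀ x ∈ F, T.alg.norm2u (ψ y * x - x * ψ y) < ε) ∧
      ∀ g ∈ L, ∀ y ∈ Q, T.alg.norm2u (T.act g (ψ y) - ψ (T.act g y)) < ε := by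
  obtain ⟨φ, hE, hact, hφ⟩ := h.exists_equiv
  obtain ⟨C, hC, hQ⟩ := exists_opBound_forall (B := T.alg) Q
  obtain ⟨w, hw, h₁, h₂⟩ := hφ F L (ε / (2 * C)) (by positivity)
  exact TracialAlgebra.exists_central_endomorphism T.E_act hE hact inl_intertwinesE
    (tensorAct_inl T.E_act T.E_act) inl_mul_inr_comm F Q L hC hQ hw h₁ h₂

/-- If `S` absorbs the strongly McDuff system `T`, then `T` maps approximately centrally and
approximately equivariantly to `S`. -/
theorem CocycleConjugate.exists_central_hom {S T : TracialSystem G Unit} (hT : T.IsStronglyMcDuff)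
    (h : S.CocycleConjugate (S.tensor T)) (F : Finset S.carrier) (Q : Finset T.carrier)
    (L : Finset G) {ε : ℝ} (hε : 0 < ε) :
    ∃ χ : T.carrier →⋆ₐ[ℂ] S.carrier, T.alg.IntertwinesE S.alg id χ ∧
      (∀ y ∈ Q, ∀ x ∈ F, S.alg.norm2u (χ y * x - x * χ y) < ε) ∧
      ∀ g ∈ L, ∀ y ∈ Q, S.alg.norm2u (S.act g (χ y) - χ (T.act g y)) < ε := by
  classical
  obtain ⟨u, hu, φ', hE', hφ'⟩ := h
  let φ : S.carrier ≃⋆ₐ[ℂ] (S.alg.algTensor T.alg).Completion := φ'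
  let Q' := Q ∪ (L ×ˢ Q).image fun p => T.act p.1 p.2
  have hQ1 : ∀ y ∈ Q, y ∈ Q' := fun y hy => Finset.mem_union_left _ hy
  have hQ2 : ∀ g ∈ L, ∀ y ∈ Q, T.act g y ∈ Q' := fun g hg y hy =>
    Finset.mem_union_right _ (Finset.mem_image.2 ⟨(g, y), Finset.mk_mem_product hg hy, rfl⟩)
  obtain ⟨C, hC, hQ'⟩ := exists_opBound_forall (B := T.alg) Q'
  let F' := F ∪ L.image fun g => (u g : S.carrier)
  obtain ⟨F₀, δ, hδ, hF₀⟩ := exists_commutator_inr_lt (B := S.alg) (T := T.alg) (F'.image φ) hC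
    (half_pos hε)
  obtain ⟨ψ, hψ, h₁, h₂⟩ := hT.exists_central_endomorphism F₀ Q' L
    (show 0 < min δ (ε / 2) from lt_min hδ (half_pos hε))
  have hcomm : ∀ y ∈ Q', ∀ x ∈ F', (S.alg.algTensor T.alg).completion.norm2u
      (S.alg.inrHom T.alg (ψ y) * φ x - φ x * S.alg.inrHom T.alg (ψ y)) < ε / 2 := by
    intro y hy x hx
    exact hF₀ (ψ y) (hψ.opBound_map (hQ' y hy))
      (fun r hr => (h₁ y hy r hr).le.trans (min_le_left _ _)) _ (Finset.mem_image_of_mem φ hx)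
  refine exists_central_hom_of_cocycle (Y := (S.alg.algTensor T.alg).completion) (φ := φ)
    (β := tensorAut S.act T.act S.E_act T.E_act)
    (u := fun g => (u g : S.carrier)) (ρ := (S.alg.inrHom T.alg).comp ψ) hE' (fun g => (u g).2) hφ'
    (inr_intertwinesE.comp hψ) (fun y hy x hx => ?_) (fun g hg y hy => ?_) fun g hg y hy => ?_
  · exact (hcomm y (hQ1 y hy) x (Finset.mem_union_left _ hx)).trans (half_lt_self hε)
  · exact hcomm _ (hQ2 g hg y hy) _
      (Finset.mem_union_right _ (Finset.mem_image_of_mem (fun g => (u g : S.carrier)) hg))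
  · change (S.alg.algTensor T.alg).completion.norm2u (tensorAut S.act T.act S.E_act T.E_act g
      (S.alg.inrHom T.alg (ψ y)) - S.alg.inrHom T.alg (ψ (T.act g y))) < ε / 2
    rw [tensorAct_inr, ← map_sub]
    exact (norm2u_inr_le _).trans_lt ((h₂ g hg y (hQ1 y hy)).trans_le (min_le_right _ _))

/-- If `S` absorbs the strongly McDuff system `T`, then the embedding `S → S ⊗̄ T` is approximately
surrounded by unitaries. -/
theorem CocycleConjugate.exists_unitary {S T : TracialSystem G Unit} (hT : T.IsStronglyMcDuff)
    (h : S.CocycleConjugate (S.tensor T)) (F : Finset S.carrier) (D : Finset T.carrier)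
    (L : Finset G) {ε : ℝ} (hε : 0 < ε) :
    ∃ v ∈ unitary (S.alg.algTensor T.alg).Completion,
      (∀ x ∈ F, (S.alg.algTensor T.alg).completion.norm2u
        (v * S.alg.inlHom T.alg x - S.alg.inlHom T.alg x * v) < ε) ∧
      (∀ d ∈ D, ∃ c, (S.alg.algTensor T.alg).completion.norm2u
        (star v * S.alg.inrHom T.alg d * v - S.alg.inlHom T.alg c) < ε) ∧
      ∀ g ∈ L, (S.alg.algTensor T.alg).completion.norm2u
        (tensorAut S.act T.act S.E_act T.E_act g v - v) < ε := by
  obtain ⟨z, hz, h₁, h₂⟩ := hT.exists_flip_unitary D L (show 0 < ε / 4 by positivity)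
  exact exists_unitary_of_central_hom S.E_act T.E_act F D L hε
    (fun Q δ hδ => h.exists_central_hom hT F Q L hδ) hz h₁ h₂

end TracialSystem

/-! ### Partitions of unity by small projections -/

/-- A finite family of pairwise orthogonal projections with sum `1`. -/
structure IsProjectionPartition {A : Type*} [Ring A] [StarRing A] {ι : Type*} [Fintype ι]
    (q : ι → A) : Prop where
  proj : ∀ i, IsStarProjection (q i)
  ortho : ∀ i j, i ≠ j → q i * q j = 0
  sum_eq : ∑ i, q i = 1

namespace IsProjectionPartition

variable {A : Type*} [Ring A] [StarRing A] {A' : Type*} [Ring A'] [StarRing A']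
  {ι κ : Type*} [Fintype ι] [Fintype κ]

theorem map [Algebra ℂ A] [Algebra ℂ A'] {q : ι → A} (h : IsProjectionPartition q)
    (f : A →⋆ₐ[ℂ] A') : IsProjectionPartition fun i => f (q i) where
  proj i := (h.proj i).map f
  ortho i j hij := by rw [← map_mul, h.ortho i j hij, map_zero]
  sum_eq := by rw [← map_sum, h.sum_eq, map_one]

theorem comp_equiv {q : ι → A} (h : IsProjectionPartition q) (e : κ ≃ ι) :
    IsProjectionPartition fun i => q (e i) where
  proj i := h.proj _
  ortho i j hij := h.ortho _ _ fun he => hij (e.injective he)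
  sum_eq := by rw [e.sum_comp, h.sum_eq]

theorem mul {q : ι → A} {p : κ → A} (hq : IsProjectionPartition q) (hp : IsProjectionPartition p)
    (hc : ∀ i j, q i * p j = p j * q i) :
    IsProjectionPartition fun i : ι × κ => q i.1 * p i.2 where
  proj i := (hq.proj _).mul (hp.proj _) (hc _ _)
  ortho i j hij := by
    have e : q i.1 * p i.2 * (q j.1 * p j.2) = (q i.1 * q j.1) * (p i.2 * p j.2) := by
      rw [mul_assoc, ← mul_assoc (p i.2), ← hc, mul_assoc, mul_assoc]
    rw [e]
    by_cases h1 : i.1 = j.1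
    · rw [hp.ortho _ _ fun h2 => hij (Prod.ext h1 h2), mul_zero]
    · rw [hq.ortho _ _ h1, zero_mul]
  sum_eq := by
    rw [Fintype.sum_prod_type]
    simp only [← Finset.mul_sum, hp.sum_eq, mul_one, hq.sum_eq]

theorem pair {p : A} (hp : IsStarProjection p) :
    IsProjectionPartition fun b : Bool => if b then p else 1 - p where
  proj b := by cases b <;> simp [hp, hp.one_sub]
  ortho i j hij := by
    cases i <;> cases j <;> simp_all [hp.mul_one_sub_self, hp.one_sub_mul_self]
  sum_eq := by simp

end IsProjectionPartition

theorem IsStarProjection.seminorm_sq {K : Type*} [TopologicalSpace K] {A : Type*} [Ring A]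
    [StarRing A] [Algebra ℂ A] [StarModule ℂ A] {p : A} (hp : IsStarProjection p)
    (B : TracialAlgebra K A) (k : K) : B.seminorm k p ^ 2 = (B.E p k).re := by
  rw [B.seminorm_sq, hp.isSelfAdjoint.star_eq, hp.isIdempotentElem.eq]

/-- A self-adjoint element with finite spectrum which is not a scalar has a nontrivial spectral
projection. -/
theorem exists_isStarProjection_of_finite_spectrum {R : Type*} [CStarAlgebra R] {a : R}
    (ha : IsSelfAdjoint a) (hfin : (spectrum ℝ a).Finite)
    (hns : ∀ c : ℂ, a ≠ algebraMap ℂ R c) : ∃ p : R, IsStarProjection p ∧ p ≠ 0 ∧ p ≠ 1 := by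
  have hcont : ∀ f : ℝ → ℝ, ContinuousOn f (spectrum ℝ a) := fun f => by
    have := hfin.instDiscreteTopology
    exact continuousOn_iff_continuous_domRestrict.2 continuous_of_discreteTopology
  have hns' : ∀ r : ℝ, a ≠ algebraMap ℝ R r := fun r h => hns r (by
    rw [h, Algebra.algebraMap_eq_smul_one, Algebra.algebraMap_eq_smul_one, Complex.coe_smul])
  have hR : Nontrivial R := by
    by_contra h
    rw [not_nontrivial_iff_subsingleton] at h
    exact hns 0 (Subsingleton.elim _ _)
  obtain ⟨r, hr⟩ : (spectrum ℝ a).Nonempty :=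
    ContinuousFunctionalCalculus.spectrum_nonempty a ha
  obtain ⟨s, hs, hsr⟩ : ∃ s ∈ spectrum ℝ a, s ≠ r := by
    by_contra! h
    refine hns' r ?_
    rw [← cfc_const r a, ← cfc_id ℝ a]
    conv_rhs => rw [cfc_id ℝ a]
    exact cfc_congr h
  let f : ℝ → ℝ := fun t => if t = r then 1 else 0
  refine ⟨cfc f a, ⟨?_, cfc_predicate f a⟩, fun h => ?_, fun h => ?_⟩
  · rw [IsIdempotentElem, ← cfc_mul f f a (hcont f) (hcont f)]
    congr 1
    funext t
    simp [f]
  · rw [← cfc_zero ℝ a] at h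
    have := eqOn_of_cfc_eq_cfc h (hcont f) (hcont _) ha hr
    simp [f] at this
  · rw [← cfc_one ℝ a] at h
    have := eqOn_of_cfc_eq_cfc h (hcont f) (hcont _) ha hs
    simp [f, hsr] at this

theorem finite_spectrum_of_aeval_eq_zero {R : Type*} [Ring R] [Algebra ℂ R] {a : R}
    {p : Polynomial ℂ} (hp : p ≠ 0) (h : Polynomial.aeval a p = 0) : (spectrum ℂ a).Finite := by
  rcases subsingleton_or_nontrivial R with hR | hR
  · rw [spectrum.of_subsingleton]; exact Set.finite_empty
  refine (p.roots.toFinset.finite_toSet).subset fun z hz => ?_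
  have := spectrum.subset_polynomial_aeval a p ⟨z, hz, rfl⟩
  rw [h, spectrum.zero_eq, Set.mem_singleton_iff] at this
  simpa [hp] using this

namespace WStarBundle

variable {R : Type*} [CStarAlgebra R] {T : WStarBundle Unit R}

theorem norm2u_alg_le (a : R) : T.alg.norm2u a ≤ ‖a‖ := (T.alg_opBound a).norm2u_le

theorem alg_faithful {a : R} (h : T.alg.norm2u a = 0) : a = 0 := by
  refine T.E_faithful a (norm_eq_zero.1 ?_)
  rwa [TracialAlgebra.norm2u, Real.sqrt_eq_zero (norm_nonneg _)] at h

/-- The hyperfinite II₁ factor contains a nontrivial projection: it is not one-dimensional, so one of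
the finite-dimensional subalgebras with dense union contains a non-scalar self-adjoint element. -/
theorem exists_isStarProjection (hT : IsHyperfiniteII1Factor T) :
    ∃ p : R, IsStarProjection p ∧ p ≠ 0 ∧ p ≠ 1 := by
  obtain ⟨F, -, hF, hd⟩ := hT.hyperfinite
  by_contra! hno
  -- Otherwise all self-adjoint elements of the finite-dimensional subalgebras are scalars.
  have hsa : ∀ n, ∀ a ∈ F n, IsSelfAdjoint a → ∃ c : ℂ, a = algebraMap ℂ R c := by
    intro n a han ha
    by_contra! hns
    have := hF n
    obtain ⟨p, hp, hpa⟩ := Algebra.IsIntegral.isIntegral (R := ℂ) (⟨a, han⟩ : F n)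
    have hpa' : Polynomial.aeval a p = 0 := by
      have := congrArg (F n).subtype hpa
      rw [map_zero, ← Polynomial.aeval_def, ← Polynomial.aeval_algHom_apply] at this
      exact this
    have hfin := finite_spectrum_of_aeval_eq_zero hp.ne_zero hpa'
    have hfin' : (spectrum ℝ a).Finite := by
      rw [← spectrum.preimage_algebraMap ℂ]
      exact hfin.preimage (Complex.ofReal_injective.injOn)
    obtain ⟨p, hp, hp0, hp1⟩ := exists_isStarProjection_of_finite_spectrum ha hfin' hns
    exact hp1 (hno p hp hp0)
  have hsc : ∀ n, ∀ a ∈ F n, ∃ c : ℂ, a = algebraMap ℂ R c := by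
    intro n a ha
    obtain ⟨c, hc⟩ := hsa n (realPart a : R) (by
      rw [realPart_apply_coe]
      have h2 := (F n).smul_mem (add_mem ha (star_mem ha)) ((2⁻¹ : ℝ) : ℂ)
      rwa [Complex.coe_smul] at h2) (realPart a).2
    obtain ⟨d, hd⟩ := hsa n (imaginaryPart a : R) (by
      rw [imaginaryPart_apply_coe]
      have h2 := (F n).smul_mem ((F n).smul_mem (sub_mem ha (star_mem ha)) ((2⁻¹ : ℝ) : ℂ))
        (-Complex.I)
      rwa [Complex.coe_smul] at h2) (imaginaryPart a).2
    refine ⟨c + Complex.I * d, ?_⟩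
    rw [map_add, ← hc, ← smul_eq_mul, Algebra.algebraMap_eq_smul_one, smul_assoc,
      ← Algebra.algebraMap_eq_smul_one, ← hd]
    exact (realPart_add_I_smul_imaginaryPart a).symm
  -- By density, every element is the scalar given by its trace.
  have hall : ∀ x : R, x = algebraMap ℂ R (T.alg.E x ()) := by
    intro x
    rw [← sub_eq_zero]
    refine alg_faithful (le_antisymm ?_ (T.alg.norm2u_nonneg _))
    refine le_of_forall_pos_le_add fun ε hε => ?_
    obtain ⟨n, b, hb, hxb⟩ := hd x (ε / 2) (half_pos hε)
    obtain ⟨c, rfl⟩ := hsc n b hb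
    have e1 := T.alg.norm2u_sub_le x (algebraMap ℂ R c) (algebraMap ℂ R (T.alg.E x ()))
    have e2 : T.alg.norm2u (algebraMap ℂ R c - algebraMap ℂ R (T.alg.E x ())) ≤ ε / 2 := by
      have hc : T.alg.E (algebraMap ℂ R c) () = c := by
        rw [Algebra.algebraMap_eq_smul_one, LinearMap.map_smul, T.alg.E_one]
        simp
      rw [← map_sub]
      refine (T.norm2u_alg_le _).trans ?_
      have : Nontrivial R := by
        by_contra h
        rw [not_nontrivial_iff_subsingleton] at h
        exact hT.infinite_dimensional inferInstance
      rw [norm_algebraMap']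
      have h3 := ((T.alg.E (x - algebraMap ℂ R c)).norm_coe_le_norm ()).trans
        (T.alg.norm_E_le (x - algebraMap ℂ R c))
      rw [LinearMap.map_sub, ContinuousMap.sub_apply, hc, norm_sub_rev] at h3
      linarith
    linarith
  refine hT.infinite_dimensional (Module.Finite.of_surjective (Algebra.linearMap ℂ R) fun x => ?_)
  exact ⟨_, (hall x).symm⟩

theorem isSeparable_of_hyperfinite (hT : IsHyperfiniteII1Factor T) : T.alg.IsSeparable := by
  obtain ⟨F, -, hF, hd⟩ := hT.hyperfinite
  have h : ∀ n, ∃ s : Set (F n), s.Countable ∧ Dense s := fun n => by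
    have := hF n
    have := FiniteDimensional.proper ℂ (F n)
    exact TopologicalSpace.exists_countable_dense (F n)
  choose s hs hsd using h
  refine TracialAlgebra.isSeparable_of_countable (⋃ n, Subtype.val '' s n)
    (Set.countable_iUnion fun n => (hs n).image _) fun x ε hε => ?_
  obtain ⟨n, b, hb, hxb⟩ := hd x (ε / 2) (half_pos hε)
  obtain ⟨c, hc, hbc⟩ := Metric.dense_iff.1 (hsd n) ⟨b, hb⟩ (ε / 2) (half_pos hε)
  refine ⟨c, Set.mem_iUnion.2 ⟨n, c, hbc, rfl⟩, ?_⟩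
  have e1 := T.alg.norm2u_sub_le x b c
  have e2 : T.alg.norm2u (b - c) < ε / 2 := by
    refine (T.norm2u_alg_le _).trans_lt ?_
    rw [Metric.mem_ball, dist_comm, dist_eq_norm] at hc
    exact hc
  linarith

/-- A projection other than `0` and `1` has trace strictly between `0` and `1`. -/
theorem seminorm_lt_one {p : R} (hp : IsStarProjection p) (h1 : p ≠ 1) :
    T.alg.seminorm () p < 1 := by
  have h0 : ∀ q : R, IsStarProjection q → q ≠ 0 → 0 < T.alg.seminorm () q := by
    intro q hq hq0
    refine (T.alg.seminorm_nonneg () q).lt_of_ne fun h => hq0 (alg_faithful (le_antisymm ?_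
      (T.alg.norm2u_nonneg _)))
    exact T.alg.norm2u_le le_rfl fun k => h.symm.le
  have h2 := h0 _ hp.one_sub (sub_ne_zero.2 h1.symm)
  have h3 := hp.one_sub.seminorm_sq T.alg ()
  rw [LinearMap.map_sub, ContinuousMap.sub_apply, Complex.sub_re, ← hp.seminorm_sq,
    T.alg.E_one, ContinuousMap.one_apply, Complex.one_re] at h3
  nlinarith [T.alg.seminorm_nonneg () p]

end WStarBundle

namespace TracialSystem

open TracialAlgebra

variable {G : Type*} [Group G]

/-- Products of a nontrivial projection and its complement in the tensor powers of a strongly McDuff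
system partition the unit into projections of arbitrarily small trace. -/
theorem IsStronglyMcDuff.exists_partition {T : TracialSystem G Unit} (h : T.IsStronglyMcDuff)
    {p : T.carrier} (hp : IsStarProjection p) (h0 : T.alg.seminorm () p < 1)
    (h1 : T.alg.seminorm () (1 - p) < 1) {η : ℝ} (hη : 0 < η) :
    ∃ (N : ℕ) (q : Fin N → T.carrier), IsProjectionPartition q ∧
      ∀ i, T.alg.seminorm () (q i) ≤ η := by
  obtain ⟨φ, hE, -, -⟩ := h.exists_equiv
  let t := max (T.alg.seminorm () p) (T.alg.seminorm () (1 - p))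
  have ht : t < 1 := max_lt h0 h1
  have ht0 : 0 ≤ t := le_max_of_le_left (T.alg.seminorm_nonneg _ _)
  let q₀ : Bool → T.carrier := fun b => if b then p else 1 - p
  have hq₀ : IsProjectionPartition q₀ := .pair hp
  have hq₀t : ∀ b, T.alg.seminorm () (q₀ b) ≤ t := by
    rintro (_ | _)
    · exact le_max_right _ _
    · exact le_max_left _ _
  have hsI : (T.alg.algTensor T.alg).completion.IntertwinesE T.alg id
      (φ.symm : (T.alg.algTensor T.alg).Completion →⋆ₐ[ℂ] T.carrier) := intertwinesE_symm hE
  let θ : (T.alg.algTensor T.alg).Completion →⋆ₐ[ℂ] T.carrier := φ.symm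
  have main : ∀ n : ℕ, ∃ (ι : Type) (_ : Fintype ι) (q : ι → T.carrier),
      IsProjectionPartition q ∧ ∀ i, T.alg.seminorm () (q i) ≤ t ^ n := by
    intro n
    induction n with
    | zero =>
      refine ⟨Unit, inferInstance, fun _ => 1,
        ⟨fun _ => .one _, fun _ _ h => (h rfl).elim, by simp⟩,
        fun _ => ?_⟩
      rw [pow_zero, T.alg.seminorm_one]
    | succ n ih =>
      obtain ⟨ι, _, q, hq, hqt⟩ := ih
      refine ⟨ι × Bool, inferInstance,
        fun i => θ (T.alg.inlHom T.alg (q i.1)) * θ (T.alg.inrHom T.alg (q₀ i.2)),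
        ((hq.map (T.alg.inlHom T.alg)).map θ).mul ((hq₀.map (T.alg.inrHom T.alg)).map θ)
          fun i j => ?_, fun i => ?_⟩
      · rw [← map_mul, ← map_mul, inl_mul_inr_comm]
      · beta_reduce
        rw [← map_mul, hsI.seminorm_map, ← of_tmul, seminorm_of, seminorm_tmul, pow_succ]
        exact mul_le_mul (hqt _) (hq₀t _) (T.alg.seminorm_nonneg _ _) (pow_nonneg ht0 _)
  obtain ⟨n, hn⟩ := exists_pow_lt_of_lt_one hη ht
  obtain ⟨ι, _, q, hq, hqt⟩ := main n
  exact ⟨Fintype.card ι, fun i => q ((Fintype.equivFin ι).symm i), hq.comp_equiv _,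
    fun i => (hqt _).trans hn.le⟩

/-- In a strongly McDuff system on the hyperfinite II₁ factor, there are approximately central
partitions of unity by projections of small trace, whose length depends on the trace only. -/
theorem exists_central_partition {R : Type*} [CStarAlgebra R] {T : WStarBundle Unit R}
    (hT : IsHyperfiniteII1Factor T) {σ : G →* (R ≃⋆ₐ[ℂ] R)} {hσ : T.IsFiberwise σ}
    (h : (T.system σ hσ).IsStronglyMcDuff) {η : ℝ} (hη : 0 < η) :
    ∃ N : ℕ, ∀ (F : Finset R) (ε : ℝ), 0 < ε → ∃ q : Fin N → R, IsProjectionPartition q ∧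
      (∀ i, T.alg.seminorm () (q i) ≤ η) ∧ ∀ i, ∀ x ∈ F, T.alg.norm2u (q i * x - x * q i) < ε := by
  classical
  obtain ⟨p, hp, hp0, hp1⟩ := WStarBundle.exists_isStarProjection hT
  have h1 : T.alg.seminorm () p < 1 := WStarBundle.seminorm_lt_one hp hp1
  have h2 : T.alg.seminorm () (1 - p) < 1 :=
    WStarBundle.seminorm_lt_one hp.one_sub fun e => hp0 (sub_eq_self.1 e)
  obtain ⟨N, q, hq, hqη⟩ := h.exists_partition (p := p) hp h1 h2 hη
  refine ⟨N, fun F ε hε => ?_⟩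
  obtain ⟨ψ, hψ, hψF, -⟩ := h.exists_central_endomorphism F (Finset.univ.image q) ∅ hε
  refine ⟨fun i => ψ (q i), hq.map ψ, fun i => ?_, fun i x hx =>
    hψF (q i) (Finset.mem_image_of_mem q (Finset.mem_univ i)) x hx⟩
  exact (hψ.seminorm_map () (q i)).trans_le (hqη i)

end TracialSystem

/-! ### Partitions of unity with small overlaps -/

/-- The truncation of a real number to the unit interval. -/
noncomputable def unitClamp (x : ℝ) : ℝ := max 0 (min 1 x)

theorem unitClamp_mono : Monotone unitClamp := fun _ _ h =>
  max_le_max le_rfl (min_le_min le_rfl h)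

theorem unitClamp_of_nonpos {x : ℝ} (h : x ≤ 0) : unitClamp x = 0 :=
  max_eq_left ((min_le_right _ _).trans h)

theorem unitClamp_of_one_le {x : ℝ} (h : 1 ≤ x) : unitClamp x = 1 := by
  rw [unitClamp, min_eq_left h, max_eq_right zero_le_one]

theorem continuous_unitClamp : Continuous unitClamp := by unfold unitClamp; fun_prop

/-- A real number lies in the open interval `(l, l + 1)` only if its integer part is `l`. -/
theorem unitClamp_sub_nat {x : ℝ} {l : ℕ} (h : ⌊x⌋₊ ≠ l) :
    unitClamp (x - l) = 0 ∨ unitClamp (x - l) = 1 := by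
  rcases le_or_gt x l with h1 | h1
  · exact Or.inl (unitClamp_of_nonpos (by linarith))
  · refine Or.inr (unitClamp_of_one_le ?_)
    have h2 : l + 1 ≤ ⌊x⌋₊ :=
      lt_of_le_of_ne (Nat.le_floor h1.le) (Ne.symm h)
    have h3 := Nat.floor_le (show 0 ≤ x from (Nat.cast_nonneg l).trans h1.le)
    have h4 : ((l + 1 : ℕ) : ℝ) ≤ (⌊x⌋₊ : ℝ) := by exact_mod_cast h2
    push_cast at h4
    linarith

/-- A sequence with values in `{0, 1}` which goes from `0` to `1` jumps at some index. -/
theorem exists_jump {c : ℕ → ℝ} {n : ℕ} (h01 : ∀ i ≤ n, c i = 0 ∨ c i = 1) (h0 : c 0 = 0)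
    (hn : c n = 1) : ∃ i < n, c i = 0 ∧ c (i + 1) = 1 := by
  by_contra! h
  have : ∀ i ≤ n, c i = 0 := by
    intro i
    induction i with
    | zero => exact fun _ => h0
    | succ i ih =>
      intro hi
      exact (h01 _ hi).resolve_right (h i hi (ih (by omega)))
  rw [this n le_rfl] at hn
  exact zero_ne_one hn

/-- For an open cover by `n` sets there are, for every `N`, `N` partitions of unity `g_l` such that
at each point all but `n` of them are concentrated on a single index, whose set contains the point.
They arise by cutting the partial sums of one subordinate partition of unity into `N` layers. -/
theorem exists_step_functions {K : Type*} [TopologicalSpace K] [CompactSpace K] [T2Space K] {n : ℕ}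
    (U : Fin n → Set K) (hU : ∀ i, IsOpen (U i)) (hcov : ∀ k, ∃ i, k ∈ U i) (N : ℕ) :
    ∃ g : Fin N → Fin n → C(K, ℝ), (∀ l i k, 0 ≤ g l i k) ∧ (∀ l k, ∑ i, g l i k = 1) ∧
      ∀ k, ∃ s : Finset (Fin N), s.card ≤ n ∧ ∀ l ∉ s, ∃ i, k ∈ U i ∧ g l i k = 1 := by
  classical
  obtain ⟨ρ, hρ⟩ := PartitionOfUnity.exists_isSubordinate isClosed_univ U hU
    (fun k _ => Set.mem_iUnion.2 (hcov k))
  let f : ℕ → C(K, ℝ) := fun j => if h : j < n then ρ ⟨j, h⟩ else 0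
  have hf0 : ∀ j k, 0 ≤ f j k := fun j k => by
    by_cases h : j < n
    · simp only [f, h, dite_true]; exact ρ.nonneg _ _
    · simp [f, h]
  have hfU : ∀ (j : Fin n) k, 0 < f j k → k ∈ U j := fun j k h => by
    simp only [f, j.2, dite_true] at h
    exact hρ j (subset_tsupport _ (Function.mem_support.2 h.ne'))
  let S : ℕ → C(K, ℝ) := fun i => ∑ j ∈ Finset.range i, f j
  have hS : ∀ i k, S (i + 1) k = S i k + f i k := fun i k => by
    simp only [S, Finset.sum_range_succ, ContinuousMap.add_apply]
  have hS0 : ∀ k, S 0 k = 0 := fun k => by simp [S]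
  have hSn : ∀ k, S n k = 1 := fun k => by
    have := ρ.sum_eq_one (Set.mem_univ k)
    rw [finsum_eq_sum_of_fintype] at this
    rw [← this]
    simp only [S, ContinuousMap.coe_sum, Finset.sum_apply]
    rw [← Fin.sum_univ_eq_sum_range (fun j => f j k)]
    exact Finset.sum_congr rfl fun j _ => by simp [f]
  have hSm : ∀ k, Monotone fun i => S i k := fun k => monotone_nat_of_le_succ fun i => by
    rw [hS]; linarith [hf0 i k]
  let c : ℕ → ℕ → C(K, ℝ) := fun l i =>
    ⟨fun k => unitClamp (N * S i k - l), continuous_unitClamp.comp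
      ((continuous_const.mul (S i).continuous).sub continuous_const)⟩
  have hc : ∀ l i k, c l i k = unitClamp (N * S i k - l) := fun _ _ _ => rfl
  have hcm : ∀ l k, Monotone fun i => c l i k := fun l k i j hij =>
    unitClamp_mono (sub_le_sub_right (mul_le_mul_of_nonneg_left (hSm k hij) (Nat.cast_nonneg N)) _)
  have hc0 : ∀ l k, c l 0 k = 0 := fun l k => by
    rw [hc, hS0]; exact unitClamp_of_nonpos (by simp)
  have hcn : ∀ (l : Fin N) k, c l n k = 1 := fun l k => by
    rw [hc, hSn]
    refine unitClamp_of_one_le ?_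
    have : ((l + 1 : ℕ) : ℝ) ≤ N := by exact_mod_cast l.2
    push_cast at this
    linarith
  refine ⟨fun l i => c l (i + 1) - c l i, fun l i k => ?_, fun l k => ?_, fun k => ?_⟩
  · rw [ContinuousMap.sub_apply, sub_nonneg]
    exact hcm l k (Nat.le_succ i)
  · simp only [ContinuousMap.sub_apply]
    rw [Fin.sum_univ_eq_sum_range (fun i => c l (i + 1) k - c l i k),
      Finset.sum_range_sub (fun i => c l i k), hcn, hc0, sub_zero]
  · refine ⟨Finset.univ.filter fun l => ∃ i < n, ⌊N * S i k⌋₊ = l, ?_, fun l hl => ?_⟩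
    · rw [← Finset.card_map Fin.valEmbedding]
      refine (Finset.card_le_card (t := (Finset.range n).image fun i => ⌊N * S i k⌋₊) ?_).trans
        (Finset.card_image_le.trans (Finset.card_range n).le)
      intro m hm
      simp only [Finset.mem_map, Finset.mem_filter, Finset.mem_univ, true_and] at hm
      obtain ⟨l, ⟨i, hi, hl⟩, rfl⟩ := hm
      exact Finset.mem_image.2 ⟨i, Finset.mem_range.2 hi, hl⟩
    · simp only [Finset.mem_filter, Finset.mem_univ, true_and, not_exists, not_and] at hl
      obtain ⟨i, hi, h0, h1⟩ := exists_jump (c := fun i => c l i k) (n := n)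
        (fun i hi => by
          rcases hi.eq_or_lt with rfl | hi
          · exact Or.inr (hcn l k)
          · exact unitClamp_sub_nat (hl i hi)) (hc0 l k) (hcn l k)
      refine ⟨⟨i, hi⟩, hfU ⟨i, hi⟩ k ((hf0 i k).lt_of_ne fun h => ?_), ?_⟩
      · have : S (i + 1) k = S i k := by rw [hS, ← h, add_zero]
        exact zero_ne_one (h0.symm.trans (((congrArg (fun x : ℝ => unitClamp (N * x - l))
          this).symm).trans h1))
      · rw [ContinuousMap.sub_apply]
        exact (congrArg₂ (· - ·) h1 h0).trans (sub_zero 1)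

namespace TracialAlgebra

/-! ### Gluing along a partition of unity by projections -/

section glue

variable {K : Type u} [TopologicalSpace K] [CompactSpace K] {X : Type v} [Ring X] [StarRing X]
  [Algebra ℂ X] [StarModule ℂ X] {Y : TracialAlgebra K X} {Z : Type w} [Ring Z] [StarRing Z]
  [Algebra ℂ Z] [StarModule ℂ Z] {Q : TracialAlgebra K Z} {ι : Type*} [Fintype ι]

/-- The element `∑ r_l j(x_l)` glued from the `x_l` along a partition `r` of the unit. -/
def glue (j : X →⋆ₐ[ℂ] Z) (r : ι → Z) (x : ι → X) : Z := ∑ l, r l * j (x l)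

variable {j : X →⋆ₐ[ℂ] Z} {r : ι → Z}

theorem glue_sub (x y : ι → X) :
    glue j r x - glue j r y = glue j r fun l => x l - y l := by
  simp only [glue, ← Finset.sum_sub_distrib, ← mul_sub, map_sub]

variable (hr : IsProjectionPartition r) (hc : ∀ l x, r l * j x = j x * r l)
include hr hc

theorem glue_mul (x y : ι → X) : glue j r x * glue j r y = glue j r fun l => x l * y l := by
  classical
  have h : ∀ l m, r l * j (x l) * (r m * j (y m)) =
      if l = m then r l * j (x l * y l) else 0 := by
    intro l m
    have e : r l * j (x l) * (r m * j (y m)) = (r l * r m) * (j (x l) * j (y m)) := by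
      rw [mul_assoc, ← mul_assoc (j (x l)), ← hc, mul_assoc, mul_assoc]
    rw [e]
    split_ifs with h
    · rw [← h, (hr.proj l).isIdempotentElem.eq, map_mul]
    · rw [hr.ortho l m h, zero_mul]
  simp only [glue, Finset.sum_mul_sum, h, Finset.sum_ite_eq, Finset.mem_univ, if_true]

theorem star_glue (x : ι → X) : star (glue j r x) = glue j r fun l => star (x l) := by
  simp only [glue, star_sum, star_mul, (hr.proj _).isSelfAdjoint.star_eq, hc, map_star]

omit hc in
theorem glue_const (x : X) : (glue j r fun _ => x) = j x := by
  rw [glue, ← Finset.sum_mul, hr.sum_eq, one_mul]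

theorem glue_mem_unitary {x : ι → X} (hx : ∀ l, x l ∈ unitary X) : glue j r x ∈ unitary Z := by
  refine ⟨?_, ?_⟩
  · rw [star_glue hr hc, glue_mul hr hc]
    simp only [Unitary.star_mul_self_of_mem (hx _)]
    rw [glue_const hr, map_one]
  · rw [star_glue hr hc, glue_mul hr hc]
    simp only [Unitary.mul_star_self_of_mem (hx _)]
    rw [glue_const hr, map_one]

/-- If the trace of `r_l j(x)` is the product of the traces, then the 2-norm of a glued element is
the weighted quadratic mean of the 2-norms of the pieces. -/
theorem seminorm_glue_sq {s : ι → ℝ} (hE : ∀ l x k, Q.E (r l * j x) k = (s l : ℂ) ^ 2 * Y.E x k)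
    (x : ι → X) (k : K) :
    Q.seminorm k (glue j r x) ^ 2 = ∑ l, s l ^ 2 * Y.seminorm k (x l) ^ 2 := by
  rw [Q.seminorm_sq, star_glue hr hc, glue_mul hr hc, glue, map_sum, ContinuousMap.coe_sum,
    Finset.sum_apply, Complex.re_sum]
  refine Finset.sum_congr rfl fun l _ => ?_
  rw [hE, Y.seminorm_sq, ← Complex.ofReal_pow, Complex.re_ofReal_mul]

/-- The glued element has small 2-norm at `k` if all but a few pieces have, and the remaining
pieces are bounded. -/
theorem seminorm_glue_le {s : ι → ℝ} (hE : ∀ l x k, Q.E (r l * j x) k = (s l : ℂ) ^ 2 * Y.E x k)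
    {η : ℝ} (hs0 : ∀ l, 0 ≤ s l) (hs : ∀ l, s l ≤ η) (x : ι → X) (k : K) {C δ : ℝ}
    (hC : ∀ l, Y.seminorm k (x l) ≤ C) (b : Finset ι) {n : ℕ} (hb : b.card ≤ n)
    (hg : ∀ l ∉ b, Y.seminorm k (x l) ≤ δ) :
    Q.seminorm k (glue j r x) ^ 2 ≤ δ ^ 2 + n * (η * C) ^ 2 := by
  classical
  have h1 : ∑ l, s l ^ 2 = 1 := by
    have := seminorm_glue_sq hr hc hE (fun _ => 1) k
    rw [glue_const hr, map_one, Q.seminorm_one] at this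
    simpa [Y.seminorm_one] using this.symm
  rw [seminorm_glue_sq hr hc hE, ← Finset.sum_compl_add_sum b]
  refine add_le_add ?_ ?_
  · calc ∑ l ∈ bᶜ, s l ^ 2 * Y.seminorm k (x l) ^ 2 ≤ ∑ l ∈ bᶜ, s l ^ 2 * δ ^ 2 :=
        Finset.sum_le_sum fun l hl => mul_le_mul_of_nonneg_left
          (pow_le_pow_left₀ (Y.seminorm_nonneg _ _) (hg l (Finset.mem_compl.1 hl)) 2) (sq_nonneg _)
      _ ≤ ∑ l, s l ^ 2 * δ ^ 2 := Finset.sum_le_univ_sum_of_nonneg fun l => by positivity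
      _ = δ ^ 2 := by rw [← Finset.sum_mul, h1, one_mul]
  · calc ∑ l ∈ b, s l ^ 2 * Y.seminorm k (x l) ^ 2 ≤ ∑ l ∈ b, (η * C) ^ 2 :=
        Finset.sum_le_sum fun l _ => by
          rw [← mul_pow]
          exact pow_le_pow_left₀ (mul_nonneg (hs0 l) (Y.seminorm_nonneg _ _))
            (mul_le_mul (hs l) (hC l) (Y.seminorm_nonneg _ _) ((hs0 l).trans (hs l))) 2
      _ = b.card * (η * C) ^ 2 := by rw [Finset.sum_const, nsmul_eq_mul]
      _ ≤ n * (η * C) ^ 2 := by gcongr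

end glue

/-! ### Density of elementary tensors -/

section density

variable {K : Type u} [TopologicalSpace K] [CompactSpace K] {A : Type v} [Ring A] [StarRing A]
  [Algebra ℂ A] [StarModule ℂ A] {B : TracialAlgebra K A}
  {D : Type w} [Ring D] [StarRing D] [Algebra ℂ D] [StarModule ℂ D] {T : TracialAlgebra Unit D}
  [B.IsBounded] [T.IsBounded]

/-- A subadditive function on the strict tensor product which is bounded by the 2-norm and
nonpositive on elementary tensors is nonpositive. -/
theorem nonpos_of_subadditive {p : (B.algTensor T).Completion → ℝ}
    (hadd : ∀ x y, p (x + y) ≤ p x + p y) {C : ℝ}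
    (hC : ∀ x, p x ≤ C * (B.algTensor T).completion.norm2u x)
    (h : ∀ a d, p (B.inlHom T a * B.inrHom T d) ≤ 0) (x : (B.algTensor T).Completion) :
    p x ≤ 0 := by
  refine nonpos_of_lipschitz (C := C) (fun x y => ?_) (fun t => ?_) x
  · have := hadd y (x - y)
    rw [add_sub_cancel] at this
    exact this.trans (add_le_add le_rfl (hC _))
  · induction t with
    | zero =>
      have := hC 0
      rwa [norm2u_zero, mul_zero, ← map_zero (of (B := B.algTensor T) IsBounded.bdd)] at this
    | add s t hs ht =>
      rw [map_add]
      exact (hadd _ _).trans (add_nonpos hs ht)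
    | tmul a d =>
      rw [of_tmul]
      exact h a d

variable {Z : Type w'} [Ring Z] [StarRing Z] [Algebra ℂ Z] [StarModule ℂ Z]
  {Q : TracialAlgebra K Z} [Q.IsStrictlyComplete]

theorem commute_of_commute_tensor {j : (B.algTensor T).Completion →⋆ₐ[ℂ] Z}
    (hj : (B.algTensor T).completion.IntertwinesE Q id j) {r : Z}
    (h₁ : ∀ a, r * j (B.inlHom T a) = j (B.inlHom T a) * r)
    (h₂ : ∀ d, r * j (B.inrHom T d) = j (B.inrHom T d) * r) (x : (B.algTensor T).Completion) :
    r * j x = j x * r := by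
  obtain ⟨C, hC⟩ := IsBounded.bdd (B := Q) r
  rw [← sub_eq_zero]
  refine IsStrictlyComplete.faithful (B := Q) _ (le_antisymm ?_ (norm2u_nonneg _ _))
  refine nonpos_of_subadditive (p := fun x => Q.norm2u (r * j x - j x * r)) (C := 2 * C)
    (fun x y => ?_) (fun x => ?_) (fun a d => ?_) x
  · beta_reduce
    rw [map_add, mul_add, add_mul, add_sub_add_comm]
    exact Q.norm2u_add_le _ _
  · have h1 := hC.norm2u_commutator_le (j x) 0
    rw [mul_zero, zero_mul, sub_zero, sub_zero, norm2u_zero, zero_add] at h1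
    refine h1.trans (mul_le_mul_of_nonneg_left (hj.norm2u_map_le x) ?_)
    have := hC.1
    positivity
  · refine le_of_eq ?_
    beta_reduce
    rw [map_mul, ← mul_assoc, h₁, mul_assoc, h₂, mul_assoc, sub_self, norm2u_zero]

theorem E_mul_map_of_tensor {j : (B.algTensor T).Completion →⋆ₐ[ℂ] Z}
    (hj : (B.algTensor T).completion.IntertwinesE Q id j) {r : Z} {f : C(K, ℂ)}
    (h : ∀ a d k, Q.E (r * j (B.inlHom T a * B.inrHom T d)) k =
      f k * (B.algTensor T).completion.E (B.inlHom T a * B.inrHom T d) k)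
    (x : (B.algTensor T).Completion) (k : K) :
    Q.E (r * j x) k = f k * (B.algTensor T).completion.E x k := by
  obtain ⟨C, hC⟩ := IsBounded.bdd (B := Q) r
  rw [← sub_eq_zero, ← norm_le_zero_iff]
  refine nonpos_of_subadditive (p := fun x => ‖Q.E (r * j x) k -
    f k * (B.algTensor T).completion.E x k‖) (C := C + ‖f‖) (fun x y => ?_) (fun x => ?_)
    (fun a d => ?_) x
  · beta_reduce
    rw [map_add, mul_add, LinearMap.map_add, LinearMap.map_add, ContinuousMap.add_apply,
      ContinuousMap.add_apply, mul_add, add_sub_add_comm]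
    exact norm_add_le _ _
  · refine (norm_sub_le _ _).trans ?_
    rw [add_mul, norm_mul]
    refine add_le_add ?_ (mul_le_mul (f.norm_coe_le_norm k) ?_ (norm_nonneg _) (norm_nonneg _))
    · refine ((Q.E (r * j x)).norm_coe_le_norm k).trans ((Q.norm_E_le _).trans
        ((hC.norm2u_mul_le _).trans (mul_le_mul_of_nonneg_left (hj.norm2u_map_le x) hC.1)))
    · exact ((((B.algTensor T).completion.E x).norm_coe_le_norm k).trans (norm_E_le _ _))
  · beta_reduce
    rw [h, sub_self, norm_zero]

/-- A unitary which almost commutes with finitely many elements of both factors almost commutes with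
a given element which is approximated by algebraic tensors. -/
theorem exists_commutator_map_le {X : Type u'} [Ring X] [StarRing X] [Algebra ℂ X] [StarModule ℂ X]
    {Y : TracialAlgebra K X} {o : A ⊗[ℂ] D →⋆ₐ[ℂ] X} {l : A →⋆ₐ[ℂ] X} {r : D →⋆ₐ[ℂ] X}
    (ho : ∀ a d, o (a ⊗ₜ d) = l a * r d) (hd : ∀ x, ∀ ε > 0, ∃ t, Y.norm2u (x - o t) < ε)
    {j : X →⋆ₐ[ℂ] Z} (hj : Y.IntertwinesE Q id j) (x : X) {ε : ℝ} (hε : 0 < ε) :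
    ∃ (F : Finset A) (P : Finset D) (δ : ℝ), 0 < δ ∧ ∀ v ∈ unitary Z,
      (∀ a ∈ F, Q.norm2u (v * j (l a) - j (l a) * v) ≤ δ) →
      (∀ d ∈ P, Q.norm2u (v * j (r d) - j (r d) * v) ≤ δ) →
      Q.norm2u (v * j x - j x * v) < ε := by
  classical
  have key : ∀ t : A ⊗[ℂ] D, ∃ (F : Finset A) (P : Finset D) (M : ℝ), 0 ≤ M ∧ ∀ v ∈ unitary Z,
      ∀ δ : ℝ, (∀ a ∈ F, Q.norm2u (v * j (l a) - j (l a) * v) ≤ δ) →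
      (∀ d ∈ P, Q.norm2u (v * j (r d) - j (r d) * v) ≤ δ) →
      Q.norm2u (v * j (o t) - j (o t) * v) ≤ M * δ := by
    intro t
    induction t with
    | zero => exact ⟨∅, ∅, 0, le_rfl, fun v _ δ _ _ => by simp [norm2u_zero]⟩
    | add s t hs ht =>
      obtain ⟨F, P, M, hM, h⟩ := hs
      obtain ⟨F', P', M', hM', h'⟩ := ht
      refine ⟨F ∪ F', P ∪ P', M + M', add_nonneg hM hM', fun v hv δ h1 h2 => ?_⟩
      rw [map_add o, map_add, mul_add, add_mul, add_sub_add_comm, add_mul]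
      exact (Q.norm2u_add_le _ _).trans (add_le_add
        (h v hv δ (fun a ha => h1 a (Finset.mem_union_left _ ha))
          fun d hd => h2 d (Finset.mem_union_left _ hd))
        (h' v hv δ (fun a ha => h1 a (Finset.mem_union_right _ ha))
          fun d hd => h2 d (Finset.mem_union_right _ hd)))
    | tmul a d =>
      obtain ⟨Ca, hCa⟩ := IsBounded.bdd (B := Q) (j (l a))
      obtain ⟨Cd, hCd⟩ := IsBounded.bdd (B := Q) (j (r d))
      refine ⟨{a}, {d}, Cd + Ca, add_nonneg hCd.1 hCa.1, fun v hv δ h1 h2 => ?_⟩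
      have h1' := h1 a (Finset.mem_singleton_self a)
      have h2' := h2 d (Finset.mem_singleton_self d)
      rw [ho, map_mul j]
      have e : v * (j (l a) * j (r d)) -
          j (l a) * j (r d) * v =
          (v * j (l a) - j (l a) * v) * j (r d) +
          j (l a) * (v * j (r d) - j (r d) * v) := by noncomm_ring
      rw [e, add_mul]
      exact (Q.norm2u_add_le _ _).trans (add_le_add
        ((hCd.norm2u_mul_right_le _).trans (mul_le_mul_of_nonneg_left h1' hCd.1))
        ((hCa.norm2u_mul_le _).trans (mul_le_mul_of_nonneg_left h2' hCa.1)))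
  obtain ⟨t, ht⟩ := hd x (ε / 4) (by positivity)
  obtain ⟨F, P, M, hM, h⟩ := key t
  refine ⟨F, P, ε / (4 * (M + 1)), by positivity, fun v hv h1 h2 => ?_⟩
  have e1 := h v hv _ h1 h2
  have e2 := (opBound_of_mem_unitary (B := Q) hv).norm2u_commutator_le (j x)
    (j (o t))
  have e3 := hj.norm2u_map_le (x - o t)
  rw [map_sub] at e3
  have e4 : M * (ε / (4 * (M + 1))) ≤ ε / 4 := by
    rw [mul_div_assoc', div_le_div_iff₀ (by positivity) (by positivity)]
    nlinarith
  linarith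

/-- If a unitary `v` almost commutes with the first factor and conjugates elements of the second
factor almost into the first one, it conjugates all algebraic tensors almost into the first
factor. -/
theorem exists_conj_tensor_sub_le [Q.IsBounded] {o : A ⊗[ℂ] D →⋆ₐ[ℂ] Z} {l : A →⋆ₐ[ℂ] Z}
    {r : D →⋆ₐ[ℂ] Z} (ho : ∀ a d, o (a ⊗ₜ d) = l a * r d) (t : A ⊗[ℂ] D) :
    ∃ (F : Finset A) (P : Finset D) (M : ℝ), 0 ≤ M ∧ ∀ v ∈ unitary Z, ∀ δ : ℝ,
      (∀ a ∈ F, Q.norm2u (v * l a - l a * v) ≤ δ) →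
      (∀ d ∈ P, ∃ c, Q.norm2u (star v * r d * v - l c) ≤ δ) →
      ∃ c, Q.norm2u (star v * o t * v - l c) ≤ M * δ := by
  classical
  induction t with
  | zero => exact ⟨∅, ∅, 0, le_rfl, fun v _ δ _ _ => ⟨0, by simp [norm2u_zero]⟩⟩
  | add s t hs ht =>
    obtain ⟨F, P, M, hM, h⟩ := hs
    obtain ⟨F', P', M', hM', h'⟩ := ht
    refine ⟨F ∪ F', P ∪ P', M + M', add_nonneg hM hM', fun v hv δ h1 h2 => ?_⟩
    obtain ⟨c, hc⟩ := h v hv δ (fun a ha => h1 a (Finset.mem_union_left _ ha))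
      fun d hd => h2 d (Finset.mem_union_left _ hd)
    obtain ⟨c', hc'⟩ := h' v hv δ (fun a ha => h1 a (Finset.mem_union_right _ ha))
        fun d hd => h2 d (Finset.mem_union_right _ hd)
    refine ⟨c + c', ?_⟩
    rw [map_add o, map_add, mul_add, add_mul, add_sub_add_comm, add_mul]
    exact (Q.norm2u_add_le _ _).trans (add_le_add hc hc')
  | tmul a d =>
    obtain ⟨Ca, hCa⟩ := IsBounded.bdd (B := Q) (l a)
    obtain ⟨Cd, hCd⟩ := IsBounded.bdd (B := Q) (r d)
    refine ⟨{a}, {d}, Cd + Ca, add_nonneg hCd.1 hCa.1, fun v hv δ h1 h2 => ?_⟩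
    have h1' := h1 a (Finset.mem_singleton_self a)
    obtain ⟨c, hc⟩ := h2 d (Finset.mem_singleton_self d)
    refine ⟨a * c, ?_⟩
    have hv1 := Unitary.mul_star_self_of_mem hv
    have hv2 := Unitary.star_mul_self_of_mem hv
    have e : star v * o (a ⊗ₜ d) * v - l (a * c) =
        star v * (-(v * l a - l a * v)) * star v * (r d) * v +
        l a * (star v * r d * v - l c) := by
      have e' : star v * (-(v * l a - l a * v)) * star v * (r d) * v =
          star v * l a * (v * star v) * r d * v -
          (star v * v) * l a * star v * r d * v := by noncomm_ring
      rw [e', hv1, hv2, ho, map_mul l]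
      noncomm_ring
    rw [e, add_mul]
    refine (Q.norm2u_add_le _ _).trans (add_le_add ?_
      ((hCa.norm2u_mul_le _).trans (mul_le_mul_of_nonneg_left hc hCa.1)))
    rw [norm2u_mul_unitary hv]
    refine (hCd.norm2u_mul_right_le _).trans (mul_le_mul_of_nonneg_left ?_ hCd.1)
    rw [norm2u_mul_unitary (Unitary.star_mem hv), norm2u_unitary_mul (Unitary.star_mem hv),
      norm2u_neg]
    exact h1'

/-- To see that the first factor embedding is absorbing, it suffices to conjugate elements of the
second factor into the first factor. -/
theorem isAbsorbing_of_inr {G : Type*} [Group G]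
    {β : G →* ((B.algTensor T).Completion ≃⋆ₐ[ℂ] (B.algTensor T).Completion)}
    (H : ∀ (F : Finset A) (P : Finset D) (L : Finset G) (ε : ℝ), 0 < ε →
      ∃ v ∈ unitary (B.algTensor T).Completion,
        (∀ a ∈ F, (B.algTensor T).completion.norm2u (v * B.inlHom T a - B.inlHom T a * v) < ε) ∧
        (∀ d ∈ P, ∃ c, (B.algTensor T).completion.norm2u
          (star v * B.inrHom T d * v - B.inlHom T c) < ε) ∧
        ∀ g ∈ L, (B.algTensor T).completion.norm2u (β g v - v) < ε) :
    IsAbsorbing (B.algTensor T).completion (B.inlHom T) β := by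
  classical
  have key := exists_conj_tensor_sub_le (Q := (B.algTensor T).completion)
    (o := of IsBounded.bdd) (l := B.inlHom T) (r := B.inrHom T) of_tmul
  intro F E L ε hε
  -- Approximate all elements of `E` by algebraic tensors simultaneously.
  have hE : ∃ (F' : Finset A) (P : Finset D) (δ : ℝ), 0 < δ ∧
      ∀ v ∈ unitary (B.algTensor T).Completion,
      (∀ a ∈ F', (B.algTensor T).completion.norm2u (v * B.inlHom T a - B.inlHom T a * v) ≤ δ) →
      (∀ d ∈ P, ∃ c, (B.algTensor T).completion.norm2u
        (star v * B.inrHom T d * v - B.inlHom T c) ≤ δ) →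
      ∀ x ∈ E, ∃ c, (B.algTensor T).completion.norm2u (star v * x * v - B.inlHom T c) < ε := by
    induction E using Finset.induction_on with
    | empty => exact ⟨∅, ∅, 1, one_pos, by simp⟩
    | insert x s _ ih =>
      obtain ⟨F₁, P₁, δ₁, hδ₁, h₁⟩ := ih
      obtain ⟨t, ht⟩ := exists_of_near x (half_pos hε)
      obtain ⟨F₂, P₂, M, hM, h₂⟩ := key t
      have hδ₂ : 0 < ε / (2 * (M + 1)) := by positivity
      refine ⟨F₁ ∪ F₂, P₁ ∪ P₂, min δ₁ (ε / (2 * (M + 1))), lt_min hδ₁ hδ₂,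
        fun v hv h1 h2 y hy => ?_⟩
      rcases Finset.mem_insert.1 hy with rfl | hy
      · obtain ⟨c, hc⟩ := h₂ v hv (ε / (2 * (M + 1)))
          (fun a ha => (h1 a (Finset.mem_union_right _ ha)).trans (min_le_right _ _))
          (fun d hd => (h2 d (Finset.mem_union_right _ hd)).imp fun c hc =>
            hc.trans (min_le_right _ _))
        refine ⟨c, ?_⟩
        have e1 := (B.algTensor T).completion.norm2u_sub_le (star v * y * v)
          (star v * of IsBounded.bdd t * v)
          (B.inlHom T c)
        have e2 : (B.algTensor T).completion.norm2u
            (star v * y * v - star v * of IsBounded.bdd t * v) < ε / 2 := by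
          rw [← sub_mul, ← mul_sub, norm2u_mul_unitary hv,
            norm2u_unitary_mul (Unitary.star_mem hv)]
          exact ht
        have e4 : M * (ε / (2 * (M + 1))) ≤ ε / 2 := by
          rw [mul_div_assoc', div_le_div_iff₀ (by positivity) (by positivity)]
          nlinarith
        linarith
      · exact h₁ v hv
          (fun a ha => (h1 a (Finset.mem_union_left _ ha)).trans (min_le_left _ _))
          (fun d hd => (h2 d (Finset.mem_union_left _ hd)).imp fun c hc =>
            hc.trans (min_le_left _ _)) y hy
  obtain ⟨F', P, δ, hδ, h⟩ := hE
  obtain ⟨v, hv, h1, h2, h3⟩ := H (F ∪ F') P L (min ε δ) (lt_min hε hδ)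
  refine ⟨v, hv, fun a ha => (h1 a (Finset.mem_union_left _ ha)).trans_le (min_le_left _ _),
    h v hv (fun a ha => ((h1 a (Finset.mem_union_right _ ha)).trans_le (min_le_right _ _)).le)
      fun d hd => (h2 d hd).imp fun c hc => (hc.trans_le (min_le_right _ _)).le,
    fun g hg => (h3 g hg).trans_le (min_le_left _ _)⟩

end density

end TracialAlgebra

namespace TracialAlgebra

/-! ### Lifting unitaries from a fiber -/

section fiber_unitary

variable {A : Type v} [Ring A] [StarRing A] [Algebra ℂ A] [StarModule ℂ A]
  {B : TracialAlgebra Unit A} {D : Type w} [Ring D] [StarRing D] [Algebra ℂ D] [StarModule ℂ D]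
  {T : TracialAlgebra Unit D} [B.IsBounded] [T.IsBounded] {G : Type*} [Group G]
  {γ : G →* (A ≃⋆ₐ[ℂ] A)} {σ : G →* (D ≃⋆ₐ[ℂ] D)}

theorem norm2u_le_seminorm {A : Type*} [Ring A] [StarRing A] [Algebra ℂ A] [StarModule ℂ A]
    (B : TracialAlgebra Unit A) (a : A) : B.norm2u a ≤ B.seminorm () a :=
  B.norm2u_le (B.seminorm_nonneg _ _) fun _ => le_rfl

/-- A unitary which almost commutes with the first factor, almost conjugates the second factor into
the first one and is almost fixed may be taken to be the exponential of an algebraic tensor. -/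
theorem exists_expI_of_unitary (hγ : ∀ g a, B.E (γ g a) = B.E a) (hσ : ∀ g d, T.E (σ g d) = T.E d)
    (F : Finset A) (P : Finset D) (L : Finset G) {ε : ℝ} (hε : 0 < ε)
    {v : (B.algTensor T).Completion} (hv : v ∈ unitary (B.algTensor T).Completion)
    (h₁ : ∀ x ∈ F, (B.algTensor T).completion.norm2u
      (v * B.inlHom T x - B.inlHom T x * v) < ε / 2)
    (h₂ : ∀ d ∈ P, ∃ c, (B.algTensor T).completion.norm2u
      (star v * B.inrHom T d * v - B.inlHom T c) < ε / 2)
    (h₃ : ∀ g ∈ L, (B.algTensor T).completion.norm2u (tensorAut γ σ hγ hσ g v - v) < ε / 2) :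
    ∃ (h : A ⊗[ℂ] D) (u : (B.algTensor T).Completion), IsSelfAdjoint h ∧
      u = expI (of IsBounded.bdd h) ∧
      (∀ x ∈ F, (B.algTensor T).completion.norm2u
        (u * B.inlHom T x - B.inlHom T x * u) < ε) ∧
      (∀ d ∈ P, ∃ c, (B.algTensor T).completion.norm2u
        (star u * B.inrHom T d * u - B.inlHom T c) < ε) ∧
      ∀ g ∈ L, (B.algTensor T).completion.norm2u (tensorAut γ σ hγ hσ g u - u) < ε := by
  classical
  obtain ⟨C, hC, hF⟩ := exists_opBound_forall (B := B) F
  obtain ⟨C', hC', hP⟩ := exists_opBound_forall (B := T) P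
  have hη : 0 < ε / (4 * (C + C' + 1)) := by positivity
  obtain ⟨h, hh, hvh⟩ := exists_expI_of_near hv () hη
  have hu : expI (of IsBounded.bdd h) ∈ unitary (B.algTensor T).Completion := by
    exact expI_mem_unitary (hh.map _)
  refine ⟨h, _, hh, rfl, ?_⟩
  generalize expI (of (B := B.algTensor T) IsBounded.bdd h) = u at hu hvh ⊢
  have hvu := (norm2u_le_seminorm _ _).trans_lt hvh
  rw [lt_div_iff₀ (by positivity), norm2u_sub_comm] at hvu
  have h0 := (B.algTensor T).completion.norm2u_nonneg (u - v)
  have hvu' : ∀ c ≤ C + C' + 1, 2 * c * (B.algTensor T).completion.norm2u (u - v) < ε / 2 := by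
    intro c hc
    generalize (B.algTensor T).completion.norm2u (u - v) = r at hvu h0
    have := mul_le_mul_of_nonneg_left hc h0
    linarith
  refine ⟨fun x hx => ?_, fun d hd => ?_, fun g hg => ?_⟩
  · have e := ((hF x hx).inl (T := T)).norm2u_commutator_le u v
    rw [norm2u_sub_comm, (B.algTensor T).completion.norm2u_sub_comm (_ * v)] at e
    have := h₁ x hx
    linarith [hvu' C (by linarith)]
  · obtain ⟨c, hc⟩ := h₂ d hd
    refine ⟨c, ?_⟩
    have e := norm2u_conj_sub_conj_le ((hP d hd).inr (B := B)) hu hv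
    have e' := (B.algTensor T).completion.norm2u_sub_le (star u * B.inrHom T d * u)
      (star v * B.inrHom T d * v) (B.inlHom T c)
    linarith [hvu' C' (by linarith)]
  · have e : tensorAut γ σ hγ hσ g u - u =
        tensorAut γ σ hγ hσ g (u - v) + ((tensorAut γ σ hγ hσ g v - v) - (u - v)) := by
      rw [map_sub]; abel
    rw [e]
    have e1 := (B.algTensor T).completion.norm2u_add_le (tensorAut γ σ hγ hσ g (u - v))
      ((tensorAut γ σ hγ hσ g v - v) - (u - v))
    have e2 := (B.algTensor T).completion.norm2u_add_le (tensorAut γ σ hγ hσ g v - v) (-(u - v))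
    rw [norm2u_neg, ← sub_eq_add_neg] at e2
    rw [norm2u_map (E_tensorAct hγ hσ g)] at e1
    have := h₃ g hg
    linarith [hvu' 1 (by linarith)]

end fiber_unitary

section lift

variable {K : Type u} [TopologicalSpace K] [CompactSpace K]
  {A : Type v} [Ring A] [StarRing A] [Algebra ℂ A] [StarModule ℂ A] {B : TracialAlgebra K A}
  {A₀ : Type v'} [Ring A₀] [StarRing A₀] [Algebra ℂ A₀] [StarModule ℂ A₀]
  {B₀ : TracialAlgebra Unit A₀}
  {D : Type w} [Ring D] [StarRing D] [Algebra ℂ D] [StarModule ℂ D]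
  {T : TracialAlgebra Unit D} [B.IsBounded] [B₀.IsBounded] [T.IsBounded] {G : Type*} [Group G]
  {γ : G →* (A ≃⋆ₐ[ℂ] A)} {γ₀ : G →* (A₀ ≃⋆ₐ[ℂ] A₀)} {σ : G →* (D ≃⋆ₐ[ℂ] D)}

theorem starTensorMap_surjective {f : A →⋆ₐ[ℂ] A₀} (hf : Function.Surjective f) :
    Function.Surjective (starTensorMap f (StarAlgHom.id ℂ D)) := by
  intro t
  induction t with
  | zero => exact ⟨0, map_zero _⟩
  | tmul a d =>
    obtain ⟨a, rfl⟩ := hf a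
    exact ⟨a ⊗ₜ d, rfl⟩
  | add s t hs ht =>
    obtain ⟨s, rfl⟩ := hs
    obtain ⟨t, rfl⟩ := ht
    exact ⟨s + t, map_add _ _ _⟩

theorem map_expI {B' : TracialAlgebra Unit A₀} [B'.IsBounded]
    (f : B.Completion →⋆ₐ[ℂ] B'.Completion) (h : B.Completion) : f (expI h) = expI (f h) := by
  let : NormedAlgebra ℚ B.Completion := .restrictScalars ℚ ℂ _
  let : NormedAlgebra ℚ B'.Completion := .restrictScalars ℚ ℂ _
  have hf : Continuous f := by
    have := NonUnitalStarAlgHom.instContinuousLinearMapClassComplex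
      (F := B.Completion →⋆ₐ[ℂ] B'.Completion)
    exact map_continuous f
  rw [expI, expI, NormedSpace.map_exp f hf, map_smul]

theorem intertwinesE_id (T : TracialAlgebra Unit D) :
    T.IntertwinesE T id (StarAlgHom.id ℂ D) := fun _ _ => rfl

/-- A unitary over the fiber lifts to the exponential of an algebraic tensor with the same
properties with respect to the 2-norm at `k`. -/
theorem exists_lift_unitary (hγ : ∀ g a, B.E (γ g a) = B.E a)
    (hγ₀ : ∀ g a, B₀.E (γ₀ g a) = B₀.E a) (hσ : ∀ g d, T.E (σ g d) = T.E d)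
    {f : A →⋆ₐ[ℂ] A₀} {k : K} (hf : B.IntertwinesE B₀ (fun _ => k) f)
    (hfs : Function.Surjective f) (hfγ : ∀ g a, f (γ g a) = γ₀ g (f a))
    (H : ∀ (F : Finset A₀) (P : Finset D) (L : Finset G) (ε : ℝ), 0 < ε →
      ∃ v ∈ unitary (B₀.algTensor T).Completion,
        (∀ x ∈ F, (B₀.algTensor T).completion.norm2u
          (v * B₀.inlHom T x - B₀.inlHom T x * v) < ε) ∧
        (∀ d ∈ P, ∃ c, (B₀.algTensor T).completion.norm2u
          (star v * B₀.inrHom T d * v - B₀.inlHom T c) < ε) ∧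
        ∀ g ∈ L, (B₀.algTensor T).completion.norm2u (tensorAut γ₀ σ hγ₀ hσ g v - v) < ε)
    (F : Finset A) (P : Finset D) (L : Finset G) {ε : ℝ} (hε : 0 < ε) :
    ∃ h : (B.algTensor T).Completion, IsSelfAdjoint h ∧
      (∀ x ∈ F, (B.algTensor T).completion.seminorm k
        (expI h * B.inlHom T x - B.inlHom T x * expI h) < ε) ∧
      (∀ d ∈ P, ∃ c, (B.algTensor T).completion.seminorm k
        (star (expI h) * B.inrHom T d * expI h - B.inlHom T c) < ε) ∧
      ∀ g ∈ L, (B.algTensor T).completion.seminorm k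
        (tensorAut γ σ hγ hσ g (expI h) - expI h) < ε := by
  classical
  obtain ⟨v, hv, h₁, h₂, h₃⟩ := H (F.image f) P L (ε / 2) (half_pos hε)
  obtain ⟨h₀, u, hh₀, hu, h₁, h₂, h₃⟩ := exists_expI_of_unitary hγ₀ hσ (F.image f) P L
    hε hv h₁ h₂ h₃
  obtain ⟨t, rfl⟩ := starTensorMap_surjective (D := D) hfs h₀
  obtain ⟨π, hπ⟩ : ∃ π, π = tensorMap hf (intertwinesE_id T) := ⟨_, rfl⟩
  have hπE : (B.algTensor T).completion.IntertwinesE (B₀.algTensor T).completion (fun _ => k) π :=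
    hπ ▸ tensorMap_intertwinesE hf (intertwinesE_id T)
  have hlt : ∀ {x}, (B₀.algTensor T).completion.norm2u (π x) < ε →
      (B.algTensor T).completion.seminorm k x < ε := fun {x} hx => by
    rw [← hπE.seminorm_map () x]
    exact (seminorm_le_norm2u _ _ _).trans_lt hx
  have hl : ∀ a, π (B.inlHom T a) = B₀.inlHom T (f a) := fun a => hπ ▸ tensorMap_inl _ _ a
  have hr : ∀ d, π (B.inrHom T d) = B₀.inrHom T d := fun d => hπ ▸ tensorMap_inr _ _ d
  have hact : ∀ g x, π (tensorAut γ σ hγ hσ g x) = tensorAut γ₀ σ hγ₀ hσ g (π x) := fun g x =>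
    hπ ▸ tensorMap_tensorAct hγ hσ hγ₀ hσ hf (intertwinesE_id T) hfγ (fun _ _ => rfl) g x
  -- The real part of a lift of a self-adjoint element is a self-adjoint lift.
  have hs : IsSelfAdjoint ((2⁻¹ : ℂ) • (t + star t)) := by
    rw [isSelfAdjoint_iff, star_smul, star_add, star_star, add_comm]
    simp
  have hts : starTensorMap f (StarAlgHom.id ℂ D) ((2⁻¹ : ℂ) • (t + star t)) =
      starTensorMap f (StarAlgHom.id ℂ D) t := by
    rw [map_smul, map_add, map_star, hh₀.star_eq, ← two_smul ℂ, smul_smul,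
      inv_mul_cancel₀ two_ne_zero, one_smul]
  have hπu : π (expI (of IsBounded.bdd ((2⁻¹ : ℂ) • (t + star t)))) = u := by
    rw [map_expI, hπ, tensorMap_of, hts, hu]
  refine ⟨of IsBounded.bdd ((2⁻¹ : ℂ) • (t + star t)), hs.map _, ?_⟩
  generalize expI (of (B := B.algTensor T) IsBounded.bdd ((2⁻¹ : ℂ) • (t + star t))) = w at hπu ⊢
  subst hπu
  refine ⟨fun x hx => hlt ?_, fun d hd => ?_, fun g hg => hlt ?_⟩
  · rw [map_sub, map_mul, map_mul, hl]
    exact h₁ _ (Finset.mem_image_of_mem f hx)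
  · obtain ⟨c, hc⟩ := h₂ d hd
    obtain ⟨c, rfl⟩ := hfs c
    refine ⟨c, hlt ?_⟩
    rw [map_sub, map_mul, map_mul, map_star, hl, hr]
    exact hc
  · rw [map_sub, hact]
    exact h₃ g hg

end lift

end TracialAlgebra

namespace TracialAlgebra

/-! ### From local to global solutions -/

section interp

variable {K : Type u} [TopologicalSpace K] {X : Type v} [Ring X] [StarRing X] [Algebra ℂ X]
  [StarModule ℂ X] {Q : TracialAlgebra K X} {ι : Type*} [Fintype ι]

/-- A real function, regarded as a complex one. -/
noncomputable def complexify (g : C(K, ℝ)) : C(K, ℂ) := ⟨fun k => (g k : ℂ), by fun_prop⟩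

theorem complexify_apply (g : C(K, ℝ)) (k : K) : complexify g k = (g k : ℂ) := rfl

theorem isSelfAdjoint_complexify (g : C(K, ℝ)) : IsSelfAdjoint (complexify g) :=
  ContinuousMap.ext fun k => Complex.conj_ofReal (g k)

/-- A unital embedding of `C(K)` into the center of `X` over which `E` is linear. -/
structure IsCentralInclusion (Q : TracialAlgebra K X) (ζ : C(K, ℂ) →⋆ₐ[ℂ] X) : Prop where
  central : ∀ f x, ζ f * x = x * ζ f
  E_mul : ∀ f x k, Q.E (ζ f * x) k = f k * Q.E x k

/-- The combination of the `w_i` with the functions `g_i` as coefficients. -/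
noncomputable def interp (ζ : C(K, ℂ) →⋆ₐ[ℂ] X) (g : ι → C(K, ℝ)) (w : ι → X) : X :=
  ∑ i, ζ (complexify (g i)) * w i

variable {ζ : C(K, ℂ) →⋆ₐ[ℂ] X} (hζ : Q.IsCentralInclusion ζ) {g : ι → C(K, ℝ)}

theorem IsCentralInclusion.seminorm_mul (hζ : Q.IsCentralInclusion ζ) (f : C(K, ℂ)) (x : X)
    (k : K) : Q.seminorm k (ζ f * x) = ‖f k‖ * Q.seminorm k x := by
  have e : star (ζ f * x) * (ζ f * x) = ζ (star f * f) * (star x * x) := by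
    rw [star_mul, map_mul, map_star]
    rw [mul_assoc, ← mul_assoc (star (ζ f)), ← map_star, ← map_mul, ← mul_assoc, ← hζ.central,
      mul_assoc]
  rw [← sq_eq_sq₀ (Q.seminorm_nonneg _ _) (mul_nonneg (norm_nonneg _) (Q.seminorm_nonneg _ _)),
    mul_pow, ← norm_E_apply_self, ← norm_E_apply_self, e, hζ.E_mul, norm_mul,
    ContinuousMap.mul_apply,
    norm_mul, ContinuousMap.star_apply, norm_star, sq]

theorem IsCentralInclusion.isSelfAdjoint_interp (hζ : Q.IsCentralInclusion ζ) {w : ι → X}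
    (hw : ∀ i, IsSelfAdjoint (w i)) : IsSelfAdjoint (interp ζ g w) := by
  rw [isSelfAdjoint_iff, interp, star_sum]
  refine Finset.sum_congr rfl fun i _ => ?_
  rw [star_mul, (hw i).star_eq, ← map_star, (isSelfAdjoint_complexify _).star_eq, hζ.central]

theorem IsCentralInclusion.seminorm_interp_le (hζ : Q.IsCentralInclusion ζ)
    (h0 : ∀ i k, 0 ≤ g i k) (w : ι → X) (k : K) :
    Q.seminorm k (interp ζ g w) ≤ ∑ i, g i k * Q.seminorm k (w i) := by
  refine (Q.seminorm_sum_le _ _ _).trans (le_of_eq (Finset.sum_congr rfl fun i _ => ?_))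
  rw [hζ.seminorm_mul, complexify_apply, Complex.norm_real, Real.norm_of_nonneg (h0 i k)]

theorem interp_sub_eq (ζ : C(K, ℂ) →⋆ₐ[ℂ] X) (h1 : ∀ k, ∑ i, g i k = 1) (w : ι → X) (x : X) :
    interp ζ g w - x = interp ζ g fun i => w i - x := by
  have e : ∑ i, complexify (g i) = 1 := ContinuousMap.ext fun k => by
    rw [ContinuousMap.coe_sum, Finset.sum_apply]
    simp only [complexify_apply]
    rw [← Complex.ofReal_sum, h1, Complex.ofReal_one, ContinuousMap.one_apply]
  simp only [interp, mul_sub, Finset.sum_sub_distrib, ← Finset.sum_mul, ← map_sum, e, map_one,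
    one_mul]

/-- At a point where the coefficients are concentrated on one index, the combination agrees with the
corresponding element. -/
theorem IsCentralInclusion.seminorm_interp_sub_eq_zero (hζ : Q.IsCentralInclusion ζ)
    (h0 : ∀ i k, 0 ≤ g i k) (h1 : ∀ k, ∑ i, g i k = 1) (w : ι → X) {i : ι} {k : K}
    (hi : g i k = 1) : Q.seminorm k (interp ζ g w - w i) = 0 := by
  classical
  refine le_antisymm ?_ (Q.seminorm_nonneg _ _)
  rw [interp_sub_eq ζ h1]
  refine (hζ.seminorm_interp_le h0 _ k).trans (Finset.sum_nonpos fun j _ => ?_)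
  by_cases hj : j = i
  · rw [hj, sub_self, Q.seminorm_zero, mul_zero]
  · have h2 := h1 k
    rw [← Finset.add_sum_erase _ _ (Finset.mem_univ i), hi, add_eq_left,
      Finset.sum_eq_zero_iff_of_nonneg fun i _ => h0 i k] at h2
    rw [h2 j (Finset.mem_erase.2 ⟨hj, Finset.mem_univ j⟩), zero_mul]

theorem IsCentralInclusion.seminorm_interp_le_sum [CompactSpace K] (hζ : Q.IsCentralInclusion ζ)
    (h0 : ∀ i k, 0 ≤ g i k) (h1 : ∀ k, ∑ i, g i k = 1) (w : ι → X) (k : K) :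
    Q.seminorm k (interp ζ g w) ≤ ∑ i, Q.norm2u (w i) := by
  refine (hζ.seminorm_interp_le h0 w k).trans (Finset.sum_le_sum fun i _ => ?_)
  refine (mul_le_of_le_one_left (Q.seminorm_nonneg _ _) ?_).trans (Q.seminorm_le_norm2u _ _)
  rw [← h1 k]
  exact Finset.single_le_sum (fun i _ => h0 i k) (Finset.mem_univ i)

end interp

section defect

variable {A : Type v} {D : Type w} {G : Type w'} {X : Type v'} [Ring X] [StarRing X]

/-- The elements whose smallness expresses that `V` almost commutes with the range of `l`, almost
conjugates `r d` to `l (c d)`, and is almost fixed by `β`. -/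
def defect (l : A → X) (r : D → X) (β : G → X → X) (V : X) (c : D → A) : A ⊕ D ⊕ G → X
  | .inl a => V * l a - l a * V
  | .inr (.inl d) => star V * r d * V - l (c d)
  | .inr (.inr g) => β g V - V

variable [Algebra ℂ X] [StarModule ℂ X] {K : Type u} [TopologicalSpace K] {Q : TracialAlgebra K X}
  {l : A → X} {r : D → X} {β : G → X → X}

theorem seminorm_mul_sub_mul_eq_zero [hQ : Q.IsBounded] {k : K} {a a' b b' : X}
    (ha : Q.seminorm k (a - a') = 0) (hb : Q.seminorm k (b - b') = 0) :
    Q.seminorm k (a * b - a' * b') = 0 := by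
  obtain ⟨C, hC⟩ := hQ.bdd a
  obtain ⟨C', hC'⟩ := hQ.bdd b'
  refine le_antisymm ?_ (Q.seminorm_nonneg _ _)
  have e : a * b - a' * b' = a * (b - b') + (a - a') * b' := by noncomm_ring
  rw [e]
  refine (Q.seminorm_add_le _ _ _).trans ?_
  have h1 := hC.2 (b - b') k
  have h2 := hC'.mul_right (a - a') k
  rw [hb, mul_zero] at h1
  rw [ha, mul_zero] at h2
  linarith

theorem seminorm_sub_sub_eq_zero {k : K} {a a' b b' : X}
    (ha : Q.seminorm k (a - a') = 0) (hb : Q.seminorm k (b - b') = 0) :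
    Q.seminorm k ((a - b) - (a' - b')) = 0 := by
  refine le_antisymm ?_ (Q.seminorm_nonneg _ _)
  have e : (a - b) - (a' - b') = (a - a') + -(b - b') := by abel
  rw [e]
  refine (Q.seminorm_add_le _ _ _).trans ?_
  rw [seminorm_neg, ha, hb, add_zero]

/-- The 2-norm of the defect at `k` only depends on the images of `V` and `c` in the fiber. -/
theorem seminorm_defect_congr [hQ : Q.IsBounded] {k : K}
    (hβ : ∀ g x y, Q.seminorm k (β g x - β g y) = Q.seminorm k (x - y)) {V V' : X} {c c' : D → A}
    (hV : Q.seminorm k (V - V') = 0) (hc : ∀ d, Q.seminorm k (l (c d) - l (c' d)) = 0)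
    (i : A ⊕ D ⊕ G) :
    Q.seminorm k (defect l r β V c i) = Q.seminorm k (defect l r β V' c' i) := by
  apply seminorm_congr
  have h0 : ∀ x, Q.seminorm k (x - x) = 0 := fun x => by rw [sub_self, Q.seminorm_zero]
  match i with
  | .inl a =>
    exact seminorm_sub_sub_eq_zero (seminorm_mul_sub_mul_eq_zero hV (h0 _))
      (seminorm_mul_sub_mul_eq_zero (h0 _) hV)
  | .inr (.inl d) =>
    refine seminorm_sub_sub_eq_zero (seminorm_mul_sub_mul_eq_zero
      (seminorm_mul_sub_mul_eq_zero ?_ (h0 _)) hV) (hc d)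
    rw [← star_sub, seminorm_star, hV]
  | .inr (.inr g) =>
    refine seminorm_sub_sub_eq_zero ?_ hV
    rw [hβ, hV]

theorem exists_seminorm_defect_le [CompactSpace K] (hβ : ∀ g x k, Q.seminorm k (β g x) =
    Q.seminorm k x) (I : Finset (A ⊕ D ⊕ G)) (s : D → ℝ) (hs : ∀ d, 0 ≤ s d) :
    ∃ C, 0 ≤ C ∧ ∀ V ∈ unitary X, ∀ (c : D → A) (k : K),
      (∀ d, Q.seminorm k (l (c d)) ≤ s d) → ∀ i ∈ I, Q.seminorm k (defect l r β V c i) ≤ C := by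
  classical
  let m : A ⊕ D ⊕ G → ℝ := fun i => match i with
    | .inl a => Q.norm2u (l a) + Q.norm2u (l a)
    | .inr (.inl d) => Q.norm2u (r d) + s d
    | .inr (.inr g) => 1 + 1
  have hm : ∀ i, 0 ≤ m i := fun i => match i with
    | .inl a => add_nonneg (Q.norm2u_nonneg _) (Q.norm2u_nonneg _)
    | .inr (.inl d) => add_nonneg (Q.norm2u_nonneg _) (hs d)
    | .inr (.inr g) => by simp [m]
  refine ⟨∑ i ∈ I, m i, Finset.sum_nonneg fun i _ => hm i, fun V hV c k hc i hi => ?_⟩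
  refine le_trans ?_ (Finset.single_le_sum (fun i _ => hm i) hi)
  have hV1 := opBound_of_mem_unitary (B := Q) hV
  have hsub : ∀ {x y : X} {a b : ℝ}, Q.seminorm k x ≤ a → Q.seminorm k y ≤ b →
      Q.seminorm k (x - y) ≤ a + b := fun {x y a b} hx hy => by
    rw [sub_eq_add_neg]
    refine (Q.seminorm_add_le _ _ _).trans (add_le_add hx ?_)
    rwa [seminorm_neg]
  have hl : ∀ x, Q.seminorm k (V * x) ≤ Q.seminorm k x := fun x => by simpa using hV1.2 x k
  have hl' : ∀ x, Q.seminorm k (star V * x) ≤ Q.seminorm k x := fun x => by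
    simpa using hV1.star.2 x k
  have hr : ∀ x, Q.seminorm k (x * V) ≤ Q.seminorm k x := fun x => by
    simpa using hV1.mul_right x k
  match i with
  | .inl a =>
    exact hsub ((hl _).trans (Q.seminorm_le_norm2u _ _)) ((hr _).trans (Q.seminorm_le_norm2u _ _))
  | .inr (.inl d) =>
    exact hsub ((hr _).trans ((hl' _).trans (Q.seminorm_le_norm2u _ _))) (hc d)
  | .inr (.inr g) =>
    refine hsub ?_ (hV1.seminorm_le k)
    rw [hβ]
    exact hV1.seminorm_le k

end defect

section layers

variable {K : Type u} [TopologicalSpace K] [CompactSpace K] [T2Space K]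
  {X : Type v} [Ring X] [StarRing X] [Algebra ℂ X] [StarModule ℂ X] {Y : TracialAlgebra K X}
  [Y.IsBounded] {A : Type v'} [Ring A] [StarRing A] [Algebra ℂ A] [StarModule ℂ A]
  {D : Type w} {G : Type w'}

/-- Local solutions give, for every `N`, `N` global unitaries such that at each point all but a
bounded number of them are solutions; the others are bounded, independently of `N`. -/
theorem exists_layers {l : A →⋆ₐ[ℂ] Y.Completion} {r : D → Y.Completion}
    {β : G → Y.Completion → Y.Completion}
    (hβ : ∀ g x k, Y.completion.seminorm k (β g x) = Y.completion.seminorm k x)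
    (hβs : ∀ g x y, β g (x - y) = β g x - β g y)
    {z : C(K, ℂ) →⋆ₐ[ℂ] A} (hz : Y.completion.IsCentralInclusion (l.comp z))
    (I : Finset (A ⊕ D ⊕ G)) {ε : ℝ} (H : ∀ k, ∃ (h : Y.Completion) (c : D → A), IsSelfAdjoint h ∧
      ∀ i ∈ I, Y.completion.seminorm k (defect l r β (expI h) c i) < ε) :
    ∃ (n : ℕ) (C : ℝ), 0 ≤ C ∧ ∀ N : ℕ, ∃ (V : Fin N → Y.Completion) (c : Fin N → D → A),
      (∀ m, V m ∈ unitary Y.Completion) ∧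
      (∀ m k, ∀ i ∈ I, Y.completion.seminorm k (defect l r β (V m) (c m) i) ≤ C) ∧
      ∀ k, ∃ b : Finset (Fin N), b.card ≤ n ∧
        ∀ m ∉ b, ∀ i ∈ I, Y.completion.seminorm k (defect l r β (V m) (c m) i) ≤ ε := by
  classical
  choose h c hh hc using H
  let U : K → Set K := fun k =>
    ⋂ i ∈ I, {k' | Y.completion.seminorm k' (defect l r β (expI (h k)) (c k) i) < ε}
  have hU : ∀ k, IsOpen (U k) := fun k => isOpen_biInter_finset fun i _ =>
    isOpen_lt (continuous_seminorm _ _) continuous_const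
  have hkU : ∀ k, k ∈ U k := fun k => Set.mem_iInter₂.2 fun i hi => hc k i hi
  obtain ⟨t, ht⟩ := isCompact_univ.elim_nhds_subcover U fun k _ => (hU k).mem_nhds (hkU k)
  let e := t.equivFin
  let p : Fin t.card → K := fun i => e.symm i
  have hcov : ∀ k, ∃ i, k ∈ U (p i) := fun k => by
    obtain ⟨x, hx, hkx⟩ := Set.mem_iUnion₂.1 (ht.2 (Set.mem_univ k))
    refine ⟨e ⟨x, hx⟩, ?_⟩
    simpa [p] using hkx
  obtain ⟨C, hC0, hC⟩ := exists_seminorm_defect_le (l := l) (r := r) (β := β) hβ I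
    (fun d => ∑ i, Y.completion.norm2u (l (c (p i) d)))
    fun d => Finset.sum_nonneg fun i _ => Y.completion.norm2u_nonneg _
  refine ⟨t.card, C, hC0, fun N => ?_⟩
  obtain ⟨g, hg0, hg1, hg⟩ := exists_step_functions (fun i => U (p i)) (fun i => hU _) hcov N
  have hlc : ∀ m d, l (∑ i, z (complexify (g m i)) * c (p i) d) =
      interp (l.comp z) (g m) fun i => l (c (p i) d) := fun m d => by
    rw [map_sum]
    exact Finset.sum_congr rfl fun i _ => map_mul l _ _
  have hsa : ∀ m, IsSelfAdjoint (interp (l.comp z) (g m) fun i => h (p i)) := fun m =>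
    hz.isSelfAdjoint_interp fun i => hh _
  refine ⟨fun m => expI (interp (l.comp z) (g m) fun i => h (p i)),
    fun m d => ∑ i, z (complexify (g m i)) * c (p i) d, fun m => expI_mem_unitary (hsa m),
    fun m k => hC _ (expI_mem_unitary (hsa m)) _ k fun d => ?_, fun k => ?_⟩
  · rw [hlc]
    exact hz.seminorm_interp_le_sum (hg0 m) (hg1 m) _ k
  · obtain ⟨b, hb, hbg⟩ := hg k
    refine ⟨b, hb, fun m hm i hi => ?_⟩
    obtain ⟨j, hj, hj1⟩ := hbg m hm
    have e1 : Y.completion.seminorm k (expI (interp (l.comp z) (g m) fun i => h (p i)) -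
        expI (h (p j))) = 0 :=
      le_antisymm ((seminorm_expI_sub_le (hsa m) (hh _) k).trans
        (hz.seminorm_interp_sub_eq_zero (hg0 m) (hg1 m) (fun i => h (p i)) hj1).le)
        (Y.completion.seminorm_nonneg _ _)
    have e2 : ∀ d, Y.completion.seminorm k (l (∑ i, z (complexify (g m i)) * c (p i) d) -
        l (c (p j) d)) = 0 := fun d => by
      rw [hlc]
      exact hz.seminorm_interp_sub_eq_zero (hg0 m) (hg1 m) (fun i => l (c (p i) d)) hj1
    rw [seminorm_defect_congr (fun g x y => by rw [← hβs, hβ]) e1 e2]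
    exact (Set.mem_iInter₂.1 hj i hi).le

end layers

end TracialAlgebra

namespace TracialAlgebra

/-! ### Gluing over the base space -/

section gluing

variable {K : Type u} [TopologicalSpace K] [CompactSpace K]
  {A : Type v} {D : Type w} [Ring D] [StarRing D] [Algebra ℂ D] [StarModule ℂ D]
  {T : TracialAlgebra Unit D} {G : Type*}
  {X : Type v'} [Ring X] [StarRing X] [Algebra ℂ X] [StarModule ℂ X] {Y : TracialAlgebra K X}
  {Z : Type u'} [Ring Z] [StarRing Z] [Algebra ℂ Z] [StarModule ℂ Z] {Q : TracialAlgebra K Z}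
  [Q.IsBounded] {W : Type w'} [Ring W] [StarRing W] [Algebra ℂ W]

/-- The unitary glued from the layers along central projections of a third factor satisfies the
required estimates, up to a commutator of the projections with the elements of that factor. -/
theorem exists_glued_unitary {j : X →⋆ₐ[ℂ] Z} {ρ : D →⋆ₐ[ℂ] Z} {i : W →⋆ₐ[ℂ] Z} {l : A → X}
    {r : D → X} {l' : A → W} {r' : D → W} {β : G → X → X} {β' : G → Z ≃⋆ₐ[ℂ] Z}
    (hρj : ∀ d x, ρ d * j x = j x * ρ d)
    (hE : ∀ d x k, Q.E (ρ d * j x) k = T.E d () * Y.E x k)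
    (hρ : ∀ d, Q.norm2u (ρ d) ≤ T.norm2u d) (hβρ : ∀ g d, β' g (ρ d) = ρ d)
    (hβj : ∀ g x, j (β g x) = β' g (j x)) (hil : ∀ a, j (l a) = i (l' a))
    (hir : ∀ d, ρ d = i (r' d))
    (F : Finset A) (P P' : Finset D) (L : Finset G) {δ C η : ℝ} {n N : ℕ}
    {V : Fin N → X} {c : Fin N → D → A} (hV : ∀ m, V m ∈ unitary X)
    (hC : ∀ m k, ∀ s ∈ F.disjSum (P.disjSum L), Y.seminorm k (defect l r β (V m) (c m) s) ≤ C)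
    (hδ : ∀ k, ∃ b : Finset (Fin N), b.card ≤ n ∧ ∀ m ∉ b, ∀ s ∈ F.disjSum (P.disjSum L),
      Y.seminorm k (defect l r β (V m) (c m) s) ≤ δ)
    {q : Fin N → D} (hq : IsProjectionPartition q) (hqη : ∀ m, T.seminorm () (q m) ≤ η)
    {ε : ℝ} (hqP : ∀ m, ∀ d ∈ P', T.norm2u (q m * d - d * q m) ≤ ε) :
    ∃ v ∈ unitary Z,
      (∀ a ∈ F, Q.norm2u (v * i (l' a) - i (l' a) * v) ≤ √(δ ^ 2 + n * (η * C) ^ 2)) ∧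
      (∀ d ∈ P', Q.norm2u (v * i (r' d) - i (r' d) * v) ≤ N * ε) ∧
      (∀ d ∈ P, ∃ c, Q.norm2u (star v * j (r d) * v - i c) ≤ √(δ ^ 2 + n * (η * C) ^ 2)) ∧
      ∀ g ∈ L, Q.norm2u (β' g v - v) ≤ √(δ ^ 2 + n * (η * C) ^ 2) := by
  have hr : IsProjectionPartition fun m => ρ (q m) := hq.map _
  have hc : ∀ (m : Fin N) x, ρ (q m) * j x = j x * ρ (q m) := fun m x => hρj _ x
  have hE' : ∀ (m : Fin N) x k, Q.E (ρ (q m) * j x) k =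
      (T.seminorm () (q m) : ℂ) ^ 2 * Y.E x k := fun m x k => by
    rw [hE, ← Complex.ofReal_pow, (hq.proj m).seminorm_sq]
    congr 1
    have := T.E_star (q m) ()
    rw [(hq.proj m).isSelfAdjoint.star_eq] at this
    exact (Complex.conj_eq_iff_re.1 this.symm).symm
  have key : ∀ s ∈ F.disjSum (P.disjSum L), Q.norm2u (glue j (fun m => ρ (q m)) fun m =>
      defect l r β (V m) (c m) s) ≤ √(δ ^ 2 + n * (η * C) ^ 2) := fun s hs => by
    refine norm2u_le _ (Real.sqrt_nonneg _) fun k => Real.le_sqrt_of_sq_le ?_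
    obtain ⟨b, hb, hbδ⟩ := hδ k
    exact seminorm_glue_le hr hc hE' (fun m => T.seminorm_nonneg _ _) hqη _ k
      (fun m => hC m k s hs) b hb fun m hm => hbδ m hm s hs
  refine ⟨glue j (fun m => ρ (q m)) V, glue_mem_unitary hr hc hV,
    fun a ha => ?_, fun d hd => ?_, fun d hd => ?_, fun g hg => ?_⟩
  · have := key (.inl a) (Finset.inl_mem_disjSum.2 ha)
    rwa [← hil, ← glue_const (j := j) hr (l a), glue_mul hr hc, glue_mul hr hc, glue_sub]
  · have e : glue j (fun m => ρ (q m)) V * i (r' d) - i (r' d) * glue j (fun m => ρ (q m)) V =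
        ∑ m, ρ (q m * d - d * q m) * j (V m) := by
      rw [glue, Finset.sum_mul, Finset.mul_sum, ← Finset.sum_sub_distrib]
      refine Finset.sum_congr rfl fun m _ => ?_
      rw [← hir, mul_assoc, ← hρj, map_sub, map_mul, map_mul, sub_mul, ← mul_assoc, ← mul_assoc]
    rw [e]
    refine norm2u_le _ ?_ fun k => ?_
    · rcases Nat.eq_zero_or_pos N with h | h
      · simp [h]
      · exact mul_nonneg (Nat.cast_nonneg _) ((T.norm2u_nonneg _).trans (hqP ⟨0, h⟩ d hd))
    refine (seminorm_sum_le _ _ _).trans ((Finset.sum_le_card_nsmul _ _ ε fun m _ => ?_).trans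
      (le_of_eq ?_))
    · refine (seminorm_le_norm2u _ _ _).trans ?_
      rw [norm2u_mul_unitary (Unitary.map_mem j (hV m))]
      exact (hρ _).trans (hqP m d hd)
    · rw [Finset.card_univ, Fintype.card_fin, nsmul_eq_mul]
  · have := key (.inr (.inl d)) (Finset.inr_mem_disjSum.2 (Finset.inl_mem_disjSum.2 hd))
    refine ⟨∑ m, r' (q m) * l' (c m d), ?_⟩
    have e : i (∑ m, r' (q m) * l' (c m d)) = glue j (fun m => ρ (q m)) fun m => l (c m d) := by
      rw [map_sum, glue]
      refine Finset.sum_congr rfl fun m _ => ?_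
      rw [map_mul, hil, hir]
    rwa [e, ← glue_const (j := j) hr (r d), star_glue hr hc, glue_mul hr hc, glue_mul hr hc,
      glue_sub]
  · have := key (.inr (.inr g)) (Finset.inr_mem_disjSum.2 (Finset.inr_mem_disjSum.2 hg))
    have e : β' g (glue j (fun m => ρ (q m)) V) = glue j (fun m => ρ (q m)) fun m => β g (V m) := by
      rw [glue, map_sum, glue]
      refine Finset.sum_congr rfl fun m _ => ?_
      rw [map_mul, hβρ, hβj]
    rwa [e, glue_sub]

end gluing

section triple

variable {K : Type u} [TopologicalSpace K] [CompactSpace K]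
  {A : Type v} [Ring A] [StarRing A] [Algebra ℂ A] [StarModule ℂ A] {B : TracialAlgebra K A}
  {D : Type w} [Ring D] [StarRing D] [Algebra ℂ D] [StarModule ℂ D]
  {T : TracialAlgebra Unit D} [B.IsBounded] [T.IsBounded]
  {X : Type v'} [Ring X] [StarRing X] [Algebra ℂ X] [StarModule ℂ X] {Y : TracialAlgebra K X}
  [Y.IsBounded] {l : A →⋆ₐ[ℂ] X} {r : D →⋆ₐ[ℂ] X}

/-- The embedding `B ⊗̄ T → Y ⊗̄ T` induced by an embedding `B → Y`. -/
noncomputable def outerHom (T : TracialAlgebra Unit D) [T.IsBounded]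
    (hl : B.IntertwinesE Y id l) : (B.algTensor T).Completion →⋆ₐ[ℂ] (Y.algTensor T).Completion :=
  tensorMap hl (intertwinesE_id T)

variable (hl : B.IntertwinesE Y id l)

theorem outerHom_inl (a : A) : outerHom T hl (B.inlHom T a) = Y.inlHom T (l a) :=
  tensorMap_inl _ _ a

theorem outerHom_inr (d : D) : outerHom T hl (B.inrHom T d) = Y.inrHom T d := tensorMap_inr _ _ d

theorem outerHom_intertwinesE :
    (B.algTensor T).completion.IntertwinesE (Y.algTensor T).completion id (outerHom T hl) :=
  tensorMap_intertwinesE _ _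

theorem inlHom_mul_outerHom_comm (hlr : ∀ a d, l a * r d = r d * l a) (d : D)
    (x : (B.algTensor T).Completion) :
    Y.inlHom T (r d) * outerHom T hl x = outerHom T hl x * Y.inlHom T (r d) := by
  refine commute_of_commute_tensor (outerHom_intertwinesE hl) (fun a => ?_) (fun d' => ?_) x
  · rw [outerHom_inl, ← map_mul (Y.inlHom T), ← map_mul (Y.inlHom T), hlr]
  · rw [outerHom_inr, inl_mul_inr_comm]

theorem E_inlHom_mul_outerHom (hlr : ∀ a d, l a * r d = r d * l a)
    (hE : ∀ a d, Y.E (l a * r d) = T.E d () • B.E a) (d : D) (x : (B.algTensor T).Completion)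
    (k : K) : (Y.algTensor T).completion.E (Y.inlHom T (r d) * outerHom T hl x) k =
      T.E d () * (B.algTensor T).completion.E x k := by
  refine E_mul_map_of_tensor (f := ContinuousMap.const K (T.E d ())) (outerHom_intertwinesE hl)
    (fun a d' k => ?_) x k
  rw [map_mul (outerHom T hl), outerHom_inl, outerHom_inr, ← mul_assoc, ← map_mul (Y.inlHom T),
    E_inl_mul_inr, ← hlr, hE, E_inl_mul_inr, ContinuousMap.const_apply]
  simp only [ContinuousMap.smul_apply, smul_eq_mul]
  ring

theorem IsCentralInclusion.inl {z : C(K, ℂ) →⋆ₐ[ℂ] A} (hz : B.IsCentralInclusion z) :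
    (B.algTensor T).completion.IsCentralInclusion ((B.inlHom T).comp z) := by
  refine ⟨fun f x => ?_, fun f x k => ?_⟩
  · refine commute_of_commute_inl_inr (fun a => ?_) (fun d => inl_mul_inr_comm _ _) x
    change B.inlHom T (z f) * B.inlHom T a = B.inlHom T a * B.inlHom T (z f)
    rw [← map_mul (B.inlHom T), ← map_mul (B.inlHom T), hz.central]
  · refine E_mul_map_of_tensor (Q := (B.algTensor T).completion)
      (j := StarAlgHom.id ℂ (B.algTensor T).Completion) (fun _ _ => rfl) (fun a d k => ?_) x k
    change (B.algTensor T).completion.E (B.inlHom T (z f) * (B.inlHom T a * B.inrHom T d)) k = _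
    rw [← mul_assoc, ← map_mul (B.inlHom T), E_inl_mul_inr, E_inl_mul_inr,
      ContinuousMap.smul_apply, ContinuousMap.smul_apply, hz.E_mul]
    simp only [smul_eq_mul]
    ring

/-- Finitely many elements of an algebra which is densely spanned by products `l a * r d` are almost
commuted with as soon as finitely many elements `l a` and `r d` are. -/
theorem exists_commutator_inl_lt {o : A ⊗[ℂ] D →⋆ₐ[ℂ] X}
    (ho : ∀ a d, o (a ⊗ₜ d) = l a * r d) (hd : ∀ x, ∀ ε > 0, ∃ t, Y.norm2u (x - o t) < ε)
    (F : Finset X) {ε : ℝ} (hε : 0 < ε) :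
    ∃ (F₁ : Finset A) (P₁ : Finset D) (δ : ℝ), 0 < δ ∧
      ∀ v ∈ unitary (Y.algTensor T).Completion,
      (∀ a ∈ F₁, (Y.algTensor T).completion.norm2u
        (v * Y.inlHom T (l a) - Y.inlHom T (l a) * v) ≤ δ) →
      (∀ d ∈ P₁, (Y.algTensor T).completion.norm2u
        (v * Y.inlHom T (r d) - Y.inlHom T (r d) * v) ≤ δ) →
      ∀ x ∈ F, (Y.algTensor T).completion.norm2u (v * Y.inlHom T x - Y.inlHom T x * v) < ε := by
  classical
  induction F using Finset.induction_on with
  | empty => exact ⟨∅, ∅, 1, one_pos, by simp⟩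
  | insert x s _ ih =>
    obtain ⟨F₁, P₁, δ₁, hδ₁, h₁⟩ := ih
    obtain ⟨F₂, P₂, δ₂, hδ₂, h₂⟩ := exists_commutator_map_le
      (Q := (Y.algTensor T).completion) ho hd inl_intertwinesE x hε
    refine ⟨F₁ ∪ F₂, P₁ ∪ P₂, min δ₁ δ₂, lt_min hδ₁ hδ₂, fun v hv h1 h2 y hy => ?_⟩
    rcases Finset.mem_insert.1 hy with rfl | hy
    · exact h₂ v hv
        (fun a ha => (h1 a (Finset.mem_union_right _ ha)).trans (min_le_right _ _))
        fun d hd => (h2 d (Finset.mem_union_right _ hd)).trans (min_le_right _ _)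
    · exact h₁ v hv
        (fun a ha => (h1 a (Finset.mem_union_left _ ha)).trans (min_le_left _ _))
        (fun d hd => (h2 d (Finset.mem_union_left _ hd)).trans (min_le_left _ _)) y hy

/-- The weight `δ / (2 (n + 1) (C + 1))` makes the contribution of `n` pieces of size `C` negligible. -/
theorem sqrt_sq_add_le (n : ℕ) {δ C : ℝ} (hδ : 0 ≤ δ) (hC : 0 ≤ C) :
    √((δ / 2) ^ 2 + n * (δ / (2 * (n + 1) * (C + 1)) * C) ^ 2) ≤ δ := by
  refine Real.sqrt_le_iff.2 ⟨hδ, ?_⟩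
  have h1 : δ / (2 * (n + 1) * (C + 1)) * C ≤ δ / (2 * (n + 1)) := by
    rw [← div_div, div_mul_eq_mul_div, div_le_iff₀ (by positivity)]
    have : 0 ≤ δ / (2 * ((n : ℝ) + 1)) := by positivity
    nlinarith
  have h2 : (0 : ℝ) ≤ δ / (2 * (n + 1) * (C + 1)) * C := by positivity
  have h3 : n * (δ / (2 * ((n : ℝ) + 1))) ^ 2 ≤ (δ / 2) ^ 2 := by
    have e : δ / (2 * ((n : ℝ) + 1)) = δ / 2 / (n + 1) := by rw [div_div]
    rw [e, div_pow, mul_div_assoc', div_le_iff₀ (by positivity), mul_comm]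
    exact mul_le_mul_of_nonneg_left (by nlinarith [Nat.cast_nonneg (α := ℝ) n]) (sq_nonneg _)
  have h4 := mul_le_mul_of_nonneg_left (pow_le_pow_left₀ h2 h1 2) (Nat.cast_nonneg (α := ℝ) n)
  nlinarith [sq_nonneg δ]

/-- If there are local solutions for `B ⊗̄ T`, if `Y` contains commuting copies of `B` and `T`, and
if the copy of `T` contains almost central partitions of the unit by small projections which are
fixed by the action, then `Y` is absorbed by `Y ⊗̄ T`. -/
theorem isAbsorbing_of_local [T2Space K] {G : Type w'} [Group G]
    {γ : G →* (A ≃⋆ₐ[ℂ] A)} {σ : G →* (D ≃⋆ₐ[ℂ] D)} {α : G →* (X ≃⋆ₐ[ℂ] X)}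
    (hγ : ∀ g a, B.E (γ g a) = B.E a) (hσ : ∀ g d, T.E (σ g d) = T.E d)
    (hα : ∀ g x, Y.E (α g x) = Y.E x) (hl : B.IntertwinesE Y id l)
    (hαl : ∀ g a, l (γ g a) = α g (l a))
    (hαr : ∀ g d, α g (r d) = r d) (hlr : ∀ a d, l a * r d = r d * l a)
    (hE : ∀ a d, Y.E (l a * r d) = T.E d () • B.E a) {o : A ⊗[ℂ] D →⋆ₐ[ℂ] X}
    (ho : ∀ a d, o (a ⊗ₜ d) = l a * r d) (hd : ∀ x, ∀ ε > 0, ∃ t, Y.norm2u (x - o t) < ε)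
    {z : C(K, ℂ) →⋆ₐ[ℂ] A} (hz : B.IsCentralInclusion z)
    (hq : ∀ η : ℝ, 0 < η → ∃ N : ℕ, ∀ (F : Finset D) (ε : ℝ), 0 < ε → ∃ q : Fin N → D,
      IsProjectionPartition q ∧ (∀ i, T.seminorm () (q i) ≤ η) ∧
        ∀ i, ∀ x ∈ F, T.norm2u (q i * x - x * q i) < ε)
    (H : ∀ (F : Finset A) (P : Finset D) (L : Finset G) (ε : ℝ), 0 < ε → ∀ k,
      ∃ h : (B.algTensor T).Completion, IsSelfAdjoint h ∧
      (∀ x ∈ F, (B.algTensor T).completion.seminorm k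
        (expI h * B.inlHom T x - B.inlHom T x * expI h) < ε) ∧
      (∀ d ∈ P, ∃ c, (B.algTensor T).completion.seminorm k
        (star (expI h) * B.inrHom T d * expI h - B.inlHom T c) < ε) ∧
      ∀ g ∈ L, (B.algTensor T).completion.seminorm k
        (tensorAut γ σ hγ hσ g (expI h) - expI h) < ε) :
    IsAbsorbing (Y.algTensor T).completion (Y.inlHom T) (tensorAct α σ hα hσ) := by
  classical
  have hr : ∀ d k, Y.seminorm k (r d) = T.seminorm () d := fun d k => by
    have e := hE 1 (star d * d)
    rw [map_one, one_mul, B.E_one, map_mul, map_star] at e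
    rw [seminorm, seminorm, e]
    simp
  refine isAbsorbing_of_inr fun F P L ε hε => ?_
  obtain ⟨F₁, P₁, δ₀, hδ₀, hF⟩ := exists_commutator_inl_lt (T := T) ho hd F hε
  obtain ⟨δ, hδ', hδ⟩ : ∃ δ, δ ≤ δ₀ ∧ 0 < δ ∧ δ < ε :=
    ⟨min δ₀ (ε / 2), min_le_left _ _, lt_min hδ₀ (half_pos hε),
      (min_le_right _ _).trans_lt (half_lt_self hε)⟩
  obtain ⟨n, C, hC, hlay⟩ := exists_layers (l := B.inlHom T) (r := B.inrHom T)
    (β := fun g => tensorAut γ σ hγ hσ g) (fun g x k => seminorm_map (E_tensorAct hγ hσ g) k x)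
    (fun g x y => map_sub _ _ _) hz.inl (F₁.disjSum (P.disjSum L)) (ε := δ / 2) fun k => by
      obtain ⟨h, hh, h₁, h₂, h₃⟩ := H F₁ P L (δ / 2) (half_pos hδ.1) k
      choose! c hc using h₂
      refine ⟨h, c, hh, fun i hi => ?_⟩
      match i, hi with
      | .inl a, hi => exact h₁ a (Finset.inl_mem_disjSum.1 hi)
      | .inr (.inl d), hi => exact hc d (Finset.inl_mem_disjSum.1 (Finset.inr_mem_disjSum.1 hi))
      | .inr (.inr g), hi => exact h₃ g (Finset.inr_mem_disjSum.1 (Finset.inr_mem_disjSum.1 hi))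
  -- Choose the trace of the projections small in comparison with the number of bad layers.
  have hη : 0 < δ / (2 * (n + 1) * (C + 1)) := by have := hδ.1; positivity
  obtain ⟨N, hN⟩ := hq _ hη
  obtain ⟨V, c, hV, hVC, hVδ⟩ := hlay N
  obtain ⟨q, hq, hqη, hqP⟩ := hN P₁ (δ / (N + 1)) (by have := hδ.1; positivity)
  have hsqrt := sqrt_sq_add_le n hδ.1.le hC
  have hNδ : (N : ℝ) * (δ / (N + 1)) ≤ δ := by
    rw [mul_div_assoc', div_le_iff₀ (by positivity)]
    nlinarith [hδ.1]
  obtain ⟨v, hv, h₁, h₂, h₃, h₄⟩ := exists_glued_unitary (Q := (Y.algTensor T).completion)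
    (j := outerHom T hl) (ρ := (Y.inlHom T).comp r) (i := Y.inlHom T) (l := B.inlHom T)
    (r := B.inrHom T) (β := fun g => tensorAut γ σ hγ hσ g) (β' := fun g => tensorAut α σ hα hσ g)
    (l' := l) (r' := r) (inlHom_mul_outerHom_comm hl hlr) (E_inlHom_mul_outerHom hl hlr hE)
    (fun d => (norm2u_inl _).trans_le (norm2u_le _ (T.norm2u_nonneg d) fun k =>
      (hr d k).trans_le (T.seminorm_le_norm2u _ _)))
    (fun g d => (tensorAct_inl hα hσ g (r d)).trans (congrArg (Y.inlHom T) (hαr g d)))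
    (fun g x => tensorMap_tensorAct hγ hσ hα hσ hl (intertwinesE_id T) hαl (fun _ _ => rfl) g x)
    (outerHom_inl hl) (fun _ => rfl) F₁ P P₁ L hV hVC hVδ hq hqη
    fun m d hd => (hqP m d hd).le
  refine ⟨v, hv, hF v hv (fun a ha => (h₁ a ha).trans (hsqrt.trans hδ'))
    (fun d hd => (h₂ d hd).trans (hNδ.trans hδ')), fun d hd => ?_,
    fun g hg => (h₄ g hg).trans_lt (hsqrt.trans_lt hδ.2)⟩
  obtain ⟨c, hc⟩ := h₃ d hd
  rw [outerHom_inr] at hc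
  exact ⟨c, hc.trans_lt (hsqrt.trans_lt hδ.2)⟩

end triple

end TracialAlgebra

/-! ### Fiber-wise absorption -/

namespace TracialSystem

variable {G : Type*} [Group G] {K : Type u} [TopologicalSpace K] [CompactSpace K]

/-- The system `T` with the trivial action. -/
abbrev trivial (T : TracialSystem G Unit) : TracialSystem G Unit where
  carrier := T.carrier
  alg := T.alg
  bdd := T.bdd
  act := 1
  E_act _ _ := rfl

section tensor

variable (S : TracialSystem G K) (T : TracialSystem G Unit)

/-- The first factor embedding `S → S ⊗̄ T`. -/
noncomputable def inlHom : S.carrier →⋆ₐ[ℂ] (S.tensor T).carrier := S.alg.inlHom T.alg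

/-- The second factor embedding `T → S ⊗̄ T`. -/
noncomputable def inrHom : T.carrier →⋆ₐ[ℂ] (S.tensor T).carrier := S.alg.inrHom T.alg

/-- The embedding of the algebraic tensor product in `S ⊗̄ T`. -/
noncomputable def ofTensor : S.carrier ⊗[ℂ] T.carrier →⋆ₐ[ℂ] (S.tensor T).carrier :=
  TracialAlgebra.of (B := S.alg.algTensor T.alg) TracialAlgebra.IsBounded.bdd

variable {S T}

theorem inlHom_intertwinesE : S.alg.IntertwinesE (S.tensor T).alg id (S.inlHom T) :=
  TracialAlgebra.inl_intertwinesE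

theorem inlHom_mul_inrHom_comm (a : S.carrier) (d : T.carrier) :
    S.inlHom T a * S.inrHom T d = S.inrHom T d * S.inlHom T a :=
  TracialAlgebra.inl_mul_inr_comm a d

theorem E_inlHom_mul_inrHom (a : S.carrier) (d : T.carrier) :
    (S.tensor T).alg.E (S.inlHom T a * S.inrHom T d) = T.alg.E d () • S.alg.E a :=
  TracialAlgebra.E_inl_mul_inr a d

theorem ofTensor_tmul (a : S.carrier) (d : T.carrier) :
    S.ofTensor T (a ⊗ₜ d) = S.inlHom T a * S.inrHom T d :=
  TracialAlgebra.of_tmul a d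

theorem exists_ofTensor_near (x : (S.tensor T).carrier) (ε : ℝ) (hε : 0 < ε) :
    ∃ t, (S.tensor T).alg.norm2u (x - S.ofTensor T t) < ε :=
  TracialAlgebra.exists_of_near x hε

theorem inlHom_act (g : G) (a : S.carrier) :
    S.inlHom T (S.act g a) = (S.tensor T).act g (S.inlHom T a) :=
  (TracialAlgebra.tensorAct_inl S.E_act T.E_act g a).symm

theorem act_inrHom (g : G) (d : T.carrier) :
    (S.tensor T).act g (S.inrHom T d) = S.inrHom T (T.act g d) :=
  TracialAlgebra.tensorAct_inr S.E_act T.E_act g d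

end tensor

/-- The gluing theorem for systems: if `exp(i h)` with `h` in `S ⊗̄ T` solves the absorption problem
locally at every point of the base, then `S ⊗̄ T` with the trivial action on the factor `T` absorbs
`T`. -/
theorem cocycleConjugate_tensor_of_local [Countable G] [T2Space K] {S : TracialSystem G K}
    {T : TracialSystem G Unit} (hS : S.alg.IsSeparable) (hT : T.alg.IsSeparable)
    {z : C(K, ℂ) →⋆ₐ[ℂ] S.carrier} (hz : S.alg.IsCentralInclusion z)
    (hq : ∀ η : ℝ, 0 < η → ∃ N : ℕ, ∀ (F : Finset T.carrier) (ε : ℝ), 0 < ε →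
      ∃ q : Fin N → T.carrier, IsProjectionPartition q ∧ (∀ i, T.alg.seminorm () (q i) ≤ η) ∧
        ∀ i, ∀ x ∈ F, T.alg.norm2u (q i * x - x * q i) < ε)
    (H : ∀ (F : Finset S.carrier) (P : Finset T.carrier) (L : Finset G) (ε : ℝ), 0 < ε → ∀ k,
      ∃ h : (S.alg.algTensor T.alg).Completion, IsSelfAdjoint h ∧
      (∀ x ∈ F, (S.alg.algTensor T.alg).completion.seminorm k
        (TracialAlgebra.expI h * S.alg.inlHom T.alg x -
          S.alg.inlHom T.alg x * TracialAlgebra.expI h) < ε) ∧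
      (∀ d ∈ P, ∃ c, (S.alg.algTensor T.alg).completion.seminorm k
        (star (TracialAlgebra.expI h) * S.alg.inrHom T.alg d * TracialAlgebra.expI h -
          S.alg.inlHom T.alg c) < ε) ∧
      ∀ g ∈ L, (S.alg.algTensor T.alg).completion.seminorm k
        (TracialAlgebra.tensorAut S.act T.act S.E_act T.E_act g (TracialAlgebra.expI h) -
          TracialAlgebra.expI h) < ε) :
    (S.tensor T.trivial).CocycleConjugate ((S.tensor T.trivial).tensor T) :=
  cocycleConjugate_tensor_of_isAbsorbing (hS.algTensor hT).completion hT
    (TracialAlgebra.isAbsorbing_of_local (Y := (S.tensor T.trivial).alg)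
      (l := S.inlHom T.trivial) (r := S.inrHom T.trivial) (α := (S.tensor T.trivial).act)
      (o := S.ofTensor T.trivial) S.E_act T.E_act (S.tensor T.trivial).E_act inlHom_intertwinesE
      inlHom_act (fun g d => act_inrHom g d) inlHom_mul_inrHom_comm E_inlHom_mul_inrHom
      ofTensor_tmul exists_ofTensor_near hz hq H)

end TracialSystem

namespace WStarBundle

variable {G : Type*} [Group G] {K : Type u} [TopologicalSpace K] [CompactSpace K] {M : Type v}
  [CStarAlgebra M] (B : WStarBundle K M)

theorem isCentralInclusion_incl (γ : G →* (M ≃⋆ₐ[ℂ] M)) (hγ : B.IsFiberwise γ) :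
    (B.system γ hγ).alg.IsCentralInclusion B.incl where
  central := B.incl_central
  E_mul f a k := congrArg (fun h : C(K, ℂ) => h k) (B.E_incl_mul f a)

/-- If the fiber at `k` absorbs a strongly McDuff system, then there are local solutions at `k`. -/
theorem exists_local_solution [PartialOrder M] [StarOrderedRing M] {γ : G →* (M ≃⋆ₐ[ℂ] M)}
    {hγ : B.IsFiberwise γ} {T : TracialSystem G Unit} (hT : T.IsStronglyMcDuff) {k : K}
    (hk : (B.fiberSystem k γ hγ).CocycleConjugate ((B.fiberSystem k γ hγ).tensor T))
    (F : Finset (B.system γ hγ).carrier) (P : Finset T.carrier) (L : Finset G) {ε : ℝ}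
    (hε : 0 < ε) :
    ∃ h : ((B.system γ hγ).alg.algTensor T.alg).Completion, IsSelfAdjoint h ∧
      (∀ x ∈ F, ((B.system γ hγ).alg.algTensor T.alg).completion.seminorm k
        (TracialAlgebra.expI h * (B.system γ hγ).alg.inlHom T.alg x -
          (B.system γ hγ).alg.inlHom T.alg x * TracialAlgebra.expI h) < ε) ∧
      (∀ d ∈ P, ∃ c, ((B.system γ hγ).alg.algTensor T.alg).completion.seminorm k
        (star (TracialAlgebra.expI h) * (B.system γ hγ).alg.inrHom T.alg d *
          TracialAlgebra.expI h - (B.system γ hγ).alg.inlHom T.alg c) < ε) ∧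
      ∀ g ∈ L, ((B.system γ hγ).alg.algTensor T.alg).completion.seminorm k
        (TracialAlgebra.tensorAut (B.system γ hγ).act T.act (B.system γ hγ).E_act T.E_act g
          (TracialAlgebra.expI h) - TracialAlgebra.expI h) < ε :=
  TracialAlgebra.exists_lift_unitary (B := (B.system γ hγ).alg)
    (B₀ := (B.fiberSystem k γ hγ).alg) (B.system γ hγ).E_act (B.fiberSystem k γ hγ).E_act T.E_act
    (f := B.toFiber k) (fun a u => B.fiberE_toFiber k a u) (B.toFiber_surjective k)
    (fun g a => (B.fiberAct_toFiber k γ hγ g a).symm)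
    (fun F P L _ hε => hk.exists_unitary hT F P L hε) F P L hε

end WStarBundle

theorem mainTheorem5
    {G : Type*} [Group G] [Countable G]
    {K : Type*} [TopologicalSpace K] [CompactSpace K] [TopologicalSpace.MetrizableSpace K]
    {M : Type*} [CStarAlgebra M] [PartialOrder M] [StarOrderedRing M]
    (B : WStarBundle K M) (hB : B.StrictlySeparable)
    (γ : G →* (M ≃⋆ₐ[ℂ] M)) (hγ : B.IsFiberwise γ)
    {R : Type*} [CStarAlgebra R] (T : WStarBundle Unit R) (hT : IsHyperfiniteII1Factor T)
    (δ : G →* (R ≃⋆ₐ[ℂ] R)) (hδ : T.IsFiberwise δ) (hMcDuff : IsMcDuff T δ hδ)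
    (hfiber : ∀ k : K, (B.fiberSystem k γ hγ).CocycleConjugate
      ((B.fiberSystem k γ hγ).tensor (T.system δ hδ))) :
    ((B.system γ hγ).tensor (T.system 1 T.isFiberwise_one)).CocycleConjugate
      (((B.system γ hγ).tensor (T.system 1 T.isFiberwise_one)).tensor (T.system δ hδ)) := by
  obtain ⟨σ, hσ, hσT, hδσ⟩ := hMcDuff
  obtain ⟨s, hs, hsB⟩ := hB
  -- It suffices to absorb the strongly McDuff action `σ`.
  refine TracialSystem.CocycleConjugate.trans ?_ (hδσ.symm.tensor_left _)
  exact TracialSystem.cocycleConjugate_tensor_of_local (S := B.system γ hγ) (T := T.system σ hσ)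
    (TracialAlgebra.isSeparable_of_countable s hs hsB)
    (WStarBundle.isSeparable_of_hyperfinite (R := R) (T := T) hT)
    (B.isCentralInclusion_incl γ hγ)
    (fun η hη => TracialSystem.exists_central_partition hT hσT hη)
    fun F P L ε hε k => B.exists_local_solution hσT
      ((hfiber k).trans (hδσ.tensor_left _)) F P L hε
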